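/- Let $d\ge 1$ and let $Z(t)$, $t\in\mathbb R^d$, be a non-negative random field on a probability space $(\Omega,\mathcal F,\mathbb P)$ whose sample paths are almost surely (generalised) càdlàg, i.e. at every point they have finite limits along each of the $2^d$ quadrants (given by the relations $<$ and $\ge$ in the single coordinates) and are continuous along the quadrant of points that are $\ge$ in all coordinates. Suppose that $\mathbb E[Z(t)]=1$ for all $t\in\mathbb R^d$, that $\mathbb E[\sup_{t\in[0,T]^d}Z(t)]<\infty$ for all $T>0$, and that $\mathbb P(\sup_{t\in\mathbb R^d}Z(t)>0)=1$. Suppose that the max-stable random field $$X(t)=\max_{i\ge 1}\Gamma_i^{-1}Z^{(i)}(t),\qquad t\in\mathbb R^d,$$ is stationary (its finite-dimensional distributions are invariant under all shifts), where $\Gamma_i=\mathcal V_1+\dots+\mathcal V_i$, the $\mathcal V_k$ are independent unit exponential random variables, and the $Z^{(i)}$ are independent copies of $Z$ that are independent of $(\mathcal V_k)_{k\ge1}$. Let $\lambda_0$ be Lebesgue measure on $0\mathbb Z^d:=\mathbb R^d$ and, for $\delta>0$, let $\lambda_\delta$ be $\delta^d$ times the counting measure on $\delta\mathbb Z^d$.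 Write $S_\delta(f)=\int_{\delta\mathbb Z^d}f(t)\,\lambda_\delta(dt)\in[0,\infty]$, $S_\delta=S_\delta(Z)$, and $(B^rZ)(t)=Z(t-r)$. Quotients are taken in $[0,\infty]$ with $a/\infty=0$ for finite $a$ and $0/0=0$. Assume $\mathbb P(S_0=\infty)<1$. Then for all $\delta\ge 0$ and $x\ge 0$ the limit $$\mathcal B_Z^\delta(x):=\lim_{T\to\infty}\frac1{T^d}\int_0^\infty\mathbb P\Big(\int_{[0,T]^d\cap\delta\mathbb Z^d}\mathbb I(Z(t)>s)\,\lambda_\delta(dt)>x\Big)\,ds$$ exists, and $$\mathcal B_Z^\delta(x)=\int_0^\infty\mathbb E\Big[\frac{Z(0)}{S_\delta}\,\mathbb I\Big(\int_{\delta\mathbb Z^d}\mathbb I(Z(t)>s)\,\lambda_\delta(dt)>x\Big)\Big]\,ds<\infty .$$ Moreover, let $\eta>0$ if $\delta=0$, and $\eta=k\delta$ with an integer $k\ge 1$ if $\delta>0$. If for every $r\in\delta\mathbb Z^d$, almost surely, $S_0(Z)<\infty$ implies $0<S_\eta(B^rZ)<\infty$, then $$\mathcal B_Z^\delta(x)=\int_0^\infty\mathbb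 E\Big[\frac{Z(0)}{S_\eta}\,\mathbb I\Big(\int_{\delta\mathbb Z^d}\mathbb I(Z(t)>s)\,\lambda_\delta(dt)>x\Big)\Big]\,ds<\infty .$$ -/

import Mathlib

open MeasureTheory ProbabilityTheory Filter Topology
open scoped ENNReal

/-- The quadrant with apex `t` in which the coordinates in `J` lie strictly below those of `t`
and the other ones lie at or above those of `t`. -/
def quadrant {d : ℕ} (J : Set (Fin d)) (t : Fin d → ℝ) : Set (Fin d → ℝ) :=
  {u | ∀ i, (i ∈ J → u i < t i) ∧ (i ∉ J → t i ≤ u i)}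

/-- Generalised càdlàg functions on `ℝ^d`: at each point the function has a finite limit along
each of the `2^d` quadrants, and it is continuous along the upper closed quadrant. -/
def IsCadlagField {d : ℕ} (f : (Fin d → ℝ) → ℝ) : Prop :=
  ∀ t, (∀ J : Set (Fin d), ∃ l : ℝ, Tendsto f (𝓝[quadrant J t] t) (𝓝 l)) ∧
    Tendsto f (𝓝[quadrant ∅ t] t) (𝓝 (f t))

/-- The cube `[0,T]^d`. -/
def cube (d : ℕ) (T : ℝ) : Set (Fin d → ℝ) :=
  {t | ∀ i, 0 ≤ t i ∧ t i ≤ T}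

open Classical in
/-- The set `δℤ^d`, read as `ℝ^d` when `δ = 0`. -/
noncomputable def scaledLattice (d : ℕ) (δ : ℝ) : Set (Fin d → ℝ) :=
  if δ = 0 then Set.univ else Set.range fun (k : Fin d → ℤ) (i : Fin d) => δ * (k i : ℝ)

open Classical in
/-- The measure `λ_δ`: Lebesgue measure on `ℝ^d` if `δ = 0`, and `δ^d` times the counting measure
on `δℤ^d` if `δ > 0`. -/
noncomputable def latticeMeasure (d : ℕ) (δ : ℝ) : Measure (Fin d → ℝ) :=
  if δ = 0 then volume
  else ENNReal.ofReal (δ ^ d) • Measure.count.restrict (scaledLattice d δ)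

/-- `S_δ(f) = ∫_{δℤ^d} f dλ_δ` for a non-negative function `f`, with values in `[0,∞]`. -/
noncomputable def totalMass {d : ℕ} (δ : ℝ) (f : (Fin d → ℝ) → ℝ) : ℝ≥0∞ :=
  ∫⁻ t in scaledLattice d δ, ENNReal.ofReal (f t) ∂(latticeMeasure d δ)

/-- The shift `(B^h f)(t) = f(t - h)`. -/
def fieldShift {d : ℕ} (h : Fin d → ℝ) (f : (Fin d → ℝ) → ℝ) : (Fin d → ℝ) → ℝ :=
  fun t => f (t - h)

/-- The sojourn `∫_A 1(f(t) > s) λ_δ(dt)`, that is, the `λ_δ`-measure of the part of `A` on which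
`f` exceeds `s`. -/
noncomputable def sojourn {d : ℕ} (δ : ℝ) (f : (Fin d → ℝ) → ℝ) (A : Set (Fin d → ℝ)) (s : ℝ) :
    ℝ≥0∞ :=
  latticeMeasure d δ {t | t ∈ A ∧ s < f t}

section Fields

variable {d : ℕ} {Ω Ω' : Type*} [MeasurableSpace Ω] [MeasurableSpace Ω']

/-- A non-negative random field on `ℝ^d` with almost surely càdlàg sample paths, `E Z(t) = 1` for
all `t`, `E sup_{[0,T]^d} Z < ∞` for all `T > 0`, and `sup_{ℝ^d} Z > 0` almost surely. -/
structure IsNormalisedField (P : Measure Ω) (Z : Ω → (Fin d → ℝ) → ℝ) : Prop where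
  measurable : ∀ t, Measurable fun ω => Z ω t
  paths : ∀ᵐ ω ∂P, (∀ t, 0 ≤ Z ω t) ∧ IsCadlagField (Z ω)
  mean_one : ∀ t, Integrable (fun ω => Z ω t) P ∧ ∫ ω, Z ω t ∂P = 1
  sup_integrable : ∀ T : ℝ, 0 < T → ∫⁻ ω, ⨆ t ∈ cube d T, ENNReal.ofReal (Z ω t) ∂P < ∞
  sup_pos : ∀ᵐ ω ∂P, 0 < ⨆ t, ENNReal.ofReal (Z ω t)

/-- The random ingredients of the de Haan representation: independent unit exponential variables
`V k`, and independent copies `W i` of the field `Z`, the two sequences being independent of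
each other. The laws of fields are taken on the product `σ`-algebra. -/
structure IsDeHaanInput (P : Measure Ω) (Z : Ω → (Fin d → ℝ) → ℝ) (P' : Measure Ω')
    (V : ℕ → Ω' → ℝ) (W : ℕ → Ω' → (Fin d → ℝ) → ℝ) : Prop where
  exp_law : ∀ k, HasLaw (V k) (expMeasure 1) P'
  exp_indep : iIndepFun V P'
  copies : ∀ i, IdentDistrib (W i) Z P' P
  copies_indep : iIndepFun W P'
  indep : IndepFun (fun ω k => V k ω) (fun ω i => W i ω) P'

/-- The max-stable field `X(t) = max_i Γ_i⁻¹ W_i(t)`, where `Γ_i = V_0 + ... + V_i`. -/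
noncomputable def maxStableField (V : ℕ → Ω' → ℝ) (W : ℕ → Ω' → (Fin d → ℝ) → ℝ)
    (ω : Ω') (t : Fin d → ℝ) : ℝ :=
  ⨆ i : ℕ, (∑ k ∈ Finset.range (i + 1), V k ω)⁻¹ * W i ω t

/-- Stationarity: the finite-dimensional distributions are invariant under all shifts. -/
def IsStationaryField (P' : Measure Ω') (X : Ω' → (Fin d → ℝ) → ℝ) : Prop :=
  ∀ (h : Fin d → ℝ) (I : Finset (Fin d → ℝ)),
    IdentDistrib (fun ω (t : I) => X ω ((t : Fin d → ℝ) + h)) (fun ω (t : I) => X ω t) P' P'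

/-- `B_Z^δ(A, x) = ∫_0^∞ P(∫_A 1(Z(t) > s) λ_δ(dt) > x) ds`. -/
noncomputable def bermanOn (P : Measure Ω) (Z : Ω → (Fin d → ℝ) → ℝ) (δ : ℝ)
    (A : Set (Fin d → ℝ)) (x : ℝ) : ℝ≥0∞ :=
  ∫⁻ s in Set.Ioi (0 : ℝ), P {ω | ENNReal.ofReal x < sojourn δ (Z ω) A s}

/-- `T^{-d} B_Z^δ([0,T]^d ∩ δℤ^d, x)`. -/
noncomputable def bermanAverage (P : Measure Ω) (Z : Ω → (Fin d → ℝ) → ℝ) (δ x T : ℝ) : ℝ≥0∞ :=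
  bermanOn P Z δ (cube d T ∩ scaledLattice d δ) x / ENNReal.ofReal (T ^ d)

/-- The Berman function `B_Z^δ(x)`: the limit, if it exists, of `T^{-d} B_Z^δ([0,T]^d ∩ δℤ^d, x)`
as `T → ∞`. -/
noncomputable def bermanFunction (P : Measure Ω) (Z : Ω → (Fin d → ℝ) → ℝ) (δ x : ℝ) : ℝ≥0∞ :=
  limUnder atTop (bermanAverage P Z δ x)

open Classical in
/-- `∫_0^∞ E[(Z(0)/S_η(Z)) 1(∫_{δℤ^d} 1(Z(t) > s) λ_δ(dt) > x)] ds`. The quotient is taken in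
`[0,∞]`, so that a finite number over `∞` is `0`, and `0/0` is `0`. -/
noncomputable def bermanFormula (P : Measure Ω) (Z : Ω → (Fin d → ℝ) → ℝ) (δ η x : ℝ) : ℝ≥0∞ :=
  ∫⁻ s in Set.Ioi (0 : ℝ), ∫⁻ ω,
    ENNReal.ofReal (Z ω 0) / totalMass η (Z ω) *
      (if ENNReal.ofReal x < sojourn δ (Z ω) (scaledLattice d δ) s then 1 else 0) ∂P

end Fields

/-! Write Λ for λ_δ and let ν be the exponent measure: the image of ds ⊗ P on (0,∞) × Ω under (s, ω)
↦ s⁻¹Z(ω). An exceedance of the level s by Z is an exceedance of the level one by s⁻¹Z, so the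
Berman functional of a cube is ν{f : Λ{t in the cube : f(t) > 1} > x}, and the claim concerns the
growth of this quantity under an infinite but shift invariant measure.

Shift invariance comes from stationarity of X. The distribution functions of X are P(X(tᵢ) ≤ aᵢ for
all i) = exp(-E maxᵢ Z(tᵢ)/aᵢ) (`IsDeHaanInput.measure_maxStableField_le`), and the exponent is ν{f
: f(tᵢ) > aᵢ for some i}. These masses determine ν (`CadlagPath.measure_ext`), hence
`measurePreserving_shift`. The void probability behind the exponential formula is obtained by a
recursion over the arrivals.

The engine is mass transport (`lintegral_transport`): ∫∫ Φ(f,t) Λ(dt) ν(df) is unchanged if f is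
replaced by its shift by t. If 0 < ∫f dΛ < ∞, spread a unit mass over the points t with density
f(t)/∫f dΛ. Transport moves t to the origin, where the density becomes f(0)/∫f dΛ, and each point of
the cube contributes equally. This gives the formula as a lower bound for the liminf. For the upper
bound two errors must be o(T^d): mass lying outside the cube, and paths with ∫f dΛ = ∞. Both are
controlled by spreading mass over the points near an exceedance, whose intensity ν{0 is near} is at
most E sup Z over [0,2]^d (`IsLatticeHaar.tendsto_negligible`).

For paths of infinite mass this needs infinitely many near points. Indeed the superlevel set of such
a path has measure 0 or ∞ (`IsLatticeHaar.ae_exceedance_zero_or_top`): otherwise the levels whose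
superlevel sets have moderate measure would define an equivariant, scale invariant probability
density p on the orbit, while transport gives E[∫Z dΛ · p(Z,t)] ≤ 1, which forces p = 0 when ∫Z dΛ =
∞.

Finally S_δ may be replaced by S_η by one more transport
(`IsLatticeHaar.lintegral_indicator_mul_originShare`), because f(0)/S_η(f) integrates to one along
the orbit of f whenever the masses of its shifts are positive and finite. -/

section ExponentialArrivals

/-! ### Void probabilities of marked exponential arrivals. -/

/-- Integration against the unit exponential distribution. -/
theorem lintegral_expMeasure_one (g : ℝ → ℝ≥0∞) (hg : Measurable g) :
    ∫⁻ v, g v ∂(expMeasure 1) = ∫⁻ v in Set.Ioi 0, ENNReal.ofReal (Real.exp (-v)) * g v := by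
  have hm : Measurable (gammaPDF 1 1) := (measurable_gammaPDFReal 1 1).ennreal_ofReal
  rw [expMeasure, gammaMeasure, lintegral_withDensity_eq_lintegral_mul _ hm hg,
    ← lintegral_add_compl _ (measurableSet_Ici (a := (0 : ℝ)))]
  have h1 : ∫⁻ v in (Set.Ici (0 : ℝ))ᶜ, (gammaPDF 1 1 * g) v = 0 := by
    rw [setLIntegral_congr_fun (g := fun _ => 0) measurableSet_Ici.compl, lintegral_zero]
    intro v hv
    simp only [Set.compl_Ici, Set.mem_Iio] at hv
    simp [gammaPDF_of_neg hv]
  rw [h1, add_zero, ← restrict_Ioi_eq_restrict_Ici]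
  refine setLIntegral_congr_fun measurableSet_Ioi fun v hv => ?_
  simp [gammaPDF_of_nonneg (le_of_lt hv)]

theorem ae_expMeasure_one_pos : ∀ᵐ v ∂(expMeasure 1), (0 : ℝ) < v := by
  rw [ae_iff]
  have hms : MeasurableSet {a : ℝ | ¬ 0 < a} := measurableSet_Ioi.compl
  rw [← lintegral_indicator_one hms, lintegral_expMeasure_one _ (by measurability)]
  rw [setLIntegral_congr_fun (g := fun _ => 0) measurableSet_Ioi, lintegral_zero]
  intro v hv
  have hv' : (0 : ℝ) < v := hv
  simp [hv']

/-- The probability that independent variables with law `μ` stay below independent arrival times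
`a + v₀ + ⋯ + vᵢ`, given those times. -/
noncomputable def belowArrivals (μ : Measure ℝ) (n : ℕ) (a : ℝ) (v : Fin n → ℝ) : ℝ≥0∞ :=
  ∏ i : Fin n, μ (Set.Iic (a + ∑ k ∈ Finset.univ.filter (· ≤ i), v k))

theorem measurable_measure_Iic (μ : Measure ℝ) : Measurable fun u : ℝ => μ (Set.Iic u) :=
  (show Monotone fun u : ℝ => μ (Set.Iic u) from
    fun _ _ h => measure_mono (Set.Iic_subset_Iic.2 h)).measurable

theorem measurable_belowArrivals (μ : Measure ℝ) (n : ℕ) (a : ℝ) : Measurable (belowArrivals μ n a) := by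
  unfold belowArrivals
  refine Finset.measurable_prod _ fun i _ => (measurable_measure_Iic μ).comp ?_
  fun_prop

theorem belowArrivals_cons (μ : Measure ℝ) (n : ℕ) (a x : ℝ) (v : Fin n → ℝ) :
    belowArrivals μ (n + 1) a (Fin.cons x v) =
      μ (Set.Iic (a + x)) * belowArrivals μ n (a + x) v := by
  have key : ∀ i : Fin (n + 1), (∑ k ∈ Finset.univ.filter (· ≤ i), (Fin.cons x v : Fin (n + 1) → ℝ) k)
      = x + ∑ k : Fin n, if k.succ ≤ i then v k else 0 := by
    intro i
    rw [Finset.sum_filter, Fin.sum_univ_succ]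
    simp
  unfold belowArrivals
  rw [Fin.prod_univ_succ]
  congr 1
  · rw [key]
    simp
  · refine Finset.prod_congr rfl fun i _ => ?_
    rw [key]
    simp only [Fin.succ_le_succ_iff, Finset.sum_filter, add_assoc]

/-- The probability that `n` independent variables with law `μ` stay below the arrival times of a
Poisson process started at `a`. -/
noncomputable def survival (μ : Measure ℝ) (n : ℕ) (a : ℝ) : ℝ≥0∞ :=
  ∫⁻ v, belowArrivals μ n a v ∂(Measure.pi fun _ : Fin n => expMeasure 1)

/-- Condition on the first waiting time v: the first variable must stay below a + v, and the
remaining n face a process restarted there. -/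
theorem survival_succ (μ : Measure ℝ) (n : ℕ) (a : ℝ) :
    survival μ (n + 1) a =
      ∫⁻ v in Set.Ioi 0, ENNReal.ofReal (Real.exp (-v)) *
        (μ (Set.Iic (a + v)) * survival μ n (a + v)) := by
  have := isProbabilityMeasure_expMeasure (zero_lt_one (α := ℝ))
  have hmp := (measurePreserving_piFinSuccAbove (fun _ : Fin (n + 1) => expMeasure 1) 0).symm
  have hjoint : Measurable fun p : ℝ × (Fin n → ℝ) =>
      μ (Set.Iic (a + p.1)) * belowArrivals μ n (a + p.1) p.2 := by
    refine Measurable.mul ((measurable_measure_Iic μ).comp (by fun_prop)) ?_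
    unfold belowArrivals
    refine Finset.measurable_prod _ fun i _ => (measurable_measure_Iic μ).comp ?_
    fun_prop
  have hcomp : ∀ p : ℝ × (Fin n → ℝ), belowArrivals μ (n + 1) a
      ((MeasurableEquiv.piFinSuccAbove (fun _ => ℝ) 0).symm p) =
      μ (Set.Iic (a + p.1)) * belowArrivals μ n (a + p.1) p.2 := by
    intro p
    rw [← belowArrivals_cons]
    congr 1
    simp [MeasurableEquiv.piFinSuccAbove, Fin.insertNthEquiv]
  unfold survival
  rw [← hmp.lintegral_comp (measurable_belowArrivals μ (n + 1) a)]
  simp_rw [hcomp]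
  rw [lintegral_prod _ hjoint.aemeasurable]
  have hin : ∀ x : ℝ, ∫⁻ y, μ (Set.Iic (a + x)) * belowArrivals μ n (a + x) y
        ∂(Measure.pi fun j : Fin n => expMeasure 1) =
      μ (Set.Iic (a + x)) * ∫⁻ y, belowArrivals μ n (a + x) y
        ∂(Measure.pi fun j : Fin n => expMeasure 1) := fun x =>
    lintegral_const_mul _ (measurable_belowArrivals μ n (a + x))
  simp only [hin]
  have hm2 : Measurable fun x => μ (Set.Iic (a + x)) * ∫⁻ y, belowArrivals μ n (a + x) y
        ∂(Measure.pi fun j : Fin n => expMeasure 1) := by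
    simp_rw [← hin]
    exact hjoint.lintegral_prod_right'
  exact lintegral_expMeasure_one _ hm2

/-- The integrated tail `∫₀^a μ(u, ∞) du`. -/
noncomputable def integratedTail (μ : Measure ℝ) (a : ℝ) : ℝ := ∫ u in (0 : ℝ)..a, (1 - cdf μ u)

theorem one_sub_cdf_mem (μ : Measure ℝ) (u : ℝ) : 1 - cdf μ u ∈ Set.Icc (0 : ℝ) 1 :=
  ⟨by linarith [cdf_le_one μ u], by linarith [cdf_nonneg μ u]⟩

theorem intervalIntegrable_one_sub_cdf (μ : Measure ℝ) (a b : ℝ) :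
    IntervalIntegrable (fun u => 1 - cdf μ u) volume a b :=
  intervalIntegrable_const.sub (monotone_cdf μ).intervalIntegrable

/-- A distribution function is only right continuous, so only the right derivative is available; the
fundamental theorem of calculus needs no more. -/
theorem hasDerivWithinAt_integratedTail (μ : Measure ℝ) (a : ℝ) :
    HasDerivWithinAt (integratedTail μ) (1 - cdf μ a) (Set.Ioi a) a := by
  have hc : ContinuousWithinAt (fun u => 1 - cdf μ u) (Set.Ioi a) a :=
    (continuousWithinAt_const.sub ((cdf μ).right_continuous a)).mono Set.Ioi_subset_Ici_self
  have hm : Measurable fun u => 1 - cdf μ u := measurable_const.sub (monotone_cdf μ).measurable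
  exact (intervalIntegral.integral_hasDerivWithinAt_right (s := Set.Ici a) (t := Set.Ioi a)
    (intervalIntegrable_one_sub_cdf μ 0 a)
    hm.stronglyMeasurable.stronglyMeasurableAtFilter hc).mono
    Set.Ioi_subset_Ici_self

theorem continuous_integratedTail (μ : Measure ℝ) : Continuous (integratedTail μ) :=
  intervalIntegral.continuous_primitive (fun a b => intervalIntegrable_one_sub_cdf μ a b) 0

theorem tendsto_integratedTail (μ : Measure ℝ) [IsProbabilityMeasure μ]
    (hmean : ∫⁻ y, ENNReal.ofReal y ∂μ ≠ ∞) :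
    Tendsto (integratedTail μ) atTop (𝓝 (∫⁻ y, ENNReal.ofReal y ∂μ).toReal) := by
  have hlc : ∫⁻ y, ENNReal.ofReal y ∂μ = ∫⁻ u in Set.Ioi 0, ENNReal.ofReal (1 - cdf μ u) := by
    have h := lintegral_eq_lintegral_meas_lt μ (f := fun y : ℝ => max y 0)
      (ae_of_all _ fun y => le_max_right y 0) (by fun_prop)
    have h1 : ∀ y : ℝ, ENNReal.ofReal (max y 0) = ENNReal.ofReal y := fun y => by
      rcases le_total y 0 with hy | hy <;> simp [hy, ENNReal.ofReal_of_nonpos]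
    simp only [h1] at h
    rw [h]
    refine setLIntegral_congr_fun measurableSet_Ioi fun u hu => ?_
    have hu' : (0 : ℝ) < u := hu
    have h2 : {a : ℝ | u < max a 0} = (Set.Iic u)ᶜ := by
      ext a; simp [not_lt.2 hu'.le]
    rw [h2, measure_compl measurableSet_Iic (measure_ne_top _ _), measure_univ,
      ENNReal.ofReal_sub _ (cdf_nonneg μ u), cdf_eq_real, ofReal_measureReal, ENNReal.ofReal_one]
  have hm : Measurable fun u => 1 - cdf μ u := measurable_const.sub (monotone_cdf μ).measurable
  have hint : IntegrableOn (fun u => 1 - cdf μ u) (Set.Ioi 0) := by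
    refine ⟨hm.aestronglyMeasurable, ?_⟩
    rw [hasFiniteIntegral_iff_ofReal (ae_of_all _ fun u => (one_sub_cdf_mem μ u).1), ← hlc]
    exact hmean.lt_top
  have h := intervalIntegral_tendsto_integral_Ioi 0 hint tendsto_id
  rwa [integral_eq_lintegral_of_nonneg_ae (ae_of_all _ fun u => (one_sub_cdf_mem μ u).1)
    hm.aestronglyMeasurable, ← hlc] at h

theorem integratedTail_monotone (μ : Measure ℝ) : Monotone (integratedTail μ) := by
  intro a b hab
  have h : integratedTail μ b - integratedTail μ a = ∫ u in a..b, (1 - cdf μ u) :=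
    intervalIntegral.integral_interval_sub_left (intervalIntegrable_one_sub_cdf μ _ _)
      (intervalIntegrable_one_sub_cdf μ _ _)
  have h2 : 0 ≤ ∫ u in a..b, (1 - cdf μ u) :=
    intervalIntegral.integral_nonneg_of_forall hab fun u => (one_sub_cdf_mem μ u).1
  linarith

/-- `exp (-E (Y - a)⁺)` for `Y` with law `μ`. -/
noncomputable def limitSurvival (μ : Measure ℝ) (a : ℝ) : ℝ :=
  Real.exp (integratedTail μ a - (∫⁻ y, ENNReal.ofReal y ∂μ).toReal)

theorem limitSurvival_le_one (μ : Measure ℝ) [IsProbabilityMeasure μ]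
    (hmean : ∫⁻ y, ENNReal.ofReal y ∂μ ≠ ∞) (a : ℝ) : limitSurvival μ a ≤ 1 := by
  rw [limitSurvival, Real.exp_le_one_iff, sub_nonpos]
  exact (integratedTail_monotone μ).ge_of_tendsto (tendsto_integratedTail μ hmean) a

theorem continuous_limitSurvival (μ : Measure ℝ) : Continuous (limitSurvival μ) :=
  Real.continuous_exp.comp ((continuous_integratedTail μ).sub continuous_const)

theorem limitSurvival_nonneg (μ : Measure ℝ) (a : ℝ) : 0 ≤ limitSurvival μ a := (Real.exp_pos _).le

theorem tendsto_limitSurvival (μ : Measure ℝ) [IsProbabilityMeasure μ]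
    (hmean : ∫⁻ y, ENNReal.ofReal y ∂μ ≠ ∞) : Tendsto (limitSurvival μ) atTop (𝓝 1) := by
  have h := (tendsto_integratedTail μ hmean).sub_const (∫⁻ y, ENNReal.ofReal y ∂μ).toReal
  rw [sub_self] at h
  have h2 := (Real.continuous_exp.tendsto 0).comp h
  rwa [Real.exp_zero] at h2

/-- `limitSurvival` is a fixed point of the recursion satisfied by `survival`. -/
theorem lintegral_limitSurvival (μ : Measure ℝ) [IsProbabilityMeasure μ]
    (hmean : ∫⁻ y, ENNReal.ofReal y ∂μ ≠ ∞) (a : ℝ) :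
    ∫⁻ v in Set.Ioi 0, ENNReal.ofReal (Real.exp (-v)) *
      (μ (Set.Iic (a + v)) * ENNReal.ofReal (limitSurvival μ (a + v))) =
    ENNReal.ofReal (limitSurvival μ a) := by
  -- With G = `limitSurvival` one has G' = (1 - F)G from the right, so -e^{-v}G(a+v) has right
  -- derivative e^{-v}F(a+v)G(a+v): `k` is an antiderivative of the integrand `g`.
  set k : ℝ → ℝ := fun v => -(Real.exp (-v) * limitSurvival μ (a + v)) with hk
  set g : ℝ → ℝ := fun v => Real.exp (-v) * (cdf μ (a + v) * limitSurvival μ (a + v)) with hg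
  have hg0 : ∀ v, 0 ≤ g v := fun v =>
    mul_nonneg (Real.exp_pos _).le (mul_nonneg (cdf_nonneg μ _) (limitSurvival_nonneg μ _))
  have hgle : ∀ v, g v ≤ Real.exp (-v) := fun v =>
    mul_le_of_le_one_right (Real.exp_pos _).le
      (mul_le_one₀ (cdf_le_one μ _) (limitSurvival_nonneg μ _) (limitSurvival_le_one μ hmean _))
  have hkc : Continuous k := by
    have := continuous_limitSurvival μ
    fun_prop
  have hder : ∀ v, HasDerivWithinAt k (g v) (Set.Ioi v) v := by
    intro v
    have hadd : HasDerivWithinAt (fun v : ℝ => a + v) 1 (Set.Ioi v) v :=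
      ((hasDerivAt_id v).const_add a).hasDerivWithinAt
    have h1 : HasDerivWithinAt (fun v => integratedTail μ (a + v)) (1 - cdf μ (a + v))
        (Set.Ioi v) v := by
      have := (hasDerivWithinAt_integratedTail μ (a + v)).scomp v hadd
        (fun w (hw : v < w) => by simpa using hw)
      simpa [Function.comp_def] using this
    have h2 := (h1.sub_const (∫⁻ y, ENNReal.ofReal y ∂μ).toReal).exp
    have h3 : HasDerivWithinAt (fun v : ℝ => Real.exp (-v)) (Real.exp (-v) * (-1)) (Set.Ioi v) v :=
      (hasDerivAt_neg v).exp.hasDerivWithinAt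
    refine (h3.mul h2).neg.congr_deriv ?_
    simp only [hg, limitSurvival]
    ring
  have hgm : Measurable g := by
    have h1 : Measurable fun v => cdf μ (a + v) := (monotone_cdf μ).measurable.comp (by fun_prop)
    have h2 : Measurable fun v => limitSurvival μ (a + v) :=
      ((continuous_limitSurvival μ).comp (by fun_prop : Continuous fun v => a + v)).measurable
    exact (by fun_prop : Measurable fun v : ℝ => Real.exp (-v)).mul (h1.mul h2)
  have hexp : IntegrableOn (fun v : ℝ => Real.exp (-v)) (Set.Ioi 0) := by
    simpa using exp_neg_integrableOn_Ioi 0 one_pos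
  have hgi : IntegrableOn g (Set.Ioi 0) :=
    hexp.mono' hgm.aestronglyMeasurable
      (ae_of_all _ fun v => by rw [Real.norm_of_nonneg (hg0 v)]; exact hgle v)
  have hlim := intervalIntegral_tendsto_integral_Ioi 0 hgi tendsto_id
  have hval : ∀ b, 0 ≤ b → ∫ v in (0 : ℝ)..b, g v = k b - k 0 := fun b hb =>
    intervalIntegral.integral_eq_sub_of_hasDeriv_right hkc.continuousOn (fun v _ => hder v)
      ((intervalIntegrable_iff_integrableOn_Ioc_of_le hb).2 (hgi.mono_set Set.Ioc_subset_Ioi_self))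
  have hk0 : Tendsto k atTop (𝓝 0) := by
    have h1 : Tendsto (fun v : ℝ => Real.exp (-v)) atTop (𝓝 0) :=
      Real.tendsto_exp_neg_atTop_nhds_zero
    have h2 : Tendsto (fun v => limitSurvival μ (a + v)) atTop (𝓝 1) :=
      (tendsto_limitSurvival μ hmean).comp (tendsto_atTop_add_const_left _ a tendsto_id)
    simpa using (h1.mul h2).neg
  have hlim2 : Tendsto (fun b => ∫ v in (0 : ℝ)..b, g v) atTop (𝓝 (0 - k 0)) :=
    (hk0.sub_const (k 0)).congr' ((eventually_ge_atTop 0).mono fun b hb => (hval b hb).symm)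
  have hI : ∫ v in Set.Ioi 0, g v = limitSurvival μ a := by
    rw [tendsto_nhds_unique hlim hlim2]
    simp [hk]
  rw [← hI, ofReal_integral_eq_lintegral_ofReal hgi (ae_of_all _ hg0)]
  refine lintegral_congr fun v => ?_
  rw [hg, ENNReal.ofReal_mul (Real.exp_pos _).le, ENNReal.ofReal_mul (cdf_nonneg μ _),
    cdf_eq_real, ofReal_measureReal]

/-- The recursion is monotone, `limitSurvival` is its fixed point, and it starts below the value one
of `survival` at n = 0. -/
theorem limitSurvival_le_survival (μ : Measure ℝ) [IsProbabilityMeasure μ]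
    (hmean : ∫⁻ y, ENNReal.ofReal y ∂μ ≠ ∞) (n : ℕ) (a : ℝ) :
    ENNReal.ofReal (limitSurvival μ a) ≤ survival μ n a := by
  have := isProbabilityMeasure_expMeasure (zero_lt_one (α := ℝ))
  induction n generalizing a with
  | zero =>
    simpa [survival, belowArrivals] using limitSurvival_le_one μ hmean a
  | succ n ih =>
    rw [survival_succ, ← lintegral_limitSurvival μ hmean]
    gcongr with v
    exact ih _

/-- The recursion does not enlarge a constant error, and it at least halves an error proportional to
e^{-a}, because ∫₀^∞ e^{-v}e^{-(a+v)} dv = e^{-a}/2. Hence every part of the initial error except ε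
dies out geometrically. -/
theorem survival_le (μ : Measure ℝ) [IsProbabilityMeasure μ]
    (hmean : ∫⁻ y, ENNReal.ofReal y ∂μ ≠ ∞) {ε K : ℝ} (hε : 0 ≤ ε) (hK : 0 ≤ K)
    (h0 : ∀ a, 0 ≤ a → 1 ≤ limitSurvival μ a + (ε + K * Real.exp (-a))) (n : ℕ) (a : ℝ)
    (ha : 0 ≤ a) :
    survival μ n a ≤ ENNReal.ofReal (limitSurvival μ a) +
      ENNReal.ofReal (ε + K * Real.exp (-a) * (1 / 2) ^ n) := by
  have := isProbabilityMeasure_expMeasure (zero_lt_one (α := ℝ))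
  induction n generalizing a with
  | zero =>
    have h := h0 a ha
    rw [← ENNReal.ofReal_add (limitSurvival_nonneg μ a) (by positivity)]
    simpa [survival, belowArrivals] using h
  | succ n ih =>
    have hexp1 : IntegrableOn (fun v : ℝ => Real.exp (-v)) (Set.Ioi 0) := by
      simpa using exp_neg_integrableOn_Ioi 0 one_pos
    have hexp2 : IntegrableOn (fun v : ℝ => Real.exp (-2 * v)) (Set.Ioi 0) :=
      exp_neg_integrableOn_Ioi 0 two_pos
    have h1 : ∫ v in Set.Ioi (0 : ℝ), Real.exp (-v) = 1 := integral_exp_neg_Ioi_zero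
    have h2 : ∫ v in Set.Ioi (0 : ℝ), Real.exp (-2 * v) = 1 / 2 := by
      rw [integral_exp_mul_Ioi (by norm_num) 0]; norm_num
    have herr : ∫⁻ v in Set.Ioi (0 : ℝ), ENNReal.ofReal (Real.exp (-v)) *
        ENNReal.ofReal (ε + K * Real.exp (-(a + v)) * (1 / 2) ^ n) =
        ENNReal.ofReal (ε + K * Real.exp (-a) * (1 / 2) ^ (n + 1)) := by
      have heq : ∀ v : ℝ, ENNReal.ofReal (Real.exp (-v)) *
          ENNReal.ofReal (ε + K * Real.exp (-(a + v)) * (1 / 2) ^ n) =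
          ENNReal.ofReal (ε * Real.exp (-v) +
            (K * Real.exp (-a) * (1 / 2) ^ n) * Real.exp (-2 * v)) := fun v => by
        rw [← ENNReal.ofReal_mul (Real.exp_pos _).le]
        congr 1
        rw [neg_add, Real.exp_add, show -2 * v = -v + -v by ring, Real.exp_add]
        ring
      simp_rw [heq]
      have hsum : Integrable (fun v : ℝ => ε * Real.exp (-v) +
          (K * Real.exp (-a) * (1 / 2) ^ n) * Real.exp (-2 * v)) (volume.restrict (Set.Ioi 0)) :=
        (hexp1.const_mul ε).add (hexp2.const_mul _)
      rw [← ofReal_integral_eq_lintegral_ofReal hsum (ae_of_all _ fun v => by positivity)]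
      congr 1
      rw [integral_add (hexp1.const_mul ε) (hexp2.const_mul _), integral_const_mul,
        integral_const_mul, h1, h2]
      ring
    rw [survival_succ, ← lintegral_limitSurvival μ hmean, ← herr, ← lintegral_add_right]
    · refine setLIntegral_mono' measurableSet_Ioi fun v hv => ?_
      have hv' : (0 : ℝ) < v := hv
      rw [← mul_add]
      gcongr
      calc _ ≤ μ (Set.Iic (a + v)) * (ENNReal.ofReal (limitSurvival μ (a + v)) +
          ENNReal.ofReal (ε + K * Real.exp (-(a + v)) * (1 / 2) ^ n)) := by
            gcongr; exact ih _ (by linarith)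
        _ ≤ _ := by
            rw [mul_add]
            gcongr
            exact mul_le_of_le_one_left' prob_le_one
    · fun_prop

theorem tendsto_survival (μ : Measure ℝ) [IsProbabilityMeasure μ]
    (hmean : ∫⁻ y, ENNReal.ofReal y ∂μ ≠ ∞) :
    Tendsto (fun n => survival μ n 0) atTop
      (𝓝 (ENNReal.ofReal (Real.exp (-(∫⁻ y, ENNReal.ofReal y ∂μ).toReal)))) := by
  have hG0 : limitSurvival μ 0 = Real.exp (-(∫⁻ y, ENNReal.ofReal y ∂μ).toReal) := by
    simp [limitSurvival, integratedTail]
  rw [← hG0]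
  refine tendsto_order.2 ⟨fun b hb => Eventually.of_forall fun n =>
    hb.trans_le (limitSurvival_le_survival μ hmean n 0), fun b hb => ?_⟩
  obtain ⟨b', hb1, hb2⟩ := exists_between hb
  obtain ⟨ε, hε, hεb⟩ : ∃ ε : ℝ, 0 < ε ∧ ENNReal.ofReal (limitSurvival μ 0) +
      ENNReal.ofReal (2 * ε) < b := by
    obtain ⟨r, hr0, hr⟩ := ENNReal.lt_iff_exists_add_pos_lt.1 hb
    exact ⟨r / 2, by positivity, by
      rw [mul_div_cancel₀ _ two_ne_zero, ENNReal.ofReal_coe_nnreal]; exact hr⟩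
  obtain ⟨A, hA⟩ := (tendsto_order.1 (tendsto_limitSurvival μ hmean)).1 (1 - ε)
    (by linarith) |>.exists_forall_of_atTop
  -- Beyond A the error is below ε; before A the trivial bound one is absorbed by e^A e^{-a} ≥ 1.
  have h0 : ∀ a, 0 ≤ a → 1 ≤ limitSurvival μ a + (ε + Real.exp A * Real.exp (-a)) := by
    intro a _
    rcases le_total A a with h | h
    · have := hA a h
      have : 0 ≤ Real.exp A * Real.exp (-a) := by positivity
      linarith
    · rw [← Real.exp_add]
      have := Real.one_le_exp (show 0 ≤ A + -a by linarith)
      have := limitSurvival_nonneg μ a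
      linarith
  have hpow : Tendsto (fun n : ℕ => Real.exp A * (1 / 2 : ℝ) ^ n) atTop (𝓝 0) := by
    simpa using (tendsto_pow_atTop_nhds_zero_of_lt_one (by norm_num : (0 : ℝ) ≤ 1 / 2)
      (by norm_num)).const_mul (Real.exp A)
  filter_upwards [hpow.eventually (gt_mem_nhds hε)] with n hn
  refine ((survival_le μ hmean hε.le (Real.exp_pos A).le h0 n 0 le_rfl).trans ?_).trans_lt hεb
  gcongr
  simp only [neg_zero, Real.exp_zero, mul_one]
  linarith

end ExponentialArrivals

/-! ### Finite-dimensional distributions of the max-stable field. -/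

section DeHaan

variable {d : ℕ} {Ω Ω' : Type*} [MeasurableSpace Ω] [MeasurableSpace Ω']
  {P : Measure Ω} {Z : Ω → (Fin d → ℝ) → ℝ} {P' : Measure Ω'}
  {V : ℕ → Ω' → ℝ} {W : ℕ → Ω' → (Fin d → ℝ) → ℝ}

/-- By independence the joint law of waiting times and marks is a product. Given the waiting times,
the event is a product of half-lines, with probability `belowArrivals`. -/
theorem IsDeHaanInput.measure_forall_fin_le [IsProbabilityMeasure P']
    (h : IsDeHaanInput P Z P' V W) {g : ((Fin d → ℝ) → ℝ) → ℝ} (hg : Measurable g) (n : ℕ) :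
    P' {ω | ∀ i : Fin n, g (W i ω) ≤ ∑ k ∈ Finset.univ.filter (· ≤ i), V (k : Fin n) ω} =
      survival (P.map fun ω => g (Z ω)) n 0 := by
  have := isProbabilityMeasure_expMeasure (zero_lt_one (α := ℝ))
  set μ : Measure ℝ := P.map fun ω => g (Z ω) with hμ
  have hWm : ∀ i, AEMeasurable (W i) P' := fun i => (h.copies i).aemeasurable_fst
  have hVm : ∀ k, AEMeasurable (V k) P' := fun k => (h.exp_law k).aemeasurable
  have hgW : ∀ i, AEMeasurable (fun ω => g (W i ω)) P' := fun i => hg.comp_aemeasurable (hWm i)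
  have hgl : ∀ i, P'.map (fun ω => g (W i ω)) = μ := fun i => by
    have h1 := ((h.copies i).comp hg).map_eq
    exact h1
  have hμp : IsProbabilityMeasure μ := by
    rw [← hgl 0]; exact Measure.isProbabilityMeasure_map (hgW 0)
  have hVmap : P'.map (fun ω (k : Fin n) => V k ω) = Measure.pi fun _ => expMeasure 1 := by
    have h1 := (h.exp_indep.precomp (g := fun k : Fin n => (k : ℕ)) Fin.val_injective)
    have h2 := (iIndepFun_iff_map_fun_eq_pi_map (fun k : Fin n => hVm k)).1 h1
    rw [h2]
    congr 1
    funext k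
    exact (h.exp_law k).map_eq
  have hYmap : P'.map (fun ω (k : Fin n) => g (W k ω)) = Measure.pi fun _ => μ := by
    have h1 := ((h.copies_indep.comp (fun _ => g) (fun _ => hg)).precomp
      (g := fun k : Fin n => (k : ℕ)) Fin.val_injective)
    have h2 := (iIndepFun_iff_map_fun_eq_pi_map (fun k : Fin n => hgW k)).1 h1
    rw [h2]
    congr 1
    funext k
    exact hgl k
  have hind : IndepFun (fun ω (k : Fin n) => V k ω) (fun ω (k : Fin n) => g (W k ω)) P' :=
    h.indep.comp (φ := fun (v : ℕ → ℝ) (k : Fin n) => v k)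
      (ψ := fun (w : ℕ → (Fin d → ℝ) → ℝ) (k : Fin n) => g (w k)) (by fun_prop) (by fun_prop)
  have hVm' : AEMeasurable (fun ω (k : Fin n) => V k ω) P' :=
    aemeasurable_pi_lambda _ fun k => hVm k
  have hYm' : AEMeasurable (fun ω (k : Fin n) => g (W k ω)) P' :=
    aemeasurable_pi_lambda _ fun k => hgW k
  have hjoint := (indepFun_iff_map_prod_eq_prod_map_map hVm' hYm').1 hind
  rw [hVmap, hYmap] at hjoint
  have hS : MeasurableSet {p : (Fin n → ℝ) × (Fin n → ℝ) |
      ∀ i : Fin n, p.2 i ≤ ∑ k ∈ Finset.univ.filter (· ≤ i), p.1 k} := by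
    simp only [Set.ofPred_forall]
    exact MeasurableSet.iInter fun i => measurableSet_le (by fun_prop) (by fun_prop)
  have h3 := congrArg (fun m => m {p : (Fin n → ℝ) × (Fin n → ℝ) |
      ∀ i : Fin n, p.2 i ≤ ∑ k ∈ Finset.univ.filter (· ≤ i), p.1 k}) hjoint
  rw [Measure.map_apply_of_aemeasurable (hVm'.prodMk hYm') hS, Measure.prod_apply hS] at h3
  refine h3.trans ?_
  unfold survival
  refine lintegral_congr fun v => ?_
  have h4 : Prod.mk v ⁻¹' {p : (Fin n → ℝ) × (Fin n → ℝ) |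
      ∀ i : Fin n, p.2 i ≤ ∑ k ∈ Finset.univ.filter (· ≤ i), p.1 k} =
      Set.univ.pi fun i => Set.Iic (0 + ∑ k ∈ Finset.univ.filter (· ≤ i), v k) := by
    ext y; simp [Pi.le_def]
  rw [h4, Measure.pi_pi]
  rfl

/-- The events for the first n arrivals decrease to the full event, so the limit of `survival`
applies. -/
theorem IsDeHaanInput.measure_forall_le [IsProbabilityMeasure P] [IsProbabilityMeasure P']
    (h : IsDeHaanInput P Z P' V W) {g : ((Fin d → ℝ) → ℝ) → ℝ} (hg : Measurable g)
    (hmean : ∫⁻ ω, ENNReal.ofReal (g (Z ω)) ∂P ≠ ∞) :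
    P' {ω | ∀ i, g (W i ω) ≤ ∑ k ∈ Finset.range (i + 1), V k ω} =
      ENNReal.ofReal (Real.exp (-(∫⁻ ω, ENNReal.ofReal (g (Z ω)) ∂P).toReal)) := by
  have hZm : AEMeasurable Z P := (h.copies 0).aemeasurable_snd
  have hμp : IsProbabilityMeasure (P.map fun ω => g (Z ω)) :=
    Measure.isProbabilityMeasure_map (hg.comp_aemeasurable hZm)
  have hint : ∫⁻ y, ENNReal.ofReal y ∂(P.map fun ω => g (Z ω)) =
      ∫⁻ ω, ENNReal.ofReal (g (Z ω)) ∂P :=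
    lintegral_map' (by fun_prop) (hg.comp_aemeasurable hZm)
  have hlim := tendsto_survival (P.map fun ω => g (Z ω)) (by rwa [hint])
  rw [hint] at hlim
  have hsum : ∀ (n : ℕ) (i : Fin n) (ω : Ω'),
      ∑ k ∈ Finset.univ.filter (· ≤ i), V (k : Fin n) ω =
        ∑ k ∈ Finset.range ((i : ℕ) + 1), V k ω := by
    intro n i ω
    refine Finset.sum_nbij (fun k : Fin n => (k : ℕ)) ?_ ?_ ?_ ?_
    · intro k hk
      simp only [Finset.mem_filter, Finset.mem_univ, true_and, Fin.le_def] at hk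
      simp only [Finset.mem_range]
      omega
    · exact fun k _ l _ hkl => Fin.ext hkl
    · intro k hk
      simp only [Finset.coe_range, Set.mem_Iio] at hk
      have hkn : k < n := by omega
      refine ⟨⟨k, hkn⟩, ?_, rfl⟩
      rw [Finset.mem_coe, Finset.mem_filter]
      exact ⟨Finset.mem_univ _, Fin.le_def.2 (by simp only; omega)⟩
    · intros; rfl
  have hset : ∀ n, P' {ω | ∀ i < n, g (W i ω) ≤ ∑ k ∈ Finset.range (i + 1), V k ω} =
      survival (P.map fun ω => g (Z ω)) n 0 := by
    intro n
    rw [← h.measure_forall_fin_le hg n]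
    congr 1
    ext ω
    simp only [Set.mem_ofPred_eq, hsum]
    exact ⟨fun hh i => hh i i.2, fun hh i hi => hh ⟨i, hi⟩⟩
  have hmeas : ∀ n, NullMeasurableSet
      {ω | ∀ i < n, g (W i ω) ≤ ∑ k ∈ Finset.range (i + 1), V k ω} P' := by
    intro n
    simp only [Set.ofPred_forall]
    refine NullMeasurableSet.iInter fun i => NullMeasurableSet.iInter fun _ =>
      nullMeasurableSet_le (hg.comp_aemeasurable (h.copies i).aemeasurable_fst) ?_
    exact Finset.aemeasurable_fun_sum _ fun k _ => (h.exp_law k).aemeasurable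
  have hinter : {ω | ∀ i, g (W i ω) ≤ ∑ k ∈ Finset.range (i + 1), V k ω} =
      ⋂ n, {ω | ∀ i < n, g (W i ω) ≤ ∑ k ∈ Finset.range (i + 1), V k ω} := by
    ext ω
    simp only [Set.mem_ofPred_eq, Set.mem_iInter]
    exact ⟨fun hh n i _ => hh i, fun hh i => hh (i + 1) i (Nat.lt_succ_self i)⟩
  have hanti : Antitone fun n =>
      {ω | ∀ i < n, g (W i ω) ≤ ∑ k ∈ Finset.range (i + 1), V k ω} :=
    fun m n hmn ω hω i hi => hω i (hi.trans_le hmn)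
  have hlim2 := tendsto_measure_iInter_atTop (μ := P') hmeas hanti ⟨0, measure_ne_top _ _⟩
  rw [← hinter] at hlim2
  refine tendsto_nhds_unique hlim2 ?_
  simpa only [Function.comp_def, hset] using hlim

theorem IsDeHaanInput.ae_pos (h : IsDeHaanInput P Z P' V W) : ∀ᵐ ω ∂P', ∀ k, 0 < V k ω := by
  rw [ae_all_iff]
  intro k
  have h1 := ae_expMeasure_one_pos
  rw [← (h.exp_law k).map_eq] at h1
  exact ae_of_ae_map (h.exp_law k).aemeasurable h1

/-- Passing to the positive part is harmless since s > 0, and it allows finite maxima to be formed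
in `NNReal`. -/
theorem inv_sum_mul_le_iff {s w a : ℝ} (hs : 0 < s) (ha : 0 < a) :
    s⁻¹ * w ≤ a ↔ ((w / a).toNNReal : ℝ) ≤ s := by
  rw [Real.coe_toNNReal', max_le_iff, div_le_iff₀ ha, inv_mul_le_iff₀ hs]
  exact ⟨fun hh => ⟨hh, hs.le⟩, fun hh => hh.1⟩

/-- All terms are at most n + 1 with probability exp(-E Z(t)⁺/(n+1)), which tends to one.
Boundedness must be known because the real `⨆` of an unbounded family is 0 by convention. -/
theorem IsDeHaanInput.ae_bddAbove [IsProbabilityMeasure P] [IsProbabilityMeasure P']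
    (h : IsDeHaanInput P Z P' V W) (t : Fin d → ℝ)
    (hmean : ∫⁻ ω, ENNReal.ofReal (Z ω t) ∂P ≠ ∞) :
    ∀ᵐ ω ∂P', BddAbove
      (Set.range fun i : ℕ => (∑ k ∈ Finset.range (i + 1), V k ω)⁻¹ * W i ω t) := by
  set B : ℕ → Set Ω' := fun n => {ω | ∀ i, ((W i ω t / (n + 1 : ℝ)).toNNReal : ℝ) ≤
    ∑ k ∈ Finset.range (i + 1), V k ω} with hB
  have hBm : ∀ n, P' (B n) = ENNReal.ofReal (Real.exp
      (-((ENNReal.ofReal (1 / (n + 1 : ℝ)) * ∫⁻ ω, ENNReal.ofReal (Z ω t) ∂P).toReal))) := by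
    intro n
    have hint : ∫⁻ ω, ENNReal.ofReal (((Z ω t / (n + 1 : ℝ)).toNNReal : ℝ)) ∂P =
        ENNReal.ofReal (1 / (n + 1 : ℝ)) * ∫⁻ ω, ENNReal.ofReal (Z ω t) ∂P := by
      rw [← lintegral_const_mul' _ _ ENNReal.ofReal_ne_top]
      refine lintegral_congr fun ω => ?_
      rw [ENNReal.ofReal_coe_nnreal, ← ENNReal.ofReal_mul (by positivity),
        one_div_mul_eq_div]
      rfl
    have hne : ∫⁻ ω, ENNReal.ofReal (((Z ω t / (n + 1 : ℝ)).toNNReal : ℝ)) ∂P ≠ ∞ := by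
      rw [hint]; exact ENNReal.mul_ne_top ENNReal.ofReal_ne_top hmean
    rw [← hint]
    exact h.measure_forall_le (g := fun f => ((f t / (n + 1 : ℝ)).toNNReal : ℝ))
      (by fun_prop) hne
  have hlim : Tendsto (fun n => P' (B n)) atTop (𝓝 1) := by
    simp only [hBm]
    have h1 : Tendsto (fun n : ℕ => (1 / ((n : ℝ) + 1)) *
        (∫⁻ ω, ENNReal.ofReal (Z ω t) ∂P).toReal) atTop (𝓝 0) := by
      simpa using tendsto_one_div_add_atTop_nhds_zero_nat.mul_const
        (∫⁻ ω, ENNReal.ofReal (Z ω t) ∂P).toReal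
    have h2 := ENNReal.tendsto_ofReal ((Real.continuous_exp.tendsto _).comp h1.neg)
    simp only [neg_zero, Real.exp_zero, ENNReal.ofReal_one] at h2
    refine h2.congr fun n => ?_
    rw [ENNReal.toReal_mul, ENNReal.toReal_ofReal (by positivity)]
    rfl
  have hU : ∀ᵐ ω ∂P', ω ∈ ⋃ n, B n := by
    have hm : NullMeasurableSet (⋃ n, B n) P' := by
      refine NullMeasurableSet.iUnion fun n => ?_
      simp only [hB, Set.ofPred_forall]
      refine NullMeasurableSet.iInter fun i => nullMeasurableSet_le ?_ ?_
      · exact (show Measurable fun f : (Fin d → ℝ) → ℝ =>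
          ((f t / (n + 1 : ℝ)).toNNReal : ℝ) by fun_prop).comp_aemeasurable
          (h.copies i).aemeasurable_fst
      · exact Finset.aemeasurable_fun_sum _ fun k _ => (h.exp_law k).aemeasurable
    refine (prob_compl_eq_zero_iff₀ hm).2 (le_antisymm prob_le_one ?_)
    exact le_of_tendsto' hlim fun n => measure_mono (Set.subset_iUnion B n)
  filter_upwards [hU, h.ae_pos] with ω hω hpos
  obtain ⟨n, hn⟩ := Set.mem_iUnion.1 hω
  refine ⟨(n + 1 : ℝ), ?_⟩
  rintro _ ⟨i, rfl⟩
  exact (inv_sum_mul_le_iff (Finset.sum_pos (fun k _ => hpos k) (by simp)) (by positivity)).2 (hn i)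

/-- The finite-dimensional distribution functions of a max-stable field in terms of the spectral
field. -/
theorem IsDeHaanInput.measure_maxStableField_le [IsProbabilityMeasure P] [IsProbabilityMeasure P']
    (h : IsDeHaanInput P Z P' V W) (hmean : ∀ t, ∫⁻ ω, ENNReal.ofReal (Z ω t) ∂P ≠ ∞)
    {ι : Type*} (I : Finset ι) (τ : ι → Fin d → ℝ) (a : ι → ℝ) (ha : ∀ t ∈ I, 0 < a t) :
    ∫⁻ ω, I.sup (fun t => ENNReal.ofReal (Z ω (τ t) / a t)) ∂P ≠ ∞ ∧
    P' {ω | ∀ t ∈ I, maxStableField V W ω (τ t) ≤ a t} =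
      ENNReal.ofReal (Real.exp
        (-(∫⁻ ω, I.sup (fun t => ENNReal.ofReal (Z ω (τ t) / a t)) ∂P).toReal)) := by
  -- One functional encodes all the constraints: an arrival Γᵢ with mark Wᵢ respects every level
  -- exactly when g(Wᵢ) ≤ Γᵢ.
  set g : ((Fin d → ℝ) → ℝ) → ℝ := fun f => ((I.sup fun t => (f (τ t) / a t).toNNReal : NNReal) : ℝ)
    with hg
  have hgm : Measurable g := by
    refine Measurable.coe_nnreal_real ?_
    have hh := Finset.sup_induction (s := I) (p := Measurable)
      (f := fun t (f : (Fin d → ℝ) → ℝ) => (f (τ t) / a t).toNNReal) measurable_const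
      (fun _ h1 _ h2 => h1.sup h2) (fun t _ => by fun_prop)
    convert hh using 2 with f
    simp [Finset.sup_apply]
  have hgo : ∀ f, ENNReal.ofReal (g f) = I.sup fun t => ENNReal.ofReal (f (τ t) / a t) := by
    intro f
    rw [hg, ENNReal.ofReal_coe_nnreal, ENNReal.coe_finset_sup]
    rfl
  have hfin : ∫⁻ ω, ENNReal.ofReal (g (Z ω)) ∂P ≠ ∞ := by
    have hle : ∀ ω, ENNReal.ofReal (g (Z ω)) ≤
        ∑ t ∈ I, ENNReal.ofReal (a t)⁻¹ * ENNReal.ofReal (Z ω (τ t)) := by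
      intro ω
      rw [hgo]
      refine Finset.sup_le fun t ht => ?_
      rw [div_eq_inv_mul, ENNReal.ofReal_mul (inv_nonneg.2 (ha t ht).le)]
      exact Finset.single_le_sum (f := fun t =>
        ENNReal.ofReal (a t)⁻¹ * ENNReal.ofReal (Z ω (τ t))) (fun _ _ => zero_le) ht
    have hZm : ∀ t, AEMeasurable (fun ω => ENNReal.ofReal (Z ω t)) P := fun t =>
      ((measurable_pi_apply t).comp_aemeasurable (h.copies 0).aemeasurable_snd).ennreal_ofReal
    refine ((lintegral_mono hle).trans_lt ?_).ne
    rw [lintegral_finsetSum' _ fun t _ => (hZm _).const_mul _]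
    refine ENNReal.sum_lt_top.2 fun t _ => ?_
    rw [lintegral_const_mul' _ _ ENNReal.ofReal_ne_top]
    exact ENNReal.mul_lt_top ENNReal.ofReal_lt_top (hmean _).lt_top
  have hmain := h.measure_forall_le hgm hfin
  simp only [hgo] at hfin hmain
  refine ⟨hfin, ?_⟩
  rw [← hmain]
  refine measure_congr ?_
  have hb : ∀ᵐ ω ∂P', ∀ t ∈ I, BddAbove
      (Set.range fun i : ℕ => (∑ k ∈ Finset.range (i + 1), V k ω)⁻¹ * W i ω (τ t)) :=
    (Finset.eventually_all I).2 fun t _ => h.ae_bddAbove (τ t) (hmean _)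
  filter_upwards [h.ae_pos, hb] with ω hpos hbdd
  have hΓ : ∀ i, 0 < ∑ k ∈ Finset.range (i + 1), V k ω := fun i =>
    Finset.sum_pos (fun k _ => hpos k) (by simp)
  refine propext ?_
  have hgle : ∀ i, g (W i ω) ≤ ∑ k ∈ Finset.range (i + 1), V k ω ↔
      ∀ t ∈ I, (∑ k ∈ Finset.range (i + 1), V k ω)⁻¹ * W i ω (τ t) ≤ a t := by
    intro i
    rw [hg, ← Real.le_toNNReal_iff_coe_le (hΓ i).le, Finset.sup_le_iff]
    refine forall₂_congr fun t ht => ?_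
    rw [inv_sum_mul_le_iff (hΓ i) (ha t ht), Real.le_toNNReal_iff_coe_le (hΓ i).le]
  have h1 : (∀ t ∈ I, maxStableField V W ω (τ t) ≤ a t) ↔
      ∀ i, g (W i ω) ≤ ∑ k ∈ Finset.range (i + 1), V k ω := by
    simp only [hgle]
    rw [forall_comm]
    refine forall_congr' fun t => ?_
    rw [forall_comm]
    refine forall_congr' fun ht => ?_
    exact ciSup_le_iff (hbdd t ht)
  exact h1

end DeHaan

/-! ### The càdlàg path space and the exponent measure. -/

section PathSpace

/-- The non-negative càdlàg functions on `ℝ^d`. -/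
def CadlagPath (d : ℕ) : Type := {f : (Fin d → ℝ) → ℝ // (∀ t, 0 ≤ f t) ∧ IsCadlagField f}

variable {d : ℕ}

instance : MeasurableSpace (CadlagPath d) :=
  inferInstanceAs (MeasurableSpace {f : (Fin d → ℝ) → ℝ // (∀ t, 0 ≤ f t) ∧ IsCadlagField f})

theorem CadlagPath.measurable_val : Measurable fun f : CadlagPath d => f.1 := measurable_subtype_coe

theorem CadlagPath.measurable_apply (t : Fin d → ℝ) : Measurable fun f : CadlagPath d => f.1 t :=
  (measurable_pi_apply t).comp CadlagPath.measurable_val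

/-- The smallest point of the lattice `(n+1)⁻¹ℤ^d` above `t`. -/
noncomputable def gridAbove (n : ℕ) (t : Fin d → ℝ) : Fin d → ℝ :=
  fun i => (⌈((n : ℝ) + 1) * t i⌉ : ℝ) / ((n : ℝ) + 1)

theorem tendsto_gridAbove (t : Fin d → ℝ) :
    Tendsto (fun n => gridAbove n t) atTop (𝓝[quadrant ∅ t] t) := by
  have hle : ∀ n i, t i ≤ gridAbove n t i := fun n i => by
    rw [gridAbove, le_div_iff₀ (by positivity), mul_comm]
    exact Int.le_ceil _
  refine tendsto_nhdsWithin_iff.2 ⟨tendsto_pi_nhds.2 fun i => ?_,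
    Eventually.of_forall fun n i => ⟨fun h => h.elim, fun _ => hle n i⟩⟩
  have h1 : Tendsto (fun n : ℕ => t i + 1 / ((n : ℝ) + 1)) atTop (𝓝 (t i)) := by
    simpa using tendsto_one_div_add_atTop_nhds_zero_nat.const_add (t i)
  refine tendsto_of_tendsto_of_tendsto_of_le_of_le tendsto_const_nhds h1 (fun n => hle n i)
    fun n => ?_
  have hn : (0 : ℝ) < (n : ℝ) + 1 := by positivity
  simp only [gridAbove]
  rw [div_le_iff₀ hn, add_mul (t i), one_div_mul_cancel hn.ne', mul_comm (t i)]
  exact (Int.ceil_lt_add_one _).le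

theorem CadlagPath.tendsto_gridAbove (f : CadlagPath d) (t : Fin d → ℝ) :
    Tendsto (fun n => f.1 (gridAbove n t)) atTop (𝓝 (f.1 t)) :=
  (f.2.2 t).2.comp (_root_.tendsto_gridAbove t)

/-- Right continuity writes f(t) as the limit of f at grid points above t. Each approximation
factors through a countable index set, so joint measurability follows from measurability of the
coordinates; all uses of Tonelli on path times parameter rest on this. -/
theorem CadlagPath.measurable_eval :
    Measurable fun p : CadlagPath d × (Fin d → ℝ) => p.1.1 p.2 := by
  refine measurable_of_tendsto_metrizable (f := fun n (p : CadlagPath d × (Fin d → ℝ)) =>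
    p.1.1 (gridAbove n p.2)) (fun n => ?_) (tendsto_pi_nhds.2 fun p => p.1.tendsto_gridAbove p.2)
  have h1 : Measurable fun q : CadlagPath d × (Fin d → ℤ) =>
      q.1.1 fun i => (q.2 i : ℝ) / ((n : ℝ) + 1) :=
    measurable_from_prod_countable_left fun k =>
      CadlagPath.measurable_apply fun i => (k i : ℝ) / ((n : ℝ) + 1)
  have h2 : Measurable fun p : CadlagPath d × (Fin d → ℝ) =>
      (p.1, fun i => ⌈((n : ℝ) + 1) * p.2 i⌉) := by
    refine measurable_fst.prodMk (measurable_pi_lambda _ fun i => ?_)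
    exact Int.measurable_ceil.comp (by fun_prop)
  exact h1.comp h2

@[fun_prop]
theorem CadlagPath.measurable_eval_comp {α : Type*} [MeasurableSpace α] {f : α → CadlagPath d}
    {t : α → Fin d → ℝ} (hf : Measurable f) (ht : Measurable t) :
    Measurable fun a => (f a).1 (t a) :=
  CadlagPath.measurable_eval.comp (hf.prodMk ht)

theorem CadlagPath.measurable_mk {α : Type*} [MeasurableSpace α] {f : α → CadlagPath d}
    (hf : ∀ t, Measurable fun a => (f a).1 t) : Measurable f :=
  (measurable_pi_iff.2 hf).subtype_mk (h := fun a => (f a).2)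

theorem tendsto_sub_quadrant (J : Set (Fin d)) (t h : Fin d → ℝ) :
    Tendsto (fun u => u - h) (𝓝[quadrant J t] t) (𝓝[quadrant J (t - h)] (t - h)) := by
  refine tendsto_nhdsWithin_iff.2 ⟨?_, ?_⟩
  · exact ((continuous_id.sub continuous_const).tendsto t).mono_left nhdsWithin_le_nhds
  · filter_upwards [self_mem_nhdsWithin] with u hu i
    exact ⟨fun hi => sub_lt_sub_right ((hu i).1 hi) _, fun hi => sub_le_sub_right ((hu i).2 hi) _⟩

theorem IsCadlagField.fieldShift {f : (Fin d → ℝ) → ℝ} (hf : IsCadlagField f) (h : Fin d → ℝ) :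
    IsCadlagField (fieldShift h f) := fun t =>
  ⟨fun J => by
    obtain ⟨l, hl⟩ := (hf (t - h)).1 J
    exact ⟨l, hl.comp (tendsto_sub_quadrant J t h)⟩,
    (hf (t - h)).2.comp (tendsto_sub_quadrant ∅ t h)⟩

theorem IsCadlagField.const_mul {f : (Fin d → ℝ) → ℝ} (hf : IsCadlagField f) (c : ℝ) :
    IsCadlagField fun t => c * f t := fun t =>
  ⟨fun J => by
    obtain ⟨l, hl⟩ := (hf t).1 J
    exact ⟨c * l, hl.const_mul c⟩, (hf t).2.const_mul c⟩

theorem isCadlagField_zero : IsCadlagField fun _ : Fin d → ℝ => 0 :=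
  fun _ => ⟨fun _ => ⟨0, tendsto_const_nhds⟩, tendsto_const_nhds⟩

namespace CadlagPath

/-- The shift `f ↦ f(· - h)`. -/
def shift (h : Fin d → ℝ) (f : CadlagPath d) : CadlagPath d :=
  ⟨fieldShift h f.1, fun t => f.2.1 (t - h), f.2.2.fieldShift h⟩

/-- Multiplication of a path by a non-negative number. -/
def scale (c : NNReal) (f : CadlagPath d) : CadlagPath d :=
  ⟨fun t => c * f.1 t, fun t => mul_nonneg c.2 (f.2.1 t), f.2.2.const_mul c⟩

/-- The path that vanishes identically. -/
def zero : CadlagPath d := ⟨fun _ => 0, fun _ => le_rfl, isCadlagField_zero⟩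

@[simp]
theorem shift_apply (h : Fin d → ℝ) (f : CadlagPath d) (t : Fin d → ℝ) :
    (shift h f).1 t = f.1 (t - h) := rfl

@[simp]
theorem scale_apply (c : NNReal) (f : CadlagPath d) (t : Fin d → ℝ) :
    (scale c f).1 t = c * f.1 t := rfl

@[fun_prop]
theorem measurable_shift_comp {α : Type*} [MeasurableSpace α] {h : α → Fin d → ℝ}
    {f : α → CadlagPath d} (hh : Measurable h) (hf : Measurable f) :
    Measurable fun a => shift (h a) (f a) :=
  measurable_mk fun t => by simp only [shift_apply]; fun_prop

@[fun_prop]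
theorem measurable_scale_comp {α : Type*} [MeasurableSpace α] {c : α → NNReal}
    {f : α → CadlagPath d} (hc : Measurable c) (hf : Measurable f) :
    Measurable fun a => scale (c a) (f a) :=
  measurable_mk fun t => by simp only [scale_apply]; fun_prop

theorem measurable_shift (h : Fin d → ℝ) : Measurable (shift h) :=
  measurable_shift_comp measurable_const measurable_id

theorem lt_scale_inv_iff {s : ℝ} (hs : 0 < s) (f : CadlagPath d) (t : Fin d → ℝ) (a : ℝ) :
    a < (scale s.toNNReal⁻¹ f).1 t ↔ s * a < f.1 t := by
  rw [scale_apply, NNReal.coe_inv, Real.coe_toNNReal _ hs.le, lt_inv_mul_iff₀ hs]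

theorem shift_scale (h : Fin d → ℝ) (c : NNReal) (f : CadlagPath d) :
    shift h (scale c f) = scale c (shift h f) := rfl

theorem shift_shift (h k : Fin d → ℝ) (f : CadlagPath d) :
    shift h (shift k f) = shift (h + k) f :=
  Subtype.ext (funext fun t => by simp [sub_sub])

end CadlagPath

variable {Ω : Type*} [MeasurableSpace Ω] {P : Measure Ω} {Z : Ω → (Fin d → ℝ) → ℝ}

/-- A field with càdlàg paths has a version with values in the path space. -/
theorem IsNormalisedField.exists_version (hZ : IsNormalisedField P Z) :
    ∃ Y : Ω → CadlagPath d, Measurable Y ∧ ∀ᵐ ω ∂P, (Y ω).1 = Z ω := by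
  classical
  -- The set of bad paths need not be measurable; a measurable null set containing it is used, on
  -- which the version is the zero path.
  set B : Set Ω := toMeasurable P {ω | ¬ ((∀ t, 0 ≤ Z ω t) ∧ IsCadlagField (Z ω))} with hB
  have hBm : MeasurableSet B := measurableSet_toMeasurable _ _
  have hB0 : P B = 0 := by rw [hB, measure_toMeasurable]; exact hZ.paths
  have hgood : ∀ ω, ω ∉ B → (∀ t, 0 ≤ Z ω t) ∧ IsCadlagField (Z ω) := fun ω hω => by
    by_contra hc
    exact hω (subset_toMeasurable P _ hc)
  refine ⟨fun ω => if hω : ω ∈ B then CadlagPath.zero else ⟨Z ω, hgood ω hω⟩, ?_, ?_⟩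
  · refine CadlagPath.measurable_mk fun t => ?_
    have : (fun ω => (if hω : ω ∈ B then CadlagPath.zero else (⟨Z ω, hgood ω hω⟩ :
        CadlagPath d)).1 t) = fun ω => if ω ∈ B then 0 else Z ω t := by
      funext ω
      by_cases hω : ω ∈ B
      · simp [hω, CadlagPath.zero]
      · simp [hω]
    rw [this]
    exact Measurable.ite hBm measurable_const (hZ.measurable t)
  · have : ∀ᵐ ω ∂P, ω ∉ B := measure_eq_zero_iff_ae_notMem.1 hB0
    filter_upwards [this] with ω hω
    simp [hω]

theorem lintegral_indicator_ofReal_lt (u : ℝ≥0∞) :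
    ∫⁻ s in Set.Ioi (0 : ℝ), {s : ℝ | ENNReal.ofReal s < u}.indicator 1 s = u := by
  have hm : MeasurableSet {s : ℝ | ENNReal.ofReal s < u} :=
    measurableSet_lt ENNReal.measurable_ofReal measurable_const
  rw [lintegral_indicator_one hm, Measure.restrict_apply hm]
  rcases eq_or_ne u ∞ with rfl | hu
  · simp
  · have : {s : ℝ | ENNReal.ofReal s < u} ∩ Set.Ioi 0 = Set.Ioo 0 u.toReal := by
      ext s
      simp only [Set.mem_inter_iff, Set.mem_ofPred_eq, Set.mem_Ioi, Set.mem_Ioo]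
      constructor
      · exact fun h => ⟨h.2, (ENNReal.ofReal_lt_iff_lt_toReal h.2.le hu).1 h.1⟩
      · exact fun h => ⟨(ENNReal.ofReal_lt_iff_lt_toReal h.1.le hu).2 h.2, h.1⟩
    rw [this, Real.volume_Ioo, sub_zero, ENNReal.ofReal_toReal hu]

/-- The layer-cake formula for functions with values in `[0,∞]`. -/
theorem lintegral_measure_ofReal_lt [SFinite P] {U : Ω → ℝ≥0∞} (hU : Measurable U) :
    ∫⁻ s in Set.Ioi (0 : ℝ), P {ω | ENNReal.ofReal s < U ω} = ∫⁻ ω, U ω ∂P := by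
  have hm : MeasurableSet {p : ℝ × Ω | ENNReal.ofReal p.1 < U p.2} :=
    measurableSet_lt (by fun_prop) (by fun_prop)
  have h1 : ∀ s : ℝ, P {ω | ENNReal.ofReal s < U ω} =
      ∫⁻ ω, {p : ℝ × Ω | ENNReal.ofReal p.1 < U p.2}.indicator 1 (s, ω) ∂P := fun s => by
    rw [← lintegral_indicator_one (measurableSet_lt measurable_const hU)]
    rfl
  simp_rw [h1]
  rw [lintegral_lintegral_swap]
  · exact lintegral_congr fun ω => lintegral_indicator_ofReal_lt (U ω)
  · exact (measurable_one.indicator hm).aemeasurable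

/-- The image of `ds ⊗ P` on `(0,∞) × Ω` under `(s, ω) ↦ s⁻¹ Y(ω)`, that is, the exponent measure
of the max-stable field with spectral field `Y`. -/
noncomputable def exponentMeasure (P : Measure Ω) (Y : Ω → CadlagPath d) :
    Measure (CadlagPath d) :=
  ((volume.restrict (Set.Ioi 0)).prod P).map
    fun p : ℝ × Ω => CadlagPath.scale p.1.toNNReal⁻¹ (Y p.2)

instance [SFinite P] (Y : Ω → CadlagPath d) : SFinite (exponentMeasure P Y) := by
  unfold exponentMeasure; infer_instance

variable {Y : Ω → CadlagPath d}

theorem measurable_scale_inv (hY : Measurable Y) :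
    Measurable fun p : ℝ × Ω => CadlagPath.scale p.1.toNNReal⁻¹ (Y p.2) := by fun_prop

theorem lintegral_exponentMeasure [SFinite P] (hY : Measurable Y) {G : CadlagPath d → ℝ≥0∞}
    (hG : Measurable G) :
    ∫⁻ f, G f ∂(exponentMeasure P Y) =
      ∫⁻ s in Set.Ioi (0 : ℝ), ∫⁻ ω, G (CadlagPath.scale s.toNNReal⁻¹ (Y ω)) ∂P := by
  have hm := measurable_scale_inv hY
  rw [exponentMeasure, lintegral_map hG hm]
  exact lintegral_prod _ (hG.comp hm).aemeasurable

theorem lintegral_exponentMeasure_symm [SFinite P] (hY : Measurable Y) {G : CadlagPath d → ℝ≥0∞}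
    (hG : Measurable G) :
    ∫⁻ f, G f ∂(exponentMeasure P Y) =
      ∫⁻ ω, (∫⁻ s in Set.Ioi (0 : ℝ), G (CadlagPath.scale s.toNNReal⁻¹ (Y ω))) ∂P := by
  have hm := measurable_scale_inv hY
  rw [exponentMeasure, lintegral_map hG hm]
  exact lintegral_prod_symm _ (hG.comp hm).aemeasurable

theorem exponentMeasure_apply [SFinite P] (hY : Measurable Y) {A : Set (CadlagPath d)}
    (hA : MeasurableSet A) :
    exponentMeasure P Y A =
      ∫⁻ s in Set.Ioi (0 : ℝ), P {ω | CadlagPath.scale s.toNNReal⁻¹ (Y ω) ∈ A} := by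
  have hm := measurable_scale_inv hY
  rw [exponentMeasure, Measure.map_apply hm hA, Measure.prod_apply (hm hA)]
  rfl

/-- A scale invariant property that holds almost surely for the spectral field holds almost
everywhere for the exponent measure. -/
theorem ae_exponentMeasure_of_ae [SFinite P] (hY : Measurable Y) {p : CadlagPath d → Prop}
    (hp : MeasurableSet {f | p f})
    (h : ∀ᵐ ω ∂P, ∀ s : ℝ, 0 < s → p (CadlagPath.scale s.toNNReal⁻¹ (Y ω))) :
    ∀ᵐ f ∂(exponentMeasure P Y), p f := by
  have hp' : MeasurableSet {f | ¬ p f} := hp.compl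
  rw [ae_iff, exponentMeasure_apply hY hp',
    setLIntegral_congr_fun (g := fun _ => 0) measurableSet_Ioi, lintegral_zero]
  intro s hs
  refine measure_mono_null ?_ h
  intro ω hω hc
  exact hω (hc s hs)

theorem measurableSet_exists_lt {ι : Type*} (I : Finset ι) (τ : ι → Fin d → ℝ) (a : ι → ℝ) :
    MeasurableSet {f : CadlagPath d | ∃ i ∈ I, a i < f.1 (τ i)} := by
  have : {f : CadlagPath d | ∃ i ∈ I, a i < f.1 (τ i)} =
      ⋃ i ∈ I, {f : CadlagPath d | a i < f.1 (τ i)} := by ext; simp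
  rw [this]
  exact Finset.measurableSet_biUnion _ fun i _ =>
    measurableSet_lt measurable_const (CadlagPath.measurable_apply _)

/-- The path s⁻¹Y exceeds some aᵢ at τᵢ exactly when s < maxᵢ Y(τᵢ)/aᵢ, so integrating over s is the
layer-cake formula. The right side is the exponent in the distribution function of the max-stable
field. -/
theorem exponentMeasure_exists_lt [SFinite P] (hY : Measurable Y) {ι : Type*} (I : Finset ι)
    (τ : ι → Fin d → ℝ) (a : ι → ℝ) (ha : ∀ i ∈ I, 0 < a i) :
    exponentMeasure P Y {f | ∃ i ∈ I, a i < f.1 (τ i)} =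
      ∫⁻ ω, I.sup (fun i => ENNReal.ofReal ((Y ω).1 (τ i) / a i)) ∂P := by
  have hUm : Measurable fun ω => I.sup (fun i => ENNReal.ofReal ((Y ω).1 (τ i) / a i)) := by
    have hh := Finset.sup_induction (s := I) (p := Measurable)
      (f := fun i ω => ENNReal.ofReal ((Y ω).1 (τ i) / a i)) measurable_const
      (fun _ h1 _ h2 => h1.sup h2) (fun t _ => by fun_prop)
    convert hh using 2 with f
    simp [Finset.sup_apply]
  rw [exponentMeasure_apply hY (measurableSet_exists_lt I τ a), ← lintegral_measure_ofReal_lt hUm]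
  refine setLIntegral_congr_fun measurableSet_Ioi fun s hs => ?_
  have hs' : (0 : ℝ) < s := hs
  refine congrArg P ?_
  ext ω
  simp only [Set.mem_ofPred_eq, Finset.lt_sup_iff]
  refine exists_congr fun i => and_congr_right fun hi => ?_
  rw [CadlagPath.lt_scale_inv_iff hs', ENNReal.ofReal_lt_ofReal_iff_of_nonneg hs'.le,
    lt_div_iff₀ (ha i hi)]

end PathSpace

/-! ### Stationarity makes the exponent measure shift invariant. -/

section ShiftInvariance

variable {d : ℕ}

/-- The sets of paths bounded by prescribed positive levels at finitely many points. -/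
def lowerOrthants (d : ℕ) : Set (Set (CadlagPath d)) :=
  {A | ∃ (I : Finset (Fin d → ℝ)) (a : (Fin d → ℝ) → ℝ), (∀ t ∈ I, 0 < a t) ∧
    A = {f | ∀ t ∈ I, f.1 t ≤ a t}}

theorem isPiSystem_lowerOrthants : IsPiSystem (lowerOrthants d) := by
  classical
  rintro _ ⟨I, a, ha, rfl⟩ _ ⟨J, b, hb, rfl⟩ -
  refine ⟨I ∪ J, fun t => if t ∈ I then (if t ∈ J then min (a t) (b t) else a t) else b t, ?_, ?_⟩
  · intro t ht
    rw [Finset.mem_union] at ht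
    beta_reduce
    split_ifs with h1 h2
    · exact lt_min (ha t h1) (hb t h2)
    · exact ha t h1
    · exact hb t (ht.resolve_left h1)
  · ext f
    simp only [Set.mem_inter_iff, Set.mem_ofPred_eq, Finset.mem_union]
    constructor
    · rintro ⟨h1, h2⟩ t ht
      split_ifs with h3 h4
      · exact le_min (h1 t h3) (h2 t h4)
      · exact h1 t h3
      · exact h2 t (ht.resolve_left h3)
    · intro h
      refine ⟨fun t ht => ?_, fun t ht => ?_⟩
      · have := h t (Or.inl ht)
        rw [if_pos ht] at this
        split_ifs at this with h4
        · exact this.trans (min_le_left _ _)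
        · exact this
      · have := h t (Or.inr ht)
        rw [if_pos ht] at this
        split_ifs at this with h4
        · exact this.trans (min_le_right _ _)
        · exact this

/-- Paths are non-negative, so the positive levels suffice: negative ones give the empty set, and
level zero is the intersection over 1/(n+1). -/
theorem measurableSpace_eq_generateFrom_lowerOrthants :
    (inferInstance : MeasurableSpace (CadlagPath d)) =
      MeasurableSpace.generateFrom (lowerOrthants d) := by
  refine le_antisymm ?_ (MeasurableSpace.generateFrom_le ?_)
  · rintro _ ⟨B, hB, rfl⟩
    have hpos : ∀ (t : Fin d → ℝ) (r : ℝ), 0 < r → MeasurableSet[MeasurableSpace.generateFrom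
        (lowerOrthants d)] {f : CadlagPath d | f.1 t ≤ r} := fun t r hr =>
      MeasurableSpace.measurableSet_generateFrom ⟨{t}, fun _ => r, by simpa using hr, by simp⟩
    have hval : @Measurable _ _ (MeasurableSpace.generateFrom (lowerOrthants d)) _
        (fun f : CadlagPath d => f.1) := by
      refine @measurable_pi_iff _ _ _ (MeasurableSpace.generateFrom (lowerOrthants d)) _ _ |>.2
        fun t => ?_
      refine measurable_of_Iic (δ := CadlagPath d) fun r => ?_
      rcases lt_trichotomy r 0 with hr | rfl | hr
      · have : (fun f : CadlagPath d => f.1 t) ⁻¹' Set.Iic r = ∅ := by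
          ext f
          simpa using hr.trans_le (f.2.1 t)
        rw [this]
        exact @MeasurableSet.empty _ (MeasurableSpace.generateFrom (lowerOrthants d))
      · have : (fun f : CadlagPath d => f.1 t) ⁻¹' Set.Iic 0 =
            ⋂ n : ℕ, {f : CadlagPath d | f.1 t ≤ 1 / ((n : ℝ) + 1)} := by
          ext f
          simp only [Set.mem_preimage, Set.mem_Iic, Set.mem_iInter, Set.mem_ofPred_eq]
          exact ⟨fun h n => h.trans (by positivity),
            fun h => ge_of_tendsto' tendsto_one_div_add_atTop_nhds_zero_nat h⟩
        rw [this]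
        exact MeasurableSet.iInter fun n => hpos t _ (by positivity)
      · exact hpos t r hr
    exact hval hB
  · rintro _ ⟨I, a, -, rfl⟩
    have : {f : CadlagPath d | ∀ t ∈ I, f.1 t ≤ a t} = ⋂ t ∈ I, {f | f.1 t ≤ a t} := by
      ext; simp
    rw [this]
    exact Finset.measurableSet_biInter _ fun t _ =>
      measurableSet_le (CadlagPath.measurable_apply t) measurable_const

/-- Turns vanishing of a path into countably many conditions, which gives both measurability of the
zero path's event and a countable cover of the non-zero paths. -/
theorem CadlagPath.eq_zero_of_grid (f : CadlagPath d)
    (h : ∀ (n : ℕ) (k : Fin d → ℤ), f.1 (fun i => (k i : ℝ) / ((n : ℝ) + 1)) = 0)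
    (t : Fin d → ℝ) : f.1 t = 0 :=
  tendsto_nhds_unique (f.tendsto_gridAbove t)
    (tendsto_const_nhds.congr fun n => (h n fun i => ⌈((n : ℝ) + 1) * t i⌉).symm)

/-- A measure on the path space that does not charge the zero path and is finite on the sets
`{f(t) > a}` is determined by the masses of finite unions of such sets. -/
theorem CadlagPath.measure_ext {ν ν' : Measure (CadlagPath d)} (h0 : ν {f | ∀ t, f.1 t = 0} = 0)
    (h0' : ν' {f | ∀ t, f.1 t = 0} = 0)
    (hfin : ∀ (I : Finset (Option (Fin d → ℝ))) (τ : Option (Fin d → ℝ) → Fin d → ℝ)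
      (a : Option (Fin d → ℝ) → ℝ), (∀ i ∈ I, 0 < a i) →
      ν {f | ∃ i ∈ I, a i < f.1 (τ i)} ≠ ∞)
    (heq : ∀ (I : Finset (Option (Fin d → ℝ))) (τ : Option (Fin d → ℝ) → Fin d → ℝ)
      (a : Option (Fin d → ℝ) → ℝ), (∀ i ∈ I, 0 < a i) →
      ν {f | ∃ i ∈ I, a i < f.1 (τ i)} = ν' {f | ∃ i ∈ I, a i < f.1 (τ i)}) : ν = ν' := by
  classical
  -- ν may be infinite, so uniqueness on a π-system is applied to its restrictions to {f(t₀) > ε},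
  -- which are finite.
  have hrestr : ∀ (t₀ : Fin d → ℝ) (ε : ℝ), 0 < ε →
      ν.restrict {f | ε < f.1 t₀} = ν'.restrict {f | ε < f.1 t₀} := by
    intro t₀ ε hε
    have hBm : MeasurableSet {f : CadlagPath d | ε < f.1 t₀} :=
      measurableSet_lt measurable_const (CadlagPath.measurable_apply _)
    have hone := heq {none} (fun _ => t₀) (fun _ => ε) (by simpa using hε)
    have hone' := hfin {none} (fun _ => t₀) (fun _ => ε) (by simpa using hε)
    simp only [Finset.mem_singleton, exists_eq_left] at hone hone'
    have hfinB : IsFiniteMeasure (ν.restrict {f | ε < f.1 t₀}) :=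
      ⟨by rw [Measure.restrict_apply_univ]; exact hone'.lt_top⟩
    refine ext_of_generate_finite (lowerOrthants d)
      measurableSpace_eq_generateFrom_lowerOrthants isPiSystem_lowerOrthants ?_ ?_
    · rintro _ ⟨I, a, ha, rfl⟩
      set τ : Option (Fin d → ℝ) → Fin d → ℝ := fun o => o.elim t₀ id with hτ
      set b : Option (Fin d → ℝ) → ℝ := fun o => o.elim ε a with hb
      set I₁ : Finset (Option (Fin d → ℝ)) := Finset.insertNone I with hI₁
      set I₂ : Finset (Option (Fin d → ℝ)) := I.map Function.Embedding.some with hI₂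
      have hb1 : ∀ i ∈ I₁, 0 < b i := by
        rintro (_ | t) hi
        · exact hε
        · exact ha t (by simpa [hI₁] using hi)
      have hb2 : ∀ i ∈ I₂, 0 < b i := by
        intro i hi
        obtain ⟨t, ht, rfl⟩ := Finset.mem_map.1 hi
        exact ha t ht
      -- An orthant cut by {f(t₀) > ε} is a difference of two finite unions of exceedance events.
      -- The extra constraint sits at `none`, so t₀ may also be one of the points of I with a
      -- different level.
      have hC : ({f : CadlagPath d | ∃ i ∈ I₁, b i < f.1 (τ i)} \
          {f : CadlagPath d | ∃ i ∈ I₂, b i < f.1 (τ i)}) =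
          {f | ∀ t ∈ I, f.1 t ≤ a t} ∩ {f | ε < f.1 t₀} := by
        ext f
        simp only [Set.mem_sdiff, Set.mem_ofPred_eq, Set.mem_inter_iff, hI₁, hI₂,
          Finset.mem_map, Function.Embedding.some_apply, Option.exists, Finset.none_mem_insertNone,
          true_and, Finset.some_mem_insertNone, hτ, hb, Option.elim, id]
        constructor
        · rintro ⟨h1, h2⟩
          push Not at h2
          have h3 : ∀ t ∈ I, f.1 t ≤ a t := fun t ht => h2.2 t ⟨t, ht, rfl⟩
          refine ⟨h3, h1.resolve_right ?_⟩
          rintro ⟨t, ht, hlt⟩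
          exact absurd hlt (not_lt.2 (h3 t ht))
        · rintro ⟨h1, h2⟩
          refine ⟨Or.inl h2, ?_⟩
          push Not
          refine ⟨?_, ?_⟩
          · rintro ⟨t, -, ht⟩
            cases ht
          · rintro t ⟨s, hs, hst⟩
            obtain rfl := Option.some_injective _ hst
            exact h1 _ hs
      have hsub : {f : CadlagPath d | ∃ i ∈ I₂, b i < f.1 (τ i)} ⊆
          {f : CadlagPath d | ∃ i ∈ I₁, b i < f.1 (τ i)} := by
        rintro f ⟨i, hi, hlt⟩
        obtain ⟨t, ht, rfl⟩ := Finset.mem_map.1 hi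
        exact ⟨some t, by simpa [hI₁] using ht, hlt⟩
      rw [Measure.restrict_apply' hBm, Measure.restrict_apply' hBm, ← hC,
        measure_sdiff hsub (measurableSet_exists_lt _ _ _).nullMeasurableSet (hfin I₂ τ b hb2),
        measure_sdiff hsub (measurableSet_exists_lt _ _ _).nullMeasurableSet
          (by rw [← heq I₂ τ b hb2]; exact hfin I₂ τ b hb2), heq I₁ τ b hb1, heq I₂ τ b hb2]
    · simpa using hone
  set s : Option (ℕ × (Fin d → ℤ) × ℕ) → Set (CadlagPath d) := fun o =>
    o.elim {f | ∀ t, f.1 t = 0}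
      fun q => {f | 1 / ((q.2.2 : ℝ) + 1) < f.1 fun i => (q.2.1 i : ℝ) / ((q.1 : ℝ) + 1)} with hs
  have hsu : ⋃ o, s o = Set.univ := by
    refine Set.eq_univ_of_forall fun f => Set.mem_iUnion.2 ?_
    by_cases hf : ∀ t, f.1 t = 0
    · exact ⟨none, hf⟩
    · have : ¬ ∀ (n : ℕ) (k : Fin d → ℤ), f.1 (fun i => (k i : ℝ) / ((n : ℝ) + 1)) = 0 :=
        fun h => hf (f.eq_zero_of_grid h)
      push Not at this
      obtain ⟨n, k, hnk⟩ := this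
      obtain ⟨m, hm⟩ := exists_nat_one_div_lt (lt_of_le_of_ne (f.2.1 _) hnk.symm)
      exact ⟨some (n, k, m), hm⟩
  refine Measure.ext_of_iUnion_eq_univ hsu fun o => ?_
  rcases o with _ | ⟨n, k, m⟩
  · simp only [hs, Option.elim]
    rw [Measure.restrict_eq_zero.2 h0, Measure.restrict_eq_zero.2 h0']
  · exact hrestr _ _ (by positivity)

variable {Ω Ω' : Type*} [MeasurableSpace Ω] [MeasurableSpace Ω']
  {P : Measure Ω} {Z : Ω → (Fin d → ℝ) → ℝ} {P' : Measure Ω'}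
  {V : ℕ → Ω' → ℝ} {W : ℕ → Ω' → (Fin d → ℝ) → ℝ} {Y : Ω → CadlagPath d}

theorem IsNormalisedField.lintegral_eq_one (hZ : IsNormalisedField P Z) (t : Fin d → ℝ) :
    ∫⁻ ω, ENNReal.ofReal (Z ω t) ∂P = 1 := by
  rw [← ofReal_integral_eq_lintegral_ofReal (hZ.mean_one t).1
    (hZ.paths.mono fun ω h => h.1 t), (hZ.mean_one t).2, ENNReal.ofReal_one]

/-- The expected weighted maxima of the spectral field of a stationary max-stable field are shift
invariant. -/
theorem IsDeHaanInput.lintegral_sup_shift [IsProbabilityMeasure P] [IsProbabilityMeasure P']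
    (hVW : IsDeHaanInput P Z P' V W) (hX : IsStationaryField P' (maxStableField V W))
    (hmean : ∀ t, ∫⁻ ω, ENNReal.ofReal (Z ω t) ∂P ≠ ∞) (h : Fin d → ℝ)
    {ι : Type*} (I : Finset ι) (τ : ι → Fin d → ℝ) (a : ι → ℝ) (ha : ∀ t ∈ I, 0 < a t) :
    ∫⁻ ω, I.sup (fun t => ENNReal.ofReal (Z ω (τ t + h) / a t)) ∂P =
      ∫⁻ ω, I.sup (fun t => ENNReal.ofReal (Z ω (τ t) / a t)) ∂P := by
  classical
  obtain ⟨h1, h2⟩ := hVW.measure_maxStableField_le hmean I τ a ha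
  obtain ⟨h3, h4⟩ := hVW.measure_maxStableField_le hmean I (fun t => τ t + h) a ha
  have hmem : ∀ i ∈ I, τ i ∈ I.image τ := fun i hi => Finset.mem_image_of_mem _ hi
  have hS : MeasurableSet {x : (I.image τ) → ℝ | ∀ i (hi : i ∈ I), x ⟨τ i, hmem i hi⟩ ≤ a i} := by
    have : {x : (I.image τ) → ℝ | ∀ i (hi : i ∈ I), x ⟨τ i, hmem i hi⟩ ≤ a i} =
        ⋂ i : I, {x | x ⟨τ i, hmem i i.2⟩ ≤ a i} := by
      ext; simp
    rw [this]
    exact MeasurableSet.iInter fun i => measurableSet_le (measurable_pi_apply _) measurable_const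
  have h5 := (hX h (I.image τ)).measure_mem_eq hS
  have h6 : P' {ω | ∀ t ∈ I, maxStableField V W ω (τ t + h) ≤ a t} =
      P' {ω | ∀ t ∈ I, maxStableField V W ω (τ t) ≤ a t} := h5
  rw [h2, h4, ENNReal.ofReal_eq_ofReal_iff (Real.exp_pos _).le (Real.exp_pos _).le,
    Real.exp_eq_exp, neg_inj, ENNReal.toReal_eq_toReal_iff' h3 h1] at h6
  exact h6

/-- The exponent measure of a stationary max-stable field is shift invariant. -/
theorem measurePreserving_shift [IsProbabilityMeasure P] [IsProbabilityMeasure P']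
    (hZ : IsNormalisedField P Z) (hVW : IsDeHaanInput P Z P' V W)
    (hX : IsStationaryField P' (maxStableField V W)) (hY : Measurable Y)
    (hYZ : ∀ᵐ ω ∂P, (Y ω).1 = Z ω) (h : Fin d → ℝ) :
    MeasurePreserving (CadlagPath.shift h) (exponentMeasure P Y) (exponentMeasure P Y) := by
  have hsm := CadlagPath.measurable_shift h
  have hmean : ∀ t, ∫⁻ ω, ENNReal.ofReal (Z ω t) ∂P ≠ ∞ := fun t => by
    rw [hZ.lintegral_eq_one]; exact ENNReal.one_ne_top
  have hmass : ∀ (I : Finset (Option (Fin d → ℝ))) (τ : Option (Fin d → ℝ) → Fin d → ℝ)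
      (a : Option (Fin d → ℝ) → ℝ), (∀ i ∈ I, 0 < a i) →
      exponentMeasure P Y {f | ∃ i ∈ I, a i < f.1 (τ i)} =
        ∫⁻ ω, I.sup (fun t => ENNReal.ofReal (Z ω (τ t) / a t)) ∂P := fun I τ a ha => by
    rw [exponentMeasure_exists_lt hY I τ a ha]
    refine lintegral_congr_ae ?_
    filter_upwards [hYZ] with ω hω
    rw [hω]
  have hzm : MeasurableSet {f : CadlagPath d | ∀ t, f.1 t = 0} := by
    have : {f : CadlagPath d | ∀ t, f.1 t = 0} = ⋂ (n : ℕ) (k : Fin d → ℤ),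
        {f | f.1 (fun i => (k i : ℝ) / ((n : ℝ) + 1)) = 0} := by
      ext f
      simp only [Set.mem_ofPred_eq, Set.mem_iInter]
      exact ⟨fun hf n k => hf _, fun hf => f.eq_zero_of_grid hf⟩
    rw [this]
    exact MeasurableSet.iInter fun n => MeasurableSet.iInter fun k =>
      measurableSet_eq_fun (CadlagPath.measurable_apply _) measurable_const
  -- The masses of exceedance events never see the zero path; positivity of sup Z excludes it.
  have hzero : exponentMeasure P Y {f | ∀ t, f.1 t = 0} = 0 := by
    have := ae_exponentMeasure_of_ae (P := P) hY (p := fun f => ¬ ∀ t, f.1 t = 0) hzm.compl ?_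
    · rw [ae_iff] at this
      simpa using this
    · filter_upwards [hYZ, hZ.sup_pos] with ω hω hpos s hs hc
      obtain ⟨t, ht⟩ := lt_iSup_iff.1 hpos
      have h1 := hc t
      rw [CadlagPath.scale_apply, hω, NNReal.coe_inv, Real.coe_toNNReal _ hs.le] at h1
      rcases mul_eq_zero.1 h1 with h2 | h2
      · exact (inv_pos.2 hs).ne' h2
      · rw [h2] at ht; simp at ht
  refine ⟨hsm, ?_⟩
  symm
  refine CadlagPath.measure_ext hzero ?_ ?_ ?_
  · rw [Measure.map_apply hsm hzm]
    have : CadlagPath.shift h ⁻¹' {f : CadlagPath d | ∀ t, f.1 t = 0} = {f | ∀ t, f.1 t = 0} := by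
      ext f
      simp only [Set.mem_preimage, Set.mem_ofPred_eq, CadlagPath.shift_apply]
      exact ⟨fun hf t => by simpa using hf (t + h), fun hf t => hf _⟩
    rw [this, hzero]
  · intro I τ a ha
    rw [hmass I τ a ha]
    exact (hVW.measure_maxStableField_le hmean I τ a ha).1
  · intro I τ a ha
    rw [Measure.map_apply hsm (measurableSet_exists_lt I τ a), hmass I τ a ha]
    -- The shifted path is evaluated at τᵢ - h, and stationarity is used to add h back.
    have h1 := hmass I (fun i => τ i - h) a ha
    have h2 := hVW.lintegral_sup_shift hX hmean h I (fun i => τ i - h) a ha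
    simp only [sub_add_cancel] at h2
    rw [h2, ← h1]
    rfl

end ShiftInvariance

/-! ### Lebesgue measure and scaled counting measure treated alike. -/

section Lattice

variable {d : ℕ}

/-- The properties shared by the measures `λ_δ`: invariance under the translations in `H` and under
reflection, and asymptotic density one. -/
structure IsLatticeHaar (Λ : Measure (Fin d → ℝ)) (H : Set (Fin d → ℝ)) : Prop where
  neg_mem : ∀ h ∈ H, -h ∈ H
  ae_mem : ∀ᵐ t ∂Λ, t ∈ H
  add_right : ∀ h ∈ H, MeasurePreserving (fun t => t + h) Λ Λ
  neg : MeasurePreserving (fun t => -t) Λ Λ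
  ball_pos : 0 < Λ (Metric.ball 0 1)
  box_lt_top : ∀ a b : ℝ, Λ (Set.univ.pi fun _ => Set.Icc a b) < ∞
  growth : ∀ r : ℝ, Tendsto (fun T : ℝ => Λ (Set.univ.pi fun _ => Set.Icc r (T - r)) /
    ENNReal.ofReal (T ^ d)) atTop (𝓝 1)

/-- The point `η k` of the lattice `ηℤ^d`. -/
def latticePoint (η : ℝ) (k : Fin d → ℤ) : Fin d → ℝ := fun i => η * (k i : ℝ)

/-- The half-open cell `[0,η)^d`. -/
def latticeCell (d : ℕ) (η : ℝ) : Set (Fin d → ℝ) := Set.univ.pi fun _ => Set.Ico 0 η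

theorem latticePoint_injective {η : ℝ} (hη : η ≠ 0) :
    Function.Injective (latticePoint η : (Fin d → ℤ) → Fin d → ℝ) := fun k l h =>
  funext fun i => by simpa [latticePoint, hη] using congrFun h i

theorem scaledLattice_zero : scaledLattice d 0 = Set.univ := by simp [scaledLattice]

theorem scaledLattice_of_pos {δ : ℝ} (hδ : 0 < δ) :
    scaledLattice d δ = Set.range (latticePoint δ) := by
  simp [scaledLattice, hδ.ne']; rfl

theorem latticeMeasure_zero : latticeMeasure d 0 = volume := by simp [latticeMeasure]

/-- As a sum of Dirac masses indexed by ℤ^d, the measure turns integrals into series, and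
translations and reflection into bijections of the index set. -/
theorem latticeMeasure_of_pos {δ : ℝ} (hδ : 0 < δ) :
    latticeMeasure d δ = ENNReal.ofReal (δ ^ d) •
      Measure.sum fun k : Fin d → ℤ => Measure.dirac (latticePoint δ k) := by
  rw [latticeMeasure, if_neg hδ.ne', scaledLattice_of_pos hδ]
  congr 1
  ext s hs
  rw [Measure.restrict_apply hs, Measure.sum_apply _ hs]
  have h1 : s ∩ Set.range (latticePoint δ) = latticePoint δ '' (latticePoint δ ⁻¹' s) := by
    rw [Set.image_preimage_eq_inter_range]
  rw [h1, Measure.count_injective_image (latticePoint_injective hδ.ne')]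
  rw [Measure.count, Measure.sum_apply _ (Set.to_countable _).measurableSet]
  refine tsum_congr fun k => ?_
  rw [Measure.dirac_apply, Measure.dirac_apply]
  rfl

theorem lintegral_latticeMeasure {δ : ℝ} (hδ : 0 < δ) (g : (Fin d → ℝ) → ℝ≥0∞) :
    ∫⁻ t, g t ∂(latticeMeasure d δ) =
      ENNReal.ofReal (δ ^ d) * ∑' k : Fin d → ℤ, g (latticePoint δ k) := by
  rw [latticeMeasure_of_pos hδ, lintegral_smul_measure, lintegral_sum_measure]
  simp [lintegral_dirac]

theorem sFinite_latticeMeasure {δ : ℝ} (hδ : 0 ≤ δ) : SFinite (latticeMeasure d δ) := by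
  rcases hδ.eq_or_lt with rfl | hδ
  · rw [latticeMeasure_zero]; infer_instance
  · rw [latticeMeasure_of_pos hδ]; infer_instance

theorem latticeMeasure_pi {δ : ℝ} (hδ : 0 < δ) {A : Set ℝ} (hA : MeasurableSet A) (F : Finset ℤ)
    (hF : ∀ m : ℤ, δ * (m : ℝ) ∈ A ↔ m ∈ F) :
    latticeMeasure d δ (Set.univ.pi fun _ => A) = ENNReal.ofReal ((δ * F.card) ^ d) := by
  classical
  have hs : MeasurableSet (Set.univ.pi fun _ : Fin d => A) := MeasurableSet.univ_pi fun _ => hA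
  rw [← lintegral_indicator_one hs, lintegral_latticeMeasure hδ]
  have h1 : ∀ k : Fin d → ℤ, (Set.univ.pi fun _ : Fin d => A).indicator (1 : (Fin d → ℝ) → ℝ≥0∞)
      (latticePoint δ k) = if k ∈ Fintype.piFinset (fun _ : Fin d => F) then 1 else 0 := by
    intro k
    simp [Set.indicator_apply, latticePoint, hF, Fintype.mem_piFinset]
  simp_rw [h1]
  rw [tsum_eq_sum (s := Fintype.piFinset (fun _ : Fin d => F)) fun k hk => if_neg hk,
    Finset.sum_congr rfl (fun k hk => if_pos hk), Finset.sum_const, Fintype.card_piFinset]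
  simp only [Finset.prod_const, Finset.card_univ, Fintype.card_fin, nsmul_eq_mul, mul_one]
  rw [mul_pow, ENNReal.ofReal_mul (by positivity)]
  congr 1
  rw [← Nat.cast_pow, ENNReal.ofReal_natCast]

theorem mul_mem_Icc_iff {δ a b : ℝ} (hδ : 0 < δ) (m : ℤ) :
    δ * (m : ℝ) ∈ Set.Icc a b ↔ m ∈ Finset.Icc ⌈a / δ⌉ ⌊b / δ⌋ := by
  rw [Set.mem_Icc, Finset.mem_Icc, Int.ceil_le, Int.le_floor, div_le_iff₀' hδ, le_div_iff₀' hδ]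

theorem volume_pi_Icc_const (a b : ℝ) :
    volume (Set.univ.pi fun _ : Fin d => Set.Icc a b) = ENNReal.ofReal (b - a) ^ d := by
  rw [volume_pi_pi]
  simp [Real.volume_Icc]

/-- A bounded change of the side length does not affect the asymptotic volume of a cube. -/
theorem tendsto_pow_div_pow_one (d : ℕ) {K : ℝ} {q : ℝ → ℝ}
    (hq : ∀ᶠ T in atTop, |q T - T| ≤ K) :
    Tendsto (fun T : ℝ => ENNReal.ofReal (q T ^ d) / ENNReal.ofReal (T ^ d)) atTop (𝓝 1) := by
  have h1 : Tendsto (fun T : ℝ => (q T - T) / T) atTop (𝓝 0) := by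
    refine squeeze_zero_norm' ?_ (tendsto_const_nhds.div_atTop tendsto_id : Tendsto
      (fun T : ℝ => K / T) atTop (𝓝 0))
    filter_upwards [hq, eventually_gt_atTop 0] with T hT hT0
    rw [norm_div, Real.norm_eq_abs, Real.norm_of_nonneg hT0.le]
    gcongr
  have h2 : Tendsto (fun T : ℝ => ENNReal.ofReal ((1 + (q T - T) / T) ^ d)) atTop (𝓝 1) := by
    have := ENNReal.tendsto_ofReal ((h1.const_add 1).pow d)
    simpa using this
  refine h2.congr' ?_
  filter_upwards [eventually_gt_atTop 0] with T hT
  rw [← ENNReal.ofReal_div_of_pos (by positivity), ← div_pow]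
  congr 2
  field_simp
  ring

theorem isLatticeHaar_volume : IsLatticeHaar (volume : Measure (Fin d → ℝ)) Set.univ where
  neg_mem _ _ := trivial
  ae_mem := ae_of_all _ fun _ => trivial
  add_right h _ := measurePreserving_add_right volume h
  neg := Measure.measurePreserving_neg volume
  ball_pos := Metric.measure_ball_pos _ _ one_pos
  box_lt_top a b := by
    rw [volume_pi_Icc_const]
    exact ENNReal.pow_lt_top ENNReal.ofReal_lt_top
  growth r := by
    refine tendsto_pow_div_pow_one d (K := |2 * r|) (q := fun T => T - 2 * r) ?_ |>.congr' ?_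
    · exact Eventually.of_forall fun T => by simp
    · filter_upwards [eventually_ge_atTop (2 * r)] with T hT
      rw [volume_pi_Icc_const, ENNReal.ofReal_pow (by linarith)]
      ring_nf

theorem isLatticeHaar_of_pos {δ : ℝ} (hδ : 0 < δ) :
    IsLatticeHaar (latticeMeasure d δ) (scaledLattice d δ) where
  neg_mem := by
    rw [scaledLattice_of_pos hδ]
    rintro _ ⟨k, rfl⟩
    exact ⟨-k, funext fun i => by simp [latticePoint]⟩
  ae_mem := by
    rw [latticeMeasure, if_neg hδ.ne']
    refine Measure.ae_smul_measure ?_ _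
    refine ae_restrict_mem ?_
    rw [scaledLattice_of_pos hδ]
    exact (Set.countable_range _).measurableSet
  add_right := by
    rw [scaledLattice_of_pos hδ]
    rintro _ ⟨l, rfl⟩
    refine ⟨by fun_prop, ?_⟩
    ext s hs
    have hm : Measurable fun t : Fin d → ℝ => t + latticePoint δ l := by fun_prop
    rw [Measure.map_apply hm hs, ← lintegral_indicator_one hs,
      ← lintegral_indicator_one (hm hs), lintegral_latticeMeasure hδ, lintegral_latticeMeasure hδ,
      ← (Equiv.addRight l).tsum_eq fun k => s.indicator (1 : (Fin d → ℝ) → ℝ≥0∞) (latticePoint δ k)]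
    congr 1
    refine tsum_congr fun k => ?_
    have : latticePoint δ (k + l) = latticePoint δ k + latticePoint δ l :=
      funext fun i => by simp [latticePoint, mul_add]
    rw [Equiv.coe_addRight, this]
    rfl
  neg := by
    have hm : Measurable fun t : Fin d → ℝ => -t := by fun_prop
    refine ⟨hm, ?_⟩
    ext s hs
    rw [Measure.map_apply hm hs, ← lintegral_indicator_one hs,
      ← lintegral_indicator_one (hm hs), lintegral_latticeMeasure hδ, lintegral_latticeMeasure hδ,
      ← (Equiv.neg (Fin d → ℤ)).tsum_eq fun k => s.indicator (1 : (Fin d → ℝ) → ℝ≥0∞) (latticePoint δ k)]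
    congr 1
    refine tsum_congr fun k => ?_
    have : latticePoint δ (-k) = -latticePoint δ k :=
      funext fun i => by simp [latticePoint]
    rw [Equiv.neg_apply, this]
    rfl
  ball_pos := by
    rw [← lintegral_indicator_one Metric.isOpen_ball.measurableSet, lintegral_latticeMeasure hδ]
    refine ENNReal.mul_pos (by simpa using pow_pos hδ d) (ne_of_gt ?_)
    refine lt_of_lt_of_le one_pos (le_trans (le_of_eq ?_) (ENNReal.le_tsum 0))
    have : latticePoint δ (0 : Fin d → ℤ) = 0 := funext fun i => by simp [latticePoint]
    simp [this]
  box_lt_top a b := by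
    rw [latticeMeasure_pi hδ measurableSet_Icc _ (mul_mem_Icc_iff hδ)]
    exact ENNReal.ofReal_lt_top
  growth r := by
    simp_rw [latticeMeasure_pi hδ measurableSet_Icc _ (mul_mem_Icc_iff hδ)]
    -- δ times the number of lattice points in [r, T-r] differs from T - 2r by at most δ.
    refine tendsto_pow_div_pow_one d (K := |2 * r| + δ) ?_
    filter_upwards [eventually_ge_atTop (2 * r)] with T hT
    have e1 := Int.lt_floor_add_one ((T - r) / δ)
    have e2 := Int.ceil_lt_add_one (r / δ)
    have e3 := Int.floor_le ((T - r) / δ)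
    have e4 := Int.le_ceil (r / δ)
    have e5 : r / δ ≤ (T - r) / δ := by gcongr; linarith
    have hnn : 0 ≤ ⌊(T - r) / δ⌋ + 1 - ⌈r / δ⌉ := by
      have : (⌈r / δ⌉ : ℝ) < ((⌊(T - r) / δ⌋ + 1 + 1 : ℤ) : ℝ) := by push_cast; linarith
      have := Int.cast_lt.1 this
      omega
    have hc : ((Finset.Icc ⌈r / δ⌉ ⌊(T - r) / δ⌋).card : ℝ) =
        ⌊(T - r) / δ⌋ + 1 - ⌈r / δ⌉ := by
      rw [Int.card_Icc]
      have : (((⌊(T - r) / δ⌋ + 1 - ⌈r / δ⌉).toNat : ℤ) : ℝ) =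
          ((⌊(T - r) / δ⌋ + 1 - ⌈r / δ⌉ : ℤ) : ℝ) := by rw [Int.toNat_of_nonneg hnn]
      push_cast at this
      exact_mod_cast this
    rw [hc]
    have m1 : δ * ((T - r) / δ) = T - r := by field_simp
    have m2 : δ * (r / δ) = r := by field_simp
    have u1 := mul_lt_mul_of_pos_left e1 hδ
    have u2 := mul_lt_mul_of_pos_left e2 hδ
    have u3 := mul_le_mul_of_nonneg_left e3 hδ.le
    have u4 := mul_le_mul_of_nonneg_left e4 hδ.le
    rw [m1] at u1 u3
    rw [m2] at u4
    rw [mul_add, m2] at u2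
    have a1 := le_abs_self (2 * r)
    have a2 := neg_abs_le (2 * r)
    rw [abs_le]
    constructor <;> nlinarith

theorem isLatticeHaar_latticeMeasure {δ : ℝ} (hδ : 0 ≤ δ) :
    IsLatticeHaar (latticeMeasure d δ) (scaledLattice d δ) := by
  rcases hδ.eq_or_lt with rfl | hδ
  · rw [latticeMeasure_zero, scaledLattice_zero]; exact isLatticeHaar_volume
  · exact isLatticeHaar_of_pos hδ

/-- For δ > 0 it matters that η is an integer multiple kδ: the cell then holds exactly k^d points of
δℤ^d. -/
theorem latticeMeasure_latticeCell {δ η : ℝ} (hη : 0 < η)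
    (h : δ = 0 ∨ 0 < δ ∧ ∃ k : ℕ, η = k * δ) :
    latticeMeasure d δ (latticeCell d η) = ENNReal.ofReal (η ^ d) := by
  rcases h with rfl | ⟨hδ, k, rfl⟩
  · rw [latticeMeasure_zero, latticeCell, volume_pi_pi]
    simp [Real.volume_Ico, ENNReal.ofReal_pow hη.le]
  · rw [latticeCell, latticeMeasure_pi hδ measurableSet_Ico (Finset.Ico 0 (k : ℤ))]
    · simp [mul_comm]
    · intro m
      rw [Set.mem_Ico, Finset.mem_Ico, mul_comm (k : ℝ), mul_lt_mul_iff_right₀ hδ,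
        mul_nonneg_iff_of_pos_left hδ, Int.cast_nonneg_iff]
      norm_cast

theorem latticePoint_mem_scaledLattice {δ η : ℝ} (h : δ = 0 ∨ 0 < δ ∧ ∃ k : ℕ, η = k * δ)
    (l : Fin d → ℤ) : latticePoint η l ∈ scaledLattice d δ := by
  rcases h with rfl | ⟨hδ, k, rfl⟩
  · rw [scaledLattice_zero]; trivial
  · rw [scaledLattice_of_pos hδ]
    exact ⟨fun i => k * l i, funext fun i => by simp [latticePoint]; ring⟩

/-- Unfolding an integral along the translates of a fundamental cell. -/
theorem IsLatticeHaar.lintegral_unfold {Λ : Measure (Fin d → ℝ)} {H : Set (Fin d → ℝ)}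
    (hΛ : IsLatticeHaar Λ H) {η : ℝ} (hη : 0 < η) (hH : ∀ l, latticePoint η l ∈ H)
    {g : (Fin d → ℝ) → ℝ≥0∞} (hg : Measurable g) :
    ∫⁻ t, g t ∂Λ = ∑' l : Fin d → ℤ, ∫⁻ u in latticeCell d η, g (u + latticePoint η l) ∂Λ := by
  -- φ is the index of the cell containing t; its fibres partition space, and translation in H
  -- brings each fibre to the basic cell.
  set φ : (Fin d → ℝ) → Fin d → ℤ := fun t i => ⌊t i / η⌋ with hφ
  have hφm : Measurable φ := measurable_pi_lambda _ fun i =>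
    Int.measurable_floor.comp (by fun_prop)
  have hms : ∀ l, MeasurableSet (φ ⁻¹' {l}) := fun l => hφm (measurableSet_singleton l)
  have hu : ⋃ l, φ ⁻¹' {l} = Set.univ := by
    ext t; simp
  have hd : Pairwise (Function.onFun Disjoint fun l => φ ⁻¹' {l}) := fun l m hlm =>
    Disjoint.preimage _ (Set.disjoint_singleton.2 hlm)
  rw [← setLIntegral_univ, ← hu, lintegral_iUnion hms hd]
  refine tsum_congr fun l => ?_
  rw [← (hΛ.add_right _ (hH l)).setLIntegral_comp_preimage (hms l) hg]
  congr 2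
  ext u
  simp only [Set.mem_preimage, Set.mem_singleton_iff, hφ, funext_iff, latticeCell, Set.mem_univ_pi,
    Set.mem_Ico, Pi.add_apply, latticePoint]
  refine forall_congr' fun i => ?_
  rw [add_div, mul_div_cancel_left₀ _ hη.ne', Int.floor_add_intCast, add_eq_right,
    Int.floor_eq_zero_iff, Set.mem_Ico, div_lt_one hη, le_div_iff₀ hη, zero_mul]

end Lattice

/-! ### Exceedance sets, near points and mass transport. -/

section Exceedances

variable {d : ℕ}

/-- The cube `[a,b]^d`. -/
def box (d : ℕ) (a b : ℝ) : Set (Fin d → ℝ) := Set.univ.pi fun _ => Set.Icc a b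

theorem measurableSet_box (a b : ℝ) : MeasurableSet (box d a b) :=
  MeasurableSet.univ_pi fun _ => measurableSet_Icc

theorem cube_eq_box (T : ℝ) : cube d T = box d 0 T := by
  ext t; simp [cube, box, Pi.le_def, forall_and]

theorem closedBall_subset_box {r T : ℝ} {t : Fin d → ℝ} (ht : t ∈ box d r (T - r)) :
    Metric.closedBall t r ⊆ box d 0 T := by
  intro u hu i _
  have h1 := (dist_le_pi_dist u t i).trans (Metric.mem_closedBall.1 hu)
  rw [Real.dist_eq, abs_le] at h1
  have h2 := ht i trivial
  exact ⟨by linarith [h2.1], by linarith [h2.2]⟩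

theorem box_subset_box {a b a' b' : ℝ} (ha : a' ≤ a) (hb : b ≤ b') : box d a b ⊆ box d a' b' :=
  fun _ ht i hi => ⟨ha.trans (ht i hi).1, (ht i hi).2.trans hb⟩

theorem ball_subset_box {T : ℝ} {t : Fin d → ℝ} (ht : t ∈ box d 0 T) :
    Metric.ball t 1 ⊆ box d (-1) (T - -1) := by
  intro u hu i _
  have h1 := (dist_le_pi_dist u t i).trans_lt (Metric.mem_ball.1 hu)
  rw [Real.dist_eq, abs_lt] at h1
  have h2 := ht i trivial
  exact ⟨by linarith [h2.1], by linarith [h2.2]⟩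

theorem iUnion_closedBall_zero : ⋃ n : ℕ, Metric.closedBall (0 : Fin d → ℝ) n = Set.univ :=
  Metric.iUnion_closedBall_nat 0

/-- The `Λ`-measure of the part of `A` on which the path exceeds the level one. -/
noncomputable def exceedance (Λ : Measure (Fin d → ℝ)) (f : CadlagPath d)
    (A : Set (Fin d → ℝ)) : ℝ≥0∞ := Λ {t | t ∈ A ∧ 1 < f.1 t}

/-- The integral of the path with respect to `Λ`. -/
noncomputable def pathMass (Λ : Measure (Fin d → ℝ)) (f : CadlagPath d) : ℝ≥0∞ :=
  ∫⁻ t, ENNReal.ofReal (f.1 t) ∂Λ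

/-- The points near which the path exceeds the level one on a set of positive `Λ`-measure. -/
def nearSet (Λ : Measure (Fin d → ℝ)) (f : CadlagPath d) : Set (Fin d → ℝ) :=
  {τ | 0 < exceedance Λ f (Metric.ball τ 1)}

variable {Λ : Measure (Fin d → ℝ)} {H : Set (Fin d → ℝ)}

theorem exceedance_mono (f : CadlagPath d) {A B : Set (Fin d → ℝ)} (h : A ⊆ B) :
    exceedance Λ f A ≤ exceedance Λ f B := measure_mono fun _ ht => ⟨h ht.1, ht.2⟩

theorem measurableSet_one_lt {α : Type*} [MeasurableSpace α] {f : α → CadlagPath d}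
    {t : α → Fin d → ℝ} (hf : Measurable f) (ht : Measurable t) :
    MeasurableSet {a | 1 < (f a).1 (t a)} :=
  measurableSet_lt measurable_const (CadlagPath.measurable_eval_comp hf ht)

theorem measurable_exceedance [SFinite Λ] {α : Type*} [MeasurableSpace α] {f : α → CadlagPath d}
    (hf : Measurable f) {A : α → Set (Fin d → ℝ)}
    (hA : MeasurableSet {p : α × (Fin d → ℝ) | p.2 ∈ A p.1}) :
    Measurable fun a => exceedance Λ (f a) (A a) := by
  have hm : MeasurableSet {p : α × (Fin d → ℝ) | p.2 ∈ A p.1 ∧ 1 < (f p.1).1 p.2} :=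
    hA.inter (measurableSet_one_lt (hf.comp measurable_fst) measurable_snd)
  exact measurable_measure_prodMk_left hm

theorem measurable_exceedance_const [SFinite Λ] {A : Set (Fin d → ℝ)} (hA : MeasurableSet A) :
    Measurable fun f : CadlagPath d => exceedance Λ f A :=
  measurable_exceedance measurable_id (measurable_snd hA)

theorem measurable_pathMass [SFinite Λ] : Measurable (pathMass Λ : CadlagPath d → ℝ≥0∞) := by
  have : Measurable fun p : CadlagPath d × (Fin d → ℝ) => ENNReal.ofReal (p.1.1 p.2) := by fun_prop
  exact this.lintegral_prod_right'

theorem measurableSet_nearSet [SFinite Λ] {α : Type*} [MeasurableSpace α] {f : α → CadlagPath d}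
    (hf : Measurable f) {τ : α → Fin d → ℝ} (hτ : Measurable τ) :
    MeasurableSet {a | τ a ∈ nearSet Λ (f a)} := by
  refine measurableSet_lt measurable_const (measurable_exceedance hf ?_)
  simp only [Metric.mem_ball]
  exact measurableSet_lt (by fun_prop) measurable_const

theorem IsLatticeHaar.sub_right (hΛ : IsLatticeHaar Λ H) {h : Fin d → ℝ} (hh : h ∈ H) :
    MeasurePreserving (fun t => t - h) Λ Λ := by
  simpa [sub_eq_add_neg] using hΛ.add_right _ (hΛ.neg_mem h hh)

theorem IsLatticeHaar.exceedance_shift (hΛ : IsLatticeHaar Λ H) {h : Fin d → ℝ} (hh : h ∈ H)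
    (f : CadlagPath d) {A : Set (Fin d → ℝ)} (hA : MeasurableSet A) :
    exceedance Λ (f.shift h) A = exceedance Λ f ((fun t => t + h) ⁻¹' A) := by
  unfold exceedance
  have hm : MeasurableSet {t | t ∈ A ∧ 1 < (f.shift h).1 t} :=
    hA.inter (measurableSet_one_lt measurable_const measurable_id)
  rw [← (hΛ.add_right h hh).measure_preimage hm.nullMeasurableSet]
  congr 1
  ext t
  simp

theorem IsLatticeHaar.exceedance_shift_univ (hΛ : IsLatticeHaar Λ H) {h : Fin d → ℝ} (hh : h ∈ H)
    (f : CadlagPath d) : exceedance Λ (f.shift h) Set.univ = exceedance Λ f Set.univ := by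
  rw [hΛ.exceedance_shift hh f MeasurableSet.univ, Set.preimage_univ]

theorem IsLatticeHaar.pathMass_shift (hΛ : IsLatticeHaar Λ H) {h : Fin d → ℝ} (hh : h ∈ H)
    (f : CadlagPath d) : pathMass Λ (f.shift h) = pathMass Λ f := by
  unfold pathMass
  have hm : Measurable fun t => ENNReal.ofReal (f.1 t) := by fun_prop
  exact (hΛ.sub_right hh).lintegral_comp hm

theorem preimage_add_ball_eq_sub (h τ : Fin d → ℝ) (r : ℝ) :
    (fun t => t + h) ⁻¹' Metric.ball τ r = Metric.ball (τ - h) r := by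
  ext t
  simp only [Set.mem_preimage, Metric.mem_ball, dist_eq_norm]
  rw [show t + h - τ = t - (τ - h) by abel]

theorem IsLatticeHaar.mem_nearSet_shift (hΛ : IsLatticeHaar Λ H) {h : Fin d → ℝ} (hh : h ∈ H)
    (f : CadlagPath d) (τ : Fin d → ℝ) : τ ∈ nearSet Λ (f.shift h) ↔ τ - h ∈ nearSet Λ f := by
  unfold nearSet
  rw [Set.mem_ofPred_eq, Set.mem_ofPred_eq,
    hΛ.exceedance_shift hh f Metric.isOpen_ball.measurableSet, preimage_add_ball_eq_sub]

theorem IsLatticeHaar.measure_ball (hΛ : IsLatticeHaar Λ H) {h : Fin d → ℝ} (hh : h ∈ H) :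
    Λ (Metric.ball h 1) = Λ (Metric.ball 0 1) := by
  rw [← (hΛ.add_right h hh).measure_preimage Metric.isOpen_ball.measurableSet.nullMeasurableSet,
    preimage_add_ball_eq_sub, sub_self]

theorem IsLatticeHaar.measure_ball_lt_top (hΛ : IsLatticeHaar Λ H) :
    Λ (Metric.ball 0 1) < ∞ :=
  (measure_mono (ball_subset_box (T := 0) (t := 0) fun i _ => by simp)).trans_lt
    (hΛ.box_lt_top _ _)

/-- A lower bound on the number of near points, uniform over all paths that exceed the level in the
cube. It lets one charge each such path to its near points at a cost of at most 1/Λ(ball). -/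
theorem IsLatticeHaar.measure_ball_le_of_exceedance_pos (hΛ : IsLatticeHaar Λ H)
    {f : CadlagPath d} {T : ℝ} (h : 0 < exceedance Λ f (box d 0 T)) :
    Λ (Metric.ball 0 1) ≤ Λ (nearSet Λ f ∩ box d (-1) (T - -1)) := by
  set s : Set (Fin d → ℝ) := {t | t ∈ box d 0 T ∧ 1 < f.1 t} with hs
  have h1 : Λ (s ∩ H) ≠ 0 := by
    rw [measure_congr (inter_ae_eq_left_of_ae_eq_univ (t := H) (eventuallyEq_univ.2 hΛ.ae_mem))]
    exact h.ne'
  -- Every neighbourhood of u meets the exceedance set in positive measure, so all points of the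
  -- unit ball about u are near. Since u lies in H, this ball has the measure of the ball about 0.
  obtain ⟨u, hu, hpos⟩ := exists_mem_forall_mem_nhdsWithin_pos_measure h1
  rw [← hΛ.measure_ball hu.2]
  refine measure_mono fun τ hτ => ⟨?_, ball_subset_box hu.1.1 hτ⟩
  have h2 : Metric.ball τ 1 ∈ 𝓝 u := Metric.isOpen_ball.mem_nhds (Metric.mem_ball_comm.1 hτ)
  have h3 : (s ∩ H) ∩ Metric.ball τ 1 ∈ 𝓝[s ∩ H] u :=
    Filter.inter_mem self_mem_nhdsWithin (mem_nhdsWithin_of_mem_nhds h2)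
  exact (hpos _ h3).trans_le (measure_mono fun t ht => ⟨ht.2, ht.1.1.2⟩)

theorem pathMass_pos_of_exceedance_pos {f : CadlagPath d} {A : Set (Fin d → ℝ)}
    (h : 0 < exceedance Λ f A) : 0 < pathMass Λ f := by
  by_contra hc
  have hm : Measurable fun t => ENNReal.ofReal (f.1 t) := by fun_prop
  have h0 := (lintegral_eq_zero_iff hm).1 (nonpos_iff_eq_zero.1 (not_lt.1 hc))
  refine h.ne' (measure_mono_null ?_ (ae_iff.1 h0))
  rintro t ⟨-, ht⟩ h1
  simp only [Pi.zero_apply, ENNReal.ofReal_eq_zero] at h1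
  linarith

/-- Count pairs (τ, t) with t an exceedance and |τ - t| < 1. Summed over t they give c times the
infinite exceedance measure; summed over τ they give at most c per near point. -/
theorem IsLatticeHaar.measure_nearSet_eq_top [SFinite Λ] (hΛ : IsLatticeHaar Λ H)
    {f : CadlagPath d} (h : exceedance Λ f Set.univ = ∞) : Λ (nearSet Λ f) = ∞ := by
  set c := Λ (Metric.ball 0 1) with hc
  have hfm : MeasurableSet {t | 1 < f.1 t} := measurableSet_one_lt measurable_const measurable_id
  have hpm : MeasurableSet {p : (Fin d → ℝ) × (Fin d → ℝ) | dist p.1 p.2 < 1 ∧ 1 < f.1 p.2} :=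
    (measurableSet_lt (f := fun p : (Fin d → ℝ) × (Fin d → ℝ) => dist p.1 p.2) (by fun_prop)
      measurable_const).inter (measurableSet_one_lt measurable_const measurable_snd)
  have h1 : ∫⁻ τ, exceedance Λ f (Metric.ball τ 1) ∂Λ = c * exceedance Λ f Set.univ := by
    have e1 : ∫⁻ τ, exceedance Λ f (Metric.ball τ 1) ∂Λ =
        ∫⁻ τ, Λ (Prod.mk τ ⁻¹' {p : (Fin d → ℝ) × (Fin d → ℝ) |
          dist p.1 p.2 < 1 ∧ 1 < f.1 p.2}) ∂Λ := by
      refine lintegral_congr fun τ => ?_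
      unfold exceedance
      congr 1
      ext t
      simp [dist_comm]
    rw [e1, ← Measure.prod_apply hpm, Measure.prod_apply_symm hpm]
    have e2 : ∀ᵐ t ∂Λ, Λ ((fun τ => (τ, t)) ⁻¹' {p : (Fin d → ℝ) × (Fin d → ℝ) |
          dist p.1 p.2 < 1 ∧ 1 < f.1 p.2}) = {t | 1 < f.1 t}.indicator (fun _ => c) t := by
      filter_upwards [hΛ.ae_mem] with t ht
      by_cases hft : 1 < f.1 t
      · rw [Set.indicator_of_mem (show t ∈ {t | 1 < f.1 t} from hft), hc, ← hΛ.measure_ball ht]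
        congr 1
        ext τ
        simp [hft]
      · rw [Set.indicator_of_notMem (show t ∉ {t | 1 < f.1 t} from hft)]
        have : (fun τ => (τ, t)) ⁻¹' {p : (Fin d → ℝ) × (Fin d → ℝ) |
          dist p.1 p.2 < 1 ∧ 1 < f.1 p.2} = ∅ := by ext τ; simp [not_lt.1 hft]
        rw [this, measure_empty]
    rw [lintegral_congr_ae e2, lintegral_indicator_const hfm]
    simp [exceedance]
  have h2 : ∫⁻ τ, exceedance Λ f (Metric.ball τ 1) ∂Λ ≤ c * Λ (nearSet Λ f) := by
    have hnm : MeasurableSet (nearSet Λ f) :=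
      measurableSet_nearSet (α := Fin d → ℝ) measurable_const measurable_id
    rw [← lintegral_indicator_const hnm]
    refine lintegral_mono_ae ?_
    filter_upwards [hΛ.ae_mem] with τ hτ
    by_cases hn : τ ∈ nearSet Λ f
    · rw [Set.indicator_of_mem hn, hc, ← hΛ.measure_ball hτ]
      exact measure_mono fun t ht => ht.1
    · rw [Set.indicator_of_notMem hn]
      exact (not_lt.1 hn)
  rw [h1, h, ENNReal.mul_top hΛ.ball_pos.ne', top_le_iff] at h2
  by_contra hne
  exact ENNReal.mul_ne_top hΛ.measure_ball_lt_top.ne hne h2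

/-- Tonelli's theorem combined with shift invariance. -/
theorem lintegral_transport [SFinite Λ] {ν : Measure (CadlagPath d)} [SFinite ν]
    (hν : ∀ h, MeasurePreserving (CadlagPath.shift h) ν ν)
    {Φ : CadlagPath d → (Fin d → ℝ) → ℝ≥0∞} (hΦ : Measurable (Function.uncurry Φ)) :
    ∫⁻ f, ∫⁻ t, Φ f t ∂Λ ∂ν = ∫⁻ f, ∫⁻ t, Φ (f.shift t) t ∂Λ ∂ν := by
  have hm2 : Measurable (Function.uncurry fun (f : CadlagPath d) t => Φ (f.shift t) t) :=
    hΦ.comp (by fun_prop : Measurable fun p : CadlagPath d × (Fin d → ℝ) =>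
      (p.1.shift p.2, p.2))
  rw [lintegral_lintegral_swap hΦ.aemeasurable, lintegral_lintegral_swap hm2.aemeasurable]
  refine lintegral_congr fun t => ?_
  exact ((hν t).lintegral_comp (hΦ.comp (by fun_prop :
    Measurable fun f : CadlagPath d => (f, t)))).symm

end Exceedances

/-! ### Lower bound by rooting, and negligibility of error terms. -/

section Asymptotics

variable {d : ℕ} {Λ : Measure (Fin d → ℝ)} {H : Set (Fin d → ℝ)} {ν : Measure (CadlagPath d)}

/-- The measure with density `f(0) / ∫ f dΛ` with respect to `ν`. -/
noncomputable def tiltedMeasure (Λ : Measure (Fin d → ℝ)) (ν : Measure (CadlagPath d)) :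
    Measure (CadlagPath d) :=
  ν.withDensity fun f => ENNReal.ofReal (f.1 0) / pathMass Λ f

theorem add_mem_box_of_closedBall {r T : ℝ} {t : Fin d → ℝ} (ht : t ∈ box d r (T - r)) :
    Metric.closedBall 0 r ⊆ (fun u => u + t) ⁻¹' box d 0 T := by
  intro u hu
  refine closedBall_subset_box ht ?_
  simpa [dist_eq_norm] using hu

theorem lintegral_const_mul_indicator_box {A : Set (Fin d → ℝ)} (hA : MeasurableSet A) (c : ℝ≥0∞) :
    ∫⁻ t, A.indicator 1 t * c ∂Λ = Λ A * c := by
  rw [lintegral_mul_const _ (measurable_one.indicator hA), lintegral_indicator_one hA]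

theorem measurable_one_indicator_comp {α β : Type*} [MeasurableSpace α] [MeasurableSpace β]
    {A : Set β} (hA : MeasurableSet A) {g : α → β} (hg : Measurable g) :
    Measurable fun a => A.indicator (1 : β → ℝ≥0∞) (g a) :=
  (measurable_one.indicator hA).comp hg

theorem measurableSet_lt_exceedance [SFinite Λ] (X : ℝ≥0∞) {A : Set (Fin d → ℝ)}
    (hA : MeasurableSet A) : MeasurableSet {f : CadlagPath d | X < exceedance Λ f A} :=
  measurableSet_lt measurable_const (measurable_exceedance_const hA)

theorem tiltedMeasure_apply [SFinite Λ] {S : Set (CadlagPath d)} (hS : MeasurableSet S) :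
    tiltedMeasure Λ ν S =
      ∫⁻ f, S.indicator 1 f * (ENNReal.ofReal (f.1 0) / pathMass Λ f) ∂ν := by
  rw [tiltedMeasure, withDensity_apply _ hS, ← lintegral_indicator hS]
  refine lintegral_congr fun f => ?_
  by_cases hf : f ∈ S <;> simp [hf]

theorem measurable_shareIntegrand [SFinite Λ] {S : Set (CadlagPath d)} (hS : MeasurableSet S)
    {B : Set (Fin d → ℝ)} (hB : MeasurableSet B) :
    Measurable (Function.uncurry fun (f : CadlagPath d) (t : Fin d → ℝ) =>
      B.indicator (1 : (Fin d → ℝ) → ℝ≥0∞) t * (S.indicator 1 f *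
        (ENNReal.ofReal (f.1 t) / pathMass Λ f))) := by
  have h1 := measurable_one_indicator_comp hB
    (measurable_snd : Measurable fun p : CadlagPath d × (Fin d → ℝ) => p.2)
  have h2 := measurable_one_indicator_comp hS
    (measurable_fst : Measurable fun p : CadlagPath d × (Fin d → ℝ) => p.1)
  have h3 := (measurable_pathMass (Λ := Λ)).comp
    (measurable_fst : Measurable fun p : CadlagPath d × (Fin d → ℝ) => p.1)
  have h4 : Measurable fun p : CadlagPath d × (Fin d → ℝ) => ENNReal.ofReal (p.1.1 p.2) := by
    fun_prop
  exact h1.mul (h2.mul (h4.div h3))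

/-- A lower bound for the exceedance functional on a large cube. -/
theorem IsLatticeHaar.le_measure_exceedance [SFinite Λ] [SFinite ν] (hΛ : IsLatticeHaar Λ H)
    (hν : ∀ h, MeasurePreserving (CadlagPath.shift h) ν ν) (X : ℝ≥0∞) (r T : ℝ) :
    Λ (box d r (T - r)) * tiltedMeasure Λ ν {f | X < exceedance Λ f (Metric.closedBall 0 r)} ≤
      ν {f | X < exceedance Λ f (box d 0 T)} := by
  set S : Set (CadlagPath d) := {f | X < exceedance Λ f (box d 0 T)} with hS
  set S' : Set (CadlagPath d) := {f | X < exceedance Λ f (Metric.closedBall 0 r)} with hS'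
  set B := box d r (T - r) with hB
  have hBm : MeasurableSet B := measurableSet_box _ _
  have hSm : MeasurableSet S := measurableSet_lt_exceedance X (measurableSet_box _ _)
  have hSm' : MeasurableSet S' :=
    measurableSet_lt_exceedance X Metric.isClosed_closedBall.measurableSet
  have hm := measurable_shareIntegrand (Λ := Λ) hSm hBm
  -- If t lies in the inner cube and the ball of radius r about 0 already carries more than X, then
  -- the path shifted by t has it inside [0,T]^d. Transport undoes the shift, and the densities
  -- f(t)/∫f integrate to at most one.
  calc Λ B * tiltedMeasure Λ ν S'
      = ∫⁻ f, ∫⁻ t, B.indicator 1 t * (S'.indicator 1 f *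
          (ENNReal.ofReal (f.1 0) / pathMass Λ f)) ∂Λ ∂ν := by
        simp_rw [lintegral_const_mul_indicator_box hBm]
        rw [tiltedMeasure_apply hSm', lintegral_const_mul']
        exact ((measure_mono (box_subset_box (le_refl r) (le_refl _))).trans_lt
          (hΛ.box_lt_top _ _)).ne
    _ ≤ ∫⁻ f, ∫⁻ t, B.indicator 1 t * (S.indicator 1 (f.shift t) *
          (ENNReal.ofReal ((f.shift t).1 t) / pathMass Λ (f.shift t))) ∂Λ ∂ν := by
        refine lintegral_mono fun f => lintegral_mono_ae ?_
        filter_upwards [hΛ.ae_mem] with t ht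
        by_cases htB : t ∈ B
        · rw [hΛ.pathMass_shift ht, CadlagPath.shift_apply, sub_self]
          refine mul_le_mul' le_rfl (mul_le_mul' ?_ le_rfl)
          by_cases hf : f ∈ S'
          · have hfS : f.shift t ∈ S := by
              have h1 : X < exceedance Λ f (Metric.closedBall 0 r) := hf
              rw [hS, Set.mem_ofPred_eq, hΛ.exceedance_shift ht f (measurableSet_box _ _)]
              exact h1.trans_le (exceedance_mono f (add_mem_box_of_closedBall htB))
            simp [hf, hfS]
          · simp [hf]
        · simp [htB]
    _ = ∫⁻ f, ∫⁻ t, B.indicator 1 t * (S.indicator 1 f *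
          (ENNReal.ofReal (f.1 t) / pathMass Λ f)) ∂Λ ∂ν := (lintegral_transport hν hm).symm
    _ ≤ ∫⁻ f, S.indicator 1 f ∂ν := by
        refine lintegral_mono fun f => ?_
        calc _ ≤ ∫⁻ t, S.indicator 1 f * (ENNReal.ofReal (f.1 t) / pathMass Λ f) ∂Λ := by
              refine lintegral_mono fun t => mul_le_of_le_one_left' ?_
              exact Set.indicator_le_self' (fun _ _ => zero_le) t
          _ ≤ S.indicator 1 f * 1 := by
              have hfm : Measurable fun t => ENNReal.ofReal (f.1 t) := by fun_prop
              rw [lintegral_const_mul _ (hfm.div_const _)]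
              gcongr
              simp_rw [div_eq_mul_inv]
              rw [lintegral_mul_const _ hfm, ← div_eq_mul_inv]
              exact ENNReal.div_self_le_one
          _ = _ := mul_one _
    _ = ν S := lintegral_indicator_one hSm

/-- The exceedances on the cube are eventually bounded from below by the tilted measure. -/
theorem IsLatticeHaar.tiltedMeasure_le_liminf [SFinite Λ] [SFinite ν] (hΛ : IsLatticeHaar Λ H)
    (hν : ∀ h, MeasurePreserving (CadlagPath.shift h) ν ν) (X : ℝ≥0∞) :
    tiltedMeasure Λ ν {f | X < exceedance Λ f Set.univ} ≤
      liminf (fun T : ℝ => ν {f | X < exceedance Λ f (box d 0 T)} / ENNReal.ofReal (T ^ d))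
        atTop := by
  have hmono : Monotone fun n : ℕ => {f : CadlagPath d |
      X < exceedance Λ f (Metric.closedBall 0 (n : ℝ))} := fun m n hmn f hf =>
    lt_of_lt_of_le hf (exceedance_mono f (Metric.closedBall_subset_closedBall
      (by exact_mod_cast hmn)))
  have hU : ⋃ n : ℕ, {f : CadlagPath d | X < exceedance Λ f (Metric.closedBall 0 (n : ℝ))} =
      {f | X < exceedance Λ f Set.univ} := by
    ext f
    simp only [Set.mem_iUnion, Set.mem_ofPred_eq]
    refine ⟨fun ⟨n, hn⟩ => hn.trans_le (exceedance_mono f (Set.subset_univ _)), fun h => ?_⟩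
    have hlim : Tendsto (fun n : ℕ => exceedance Λ f (Metric.closedBall 0 (n : ℝ))) atTop
        (𝓝 (exceedance Λ f Set.univ)) := by
      have := tendsto_measure_iUnion_atTop (μ := Λ)
        (s := fun n : ℕ => {t | t ∈ Metric.closedBall (0 : Fin d → ℝ) n ∧ 1 < f.1 t})
        (fun m n hmn t ht => ⟨Metric.closedBall_subset_closedBall (by exact_mod_cast hmn) ht.1,
          ht.2⟩)
      suffices hset : ⋃ n : ℕ, {t | t ∈ Metric.closedBall (0 : Fin d → ℝ) n ∧ 1 < f.1 t} =
          {t | t ∈ Set.univ ∧ 1 < f.1 t} by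
        rw [hset] at this
        exact this
      ext t
      simp only [Set.mem_univ, true_and, Set.mem_ofPred_eq, Set.mem_iUnion]
      symm
      refine ⟨fun ht => ?_, fun ⟨_, _, ht⟩ => ht⟩
      have := Set.mem_univ t
      rw [← iUnion_closedBall_zero, Set.mem_iUnion] at this
      obtain ⟨n, hn⟩ := this
      exact ⟨n, hn, ht⟩
    exact ((tendsto_order.1 hlim).1 X h).exists
  have hlim := tendsto_measure_iUnion_atTop (μ := tiltedMeasure Λ ν) hmono
  rw [hU] at hlim
  -- For a fixed radius n the inner cube still has asymptotic density one; only afterwards does n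
  -- tend to infinity.
  refine le_of_tendsto' hlim fun n => ?_
  have h1 := ENNReal.Tendsto.mul_const (hΛ.growth n)
    (b := tiltedMeasure Λ ν {f | X < exceedance Λ f (Metric.closedBall 0 (n : ℝ))})
    (Or.inl one_ne_zero)
  rw [one_mul] at h1
  rw [Function.comp_apply, ← h1.liminf_eq]
  refine liminf_le_liminf (Eventually.of_forall fun T => ?_)
  rw [ENNReal.div_eq_inv_mul, mul_assoc, ENNReal.div_eq_inv_mul]
  gcongr
  exact hΛ.le_measure_exceedance hν X n T

/-- Boundary effects and contributions that vanish far away from the exceedance are negligible. -/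
theorem IsLatticeHaar.tendsto_negligible [SFinite Λ] [SFinite ν] (hΛ : IsLatticeHaar Λ H)
    (hν : ∀ h, MeasurePreserving (CadlagPath.shift h) ν ν)
    (hnear : ν {f | 0 ∈ nearSet Λ f} ≠ ∞)
    {q : ℝ → CadlagPath d → (Fin d → ℝ) → ℝ≥0∞} (hq : ∀ T, Measurable (Function.uncurry (q T)))
    (hq1 : ∀ T f t, q T f t ≤ 1) {k : ℕ → CadlagPath d → ℝ≥0∞} (hk : ∀ n, Measurable (k n))
    (hqk : ∀ (n : ℕ) T f, ∀ t ∈ H, t ∈ box d n (T - n) → q T (f.shift t) t ≤ k n f)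
    (hk1 : ∀ n f, k n f ≤ 1)
    (hk0 : ∀ᵐ f ∂ν, 0 ∈ nearSet Λ f → Tendsto (fun n => k n f) atTop (𝓝 0)) :
    Tendsto (fun T : ℝ => (∫⁻ f, ∫⁻ t, (box d (-1) (T - -1)).indicator 1 t *
      ({τ | τ ∈ nearSet Λ f}.indicator 1 t * q T f t) ∂Λ ∂ν) / ENNReal.ofReal (T ^ d))
      atTop (𝓝 0) := by
  set N : Set (CadlagPath d) := {f | 0 ∈ nearSet Λ f} with hN
  have hNm : MeasurableSet N := measurableSet_nearSet measurable_id measurable_const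
  have hK : Tendsto (fun n => ∫⁻ f, N.indicator 1 f * k n f ∂ν) atTop (𝓝 0) := by
    have h1 : Tendsto (fun n => ∫⁻ f, N.indicator 1 f * k n f ∂ν) atTop (𝓝 (∫⁻ _, 0 ∂ν)) := by
      refine tendsto_lintegral_of_dominated_convergence (N.indicator 1)
        (fun n => (measurable_one.indicator hNm).mul (hk n)) (fun n => ae_of_all _ fun f =>
          mul_le_of_le_one_right' (hk1 n f)) ?_ ?_
      · rwa [lintegral_indicator_one hNm]
      · filter_upwards [hk0] with f hf
        by_cases hfN : f ∈ N
        · simpa [hfN] using hf hfN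
        · simp [hfN]
    simpa using h1
  -- After transport every near point sits at the origin. Points at distance at least n from the
  -- boundary contribute at most k n; the remaining boundary layer is bounded trivially by its
  -- volume times the intensity of near points.
  have hbound : ∀ (n : ℕ) (T : ℝ), ∫⁻ f, ∫⁻ t, (box d (-1) (T - -1)).indicator 1 t *
      ({τ | τ ∈ nearSet Λ f}.indicator 1 t * q T f t) ∂Λ ∂ν ≤
      Λ (box d n (T - n)) * (∫⁻ f, N.indicator 1 f * k n f ∂ν) +
        (Λ (box d (-1) (T - -1)) - Λ (box d n (T - n))) * ν N := by
    intro n T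
    set B := box d (-1) (T - -1) with hB
    set B' := box d n (T - n) with hB'
    have hn0 : (0 : ℝ) ≤ n := Nat.cast_nonneg n
    have hsub : B' ⊆ B := box_subset_box (by linarith) (by linarith)
    have hBm : MeasurableSet B := measurableSet_box _ _
    have hBm' : MeasurableSet B' := measurableSet_box _ _
    have hm : Measurable (Function.uncurry fun (f : CadlagPath d) (t : Fin d → ℝ) =>
        B.indicator (1 : (Fin d → ℝ) → ℝ≥0∞) t * ({τ | τ ∈ nearSet Λ f}.indicator 1 t * q T f t)) := by
      have h1 := measurable_one_indicator_comp hBm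
        (measurable_snd : Measurable fun p : CadlagPath d × (Fin d → ℝ) => p.2)
      have h2 : MeasurableSet {p : CadlagPath d × (Fin d → ℝ) | p.2 ∈ nearSet Λ p.1} :=
        measurableSet_nearSet measurable_fst measurable_snd
      have h3 : Measurable fun p : CadlagPath d × (Fin d → ℝ) =>
        {τ | τ ∈ nearSet Λ p.1}.indicator (1 : (Fin d → ℝ) → ℝ≥0∞) p.2 := measurable_one.indicator h2
      exact h1.mul (h3.mul (hq T))
    rw [lintegral_transport hν hm]
    calc _ ≤ ∫⁻ f, ∫⁻ t, (B'.indicator 1 t * (N.indicator 1 f * k n f) +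
          (B \ B').indicator 1 t * N.indicator 1 f) ∂Λ ∂ν := by
          refine lintegral_mono fun f => lintegral_mono_ae ?_
          filter_upwards [hΛ.ae_mem] with t ht
          have hiff : t ∈ nearSet Λ (f.shift t) ↔ f ∈ N := by
            rw [hΛ.mem_nearSet_shift ht, sub_self, hN, Set.mem_ofPred_eq]
          by_cases hfN : f ∈ N
          · by_cases htB' : t ∈ B'
            · have htB := hsub htB'
              simp [hfN, htB, htB', hiff.2 hfN]
              exact hqk n T f t ht htB'
            · by_cases htB : t ∈ B
              · simp [hfN, htB, htB', hiff.2 hfN]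
                exact hq1 _ _ _
              · simp [htB]
          · have hnn : t ∉ nearSet Λ (f.shift t) := fun h => hfN (hiff.1 h)
            simp [hnn]
      _ = _ := by
          have hi : ∀ f : CadlagPath d, ∫⁻ t, (B'.indicator 1 t * (N.indicator 1 f * k n f) +
              (B \ B').indicator 1 t * N.indicator 1 f) ∂Λ =
              Λ B' * (N.indicator 1 f * k n f) + Λ (B \ B') * N.indicator 1 f := fun f => by
            rw [lintegral_add_left ((measurable_one.indicator hBm').mul_const _),
              lintegral_const_mul_indicator_box hBm',
              lintegral_const_mul_indicator_box (hBm.diff hBm')]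
          have hNk : Measurable fun f => N.indicator 1 f * k n f :=
            (measurable_one.indicator hNm).mul (hk n)
          simp_rw [hi]
          rw [lintegral_add_right _ ((measurable_one.indicator hNm).const_mul _),
            lintegral_const_mul _ hNk,
            lintegral_const_mul _ (measurable_one.indicator hNm), lintegral_indicator_one hNm,
            measure_sdiff hsub hBm'.nullMeasurableSet (hΛ.box_lt_top _ _).ne]
  refine ENNReal.tendsto_nhds_zero.2 fun ε hε => ?_
  -- n is fixed before T grows, so the volume of the boundary layer is o(T^d).
  obtain ⟨n, hn⟩ := ((tendsto_order.1 hK).2 ε hε).exists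
  have hlim : Tendsto (fun T : ℝ => (Λ (box d n (T - n)) / ENNReal.ofReal (T ^ d)) *
      (∫⁻ f, N.indicator 1 f * k n f ∂ν) +
      (Λ (box d (-1) (T - -1)) / ENNReal.ofReal (T ^ d) -
        Λ (box d n (T - n)) / ENNReal.ofReal (T ^ d)) * ν N) atTop
      (𝓝 (1 * (∫⁻ f, N.indicator 1 f * k n f ∂ν) + (1 - 1) * ν N)) := by
    refine Tendsto.add (ENNReal.Tendsto.mul_const (hΛ.growth n) (Or.inl one_ne_zero))
      (ENNReal.Tendsto.mul_const (ENNReal.Tendsto.sub (hΛ.growth (-1)) (hΛ.growth n)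
        (Or.inl ENNReal.one_ne_top)) (Or.inr hnear))
  simp only [one_mul, tsub_self, zero_mul, add_zero] at hlim
  filter_upwards [(tendsto_order.1 hlim).2 ε hn, eventually_gt_atTop 0] with T hT hT0
  refine le_trans ?_ hT.le
  refine (ENNReal.div_le_div_right (hbound n T) _).trans (le_of_eq ?_)
  have hTp : ENNReal.ofReal (T ^ d) ≠ 0 := by
    rw [Ne, ENNReal.ofReal_eq_zero, not_le]; positivity
  rw [ENNReal.add_div]
  congr 1
  · rw [ENNReal.mul_div_right_comm]
  · rw [ENNReal.mul_div_right_comm, ENNReal.sub_div fun _ _ => hTp]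

end Asymptotics

/-! ### The limiting intensity of exceedances in large cubes. -/

section Limit

variable {d : ℕ} {Λ : Measure (Fin d → ℝ)} {H : Set (Fin d → ℝ)} {ν : Measure (CadlagPath d)}

theorem tendsto_measure_inter_closedBall (μ : Measure (Fin d → ℝ)) (A : Set (Fin d → ℝ)) :
    Tendsto (fun n : ℕ => μ (A ∩ Metric.closedBall 0 n)) atTop (𝓝 (μ A)) := by
  have h := tendsto_measure_iUnion_atTop (μ := μ)
    (s := fun n : ℕ => A ∩ Metric.closedBall (0 : Fin d → ℝ) n)
    (fun m n hmn t ht => ⟨ht.1, Metric.closedBall_subset_closedBall (by exact_mod_cast hmn) ht.2⟩)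
  rwa [← Set.inter_iUnion, iUnion_closedBall_zero, Set.inter_univ] at h

/-- The share of the total mass of a path that is carried by `A`. -/
noncomputable def massShare (Λ : Measure (Fin d → ℝ)) (f : CadlagPath d)
    (A : Set (Fin d → ℝ)) : ℝ≥0∞ :=
  (∫⁻ t in A, ENNReal.ofReal (f.1 t) ∂Λ) / pathMass Λ f

theorem massShare_le_one (f : CadlagPath d) (A : Set (Fin d → ℝ)) : massShare Λ f A ≤ 1 :=
  (ENNReal.div_le_div_right (setLIntegral_le_lintegral A _) _).trans ENNReal.div_self_le_one

theorem measurable_massShare [SFinite Λ] (A : Set (Fin d → ℝ)) :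
    Measurable fun f : CadlagPath d => massShare Λ f A := by
  refine Measurable.div ?_ measurable_pathMass
  have : Measurable fun p : CadlagPath d × (Fin d → ℝ) => ENNReal.ofReal (p.1.1 p.2) := by fun_prop
  exact this.lintegral_prod_right'

theorem massShare_mono (f : CadlagPath d) {A B : Set (Fin d → ℝ)} (h : A ⊆ B) :
    massShare Λ f A ≤ massShare Λ f B :=
  ENNReal.div_le_div_right (lintegral_mono_set h) _

theorem IsLatticeHaar.massShare_shift (hΛ : IsLatticeHaar Λ H) {h : Fin d → ℝ} (hh : h ∈ H)
    (f : CadlagPath d) {A : Set (Fin d → ℝ)} (hA : MeasurableSet A) :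
    massShare Λ (f.shift h) A = massShare Λ f ((fun t => t + h) ⁻¹' A) := by
  unfold massShare
  rw [hΛ.pathMass_shift hh]
  congr 1
  have hm : Measurable fun t => ENNReal.ofReal ((f.shift h).1 t) := by fun_prop
  rw [← (hΛ.add_right h hh).setLIntegral_comp_preimage hA hm]
  simp

/-- For positive finite mass this is continuity from above. If the mass is 0 or ∞ the share is 0, by
the conventions for quotients in `ℝ≥0∞`. -/
theorem tendsto_massShare_compl_closedBall (f : CadlagPath d) :
    Tendsto (fun n : ℕ => massShare Λ f (Metric.closedBall 0 n)ᶜ) atTop (𝓝 0) := by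
  have hm : Measurable fun t => ENNReal.ofReal (f.1 t) := by fun_prop
  rcases eq_or_ne (pathMass Λ f) ∞ with htop | htop
  · simp [massShare, htop]
  rcases eq_or_ne (pathMass Λ f) 0 with h0 | h0
  · have : ∀ A, ∫⁻ t in A, ENNReal.ofReal (f.1 t) ∂Λ = 0 := fun A =>
      nonpos_iff_eq_zero.1 ((setLIntegral_le_lintegral A _).trans h0.le)
    simp [massShare, this]
  · set m := Λ.withDensity fun t => ENNReal.ofReal (f.1 t) with hmdef
    have hmu : m Set.univ = pathMass Λ f := by
      rw [hmdef, withDensity_apply _ MeasurableSet.univ, setLIntegral_univ]; rfl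
    have hfin : IsFiniteMeasure m := ⟨by rw [hmu]; exact htop.lt_top⟩
    have h1 := tendsto_measure_inter_closedBall m Set.univ
    have h2 := ENNReal.Tendsto.sub (tendsto_const_nhds (x := m Set.univ)) h1
      (Or.inl (measure_ne_top m _))
    rw [tsub_self] at h2
    have h3 := ENNReal.Tendsto.div_const h2 (b := pathMass Λ f) (Or.inr h0)
    rw [ENNReal.zero_div] at h3
    refine h3.congr fun n => ?_
    unfold massShare
    have hcm : MeasurableSet (Metric.closedBall (0 : Fin d → ℝ) n) :=
      Metric.isClosed_closedBall.measurableSet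
    rw [Set.univ_inter, ← measure_compl hcm (measure_ne_top m _), hmdef,
      withDensity_apply _ hcm.compl]

theorem lintegral_nearSet_const [SFinite Λ] (f : CadlagPath d) {B : Set (Fin d → ℝ)}
    (hB : MeasurableSet B) (c : ℝ≥0∞) :
    ∫⁻ t, B.indicator 1 t * ({τ | τ ∈ nearSet Λ f}.indicator 1 t * c) ∂Λ =
      Λ (nearSet Λ f ∩ B) * c := by
  have hnm : MeasurableSet (nearSet Λ f) :=
    measurableSet_nearSet (α := Fin d → ℝ) measurable_const measurable_id
  rw [← lintegral_const_mul_indicator_box (hnm.inter hB)]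
  refine lintegral_congr fun t => ?_
  rw [← mul_assoc]
  congr 1
  by_cases h1 : t ∈ nearSet Λ f <;> by_cases h2 : t ∈ B <;> simp [h1, h2]

/-- The contribution of the mass outside a large cube to the exceedances inside is negligible. -/
theorem IsLatticeHaar.tendsto_dissipative_remainder [SFinite Λ] [SFinite ν]
    (hΛ : IsLatticeHaar Λ H) (hν : ∀ h, MeasurePreserving (CadlagPath.shift h) ν ν)
    (hnear : ν {f | 0 ∈ nearSet Λ f} ≠ ∞) :
    Tendsto (fun T : ℝ => (∫⁻ f, Λ (nearSet Λ f ∩ box d (-1) (T - -1)) *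
      massShare Λ f (box d 0 T)ᶜ ∂ν) / ENNReal.ofReal (T ^ d)) atTop (𝓝 0) := by
  have h := hΛ.tendsto_negligible hν hnear (q := fun T f _ => massShare Λ f (box d 0 T)ᶜ)
    (fun T => (measurable_massShare _).comp measurable_fst)
    (fun T f _ => massShare_le_one f _) (k := fun n f => massShare Λ f (Metric.closedBall 0 n)ᶜ)
    (fun n => measurable_massShare _) ?_
    (fun n f => massShare_le_one f _)
    (ae_of_all _ fun f _ => tendsto_massShare_compl_closedBall f)
  · simpa only [lintegral_nearSet_const _ (measurableSet_box _ _)] using h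
  · intro n T f t ht htB
    rw [hΛ.massShare_shift ht f (measurableSet_box _ _).compl, Set.preimage_compl]
    exact massShare_mono f (Set.compl_subset_compl.2 (add_mem_box_of_closedBall htB))

theorem measurable_measure_nearSet_inter [SFinite Λ] {A : Set (Fin d → ℝ)}
    (hA : MeasurableSet A) : Measurable fun f : CadlagPath d => Λ (nearSet Λ f ∩ A) := by
  have h2 : MeasurableSet {p : CadlagPath d × (Fin d → ℝ) | p.2 ∈ nearSet Λ p.1 ∧ p.2 ∈ A} :=
    (measurableSet_nearSet measurable_fst measurable_snd).inter (measurable_snd hA)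
  exact measurable_measure_prodMk_left h2

theorem IsLatticeHaar.measure_nearSet_shift_inter [SFinite Λ] (hΛ : IsLatticeHaar Λ H)
    {h : Fin d → ℝ} (hh : h ∈ H) (f : CadlagPath d) {A : Set (Fin d → ℝ)} (hA : MeasurableSet A) :
    Λ (nearSet Λ (f.shift h) ∩ A) = Λ (nearSet Λ f ∩ (fun t => t + h) ⁻¹' A) := by
  have hnm : MeasurableSet (nearSet Λ (f.shift h)) :=
    measurableSet_nearSet (α := Fin d → ℝ) measurable_const measurable_id
  rw [← (hΛ.add_right h hh).measure_preimage (hnm.inter hA).nullMeasurableSet]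
  congr 1
  ext t
  simp only [Set.mem_preimage, Set.mem_inter_iff, hΛ.mem_nearSet_shift hh, add_sub_cancel_right]

/-- Paths with infinite total mass do not contribute to the limit. -/
theorem IsLatticeHaar.tendsto_conservative [SFinite Λ] [SFinite ν]
    (hΛ : IsLatticeHaar Λ H) (hν : ∀ h, MeasurePreserving (CadlagPath.shift h) ν ν)
    (hnear : ν {f | 0 ∈ nearSet Λ f} ≠ ∞)
    (hcons : ∀ᵐ f ∂ν, pathMass Λ f = ∞ →
      exceedance Λ f Set.univ = 0 ∨ exceedance Λ f Set.univ = ∞) :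
    Tendsto (fun T : ℝ => (∫⁻ f, Λ (nearSet Λ f ∩ box d (-1) (T - -1)) *
      ({f | pathMass Λ f = ∞}.indicator 1 f * (Λ (Metric.ball 0 1) /
        max (Λ (Metric.ball 0 1)) (Λ (nearSet Λ f ∩ box d (-1) (T - -1))))) ∂ν) /
        ENNReal.ofReal (T ^ d)) atTop (𝓝 0) := by
  set c := Λ (Metric.ball 0 1) with hc
  have hc0 : c ≠ 0 := hΛ.ball_pos.ne'
  have hct : c ≠ ∞ := hΛ.measure_ball_lt_top.ne
  have hDm : MeasurableSet {f : CadlagPath d | pathMass Λ f = ∞} :=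
    measurable_pathMass (measurableSet_singleton ∞)
  have hle : ∀ (f : CadlagPath d) (b : ℝ≥0∞),
      {f | pathMass Λ f = ∞}.indicator 1 f * (c / max c b) ≤ 1 := fun f b =>
    mul_le_one' (Set.indicator_le_self' (fun _ _ => zero_le) f)
      ((ENNReal.div_le_div_left (le_max_left _ _) _).trans ENNReal.div_self_le_one)
  have hmeas : ∀ A : Set (Fin d → ℝ), MeasurableSet A → Measurable fun f : CadlagPath d =>
      {f | pathMass Λ f = ∞}.indicator (1 : CadlagPath d → ℝ≥0∞) f *
        (c / max c (Λ (nearSet Λ f ∩ A))) := fun A hA =>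
    (measurable_one.indicator hDm).mul
      (measurable_const.div (measurable_const.max (measurable_measure_nearSet_inter hA)))
  have h := hΛ.tendsto_negligible hν hnear
    (q := fun T f _ => {f | pathMass Λ f = ∞}.indicator 1 f *
      (c / max c (Λ (nearSet Λ f ∩ box d (-1) (T - -1)))))
    (fun T => (hmeas _ (measurableSet_box _ _)).comp measurable_fst)
    (fun T f _ => hle f _)
    (k := fun n f => {f | pathMass Λ f = ∞}.indicator 1 f *
      (c / max c (Λ (nearSet Λ f ∩ Metric.closedBall 0 n))))
    (fun n => hmeas _ Metric.isClosed_closedBall.measurableSet) ?_ (fun n f => hle f _) ?_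
  · simpa only [lintegral_nearSet_const _ (measurableSet_box _ _)] using h
  · intro n T f t ht htB
    have hsub : Metric.closedBall 0 (n : ℝ) ⊆ (fun u => u + t) ⁻¹' box d (-1) (T - -1) :=
      (add_mem_box_of_closedBall htB).trans
        (Set.preimage_mono (box_subset_box (by norm_num) (by linarith)))
    rw [hΛ.measure_nearSet_shift_inter ht f (measurableSet_box _ _)]
    refine mul_le_mul' (le_of_eq ?_) (ENNReal.div_le_div_left (max_le_max le_rfl (measure_mono
      (Set.inter_subset_inter_right _ hsub))) _)
    simp only [Set.indicator_apply, Set.mem_ofPred_eq, hΛ.pathMass_shift ht, Pi.one_apply]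
  -- A path of infinite mass with a near point has infinitely large near set, so the share c/G of a
  -- single near point tends to 0 as the window grows.
  · filter_upwards [hcons] with f hf hf0
    by_cases hD : pathMass Λ f = ∞
    · have hpos : exceedance Λ f Set.univ ≠ 0 := ((show 0 < exceedance Λ f (Metric.ball 0 1)
        from hf0).trans_le (exceedance_mono f (Set.subset_univ _))).ne'
      have hN := hΛ.measure_nearSet_eq_top ((hf hD).resolve_left hpos)
      have h1 := tendsto_measure_inter_closedBall Λ (nearSet Λ f)
      rw [hN] at h1
      have h2 : Tendsto (fun n : ℕ => max c (Λ (nearSet Λ f ∩ Metric.closedBall 0 n))) atTop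
          (𝓝 ∞) := tendsto_nhds_top_mono' h1 fun n => le_max_right _ _
      have h3 := ENNReal.Tendsto.const_div h2 (a := c) (Or.inr hct)
      rw [ENNReal.div_top] at h3
      simpa [hD] using h3
    · simp [hD]

/-- Decomposition of the exceedances in a cube. -/
theorem IsLatticeHaar.indicator_exceedance_le [SFinite Λ] (hΛ : IsLatticeHaar Λ H) (X : ℝ≥0∞)
    (T : ℝ) (f : CadlagPath d) :
    {f | X < exceedance Λ f (box d 0 T)}.indicator (1 : CadlagPath d → ℝ≥0∞) f ≤
      {f | X < exceedance Λ f Set.univ}.indicator 1 f * massShare Λ f (box d 0 T) +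
      ((Λ (Metric.ball 0 1))⁻¹ * (Λ (nearSet Λ f ∩ box d (-1) (T - -1)) *
        massShare Λ f (box d 0 T)ᶜ) +
      (Λ (Metric.ball 0 1))⁻¹ * (Λ (nearSet Λ f ∩ box d (-1) (T - -1)) *
      ({f | pathMass Λ f = ∞}.indicator 1 f * (Λ (Metric.ball 0 1) /
        max (Λ (Metric.ball 0 1)) (Λ (nearSet Λ f ∩ box d (-1) (T - -1))))))) := by
  set c := Λ (Metric.ball 0 1) with hc
  have hc0 : c ≠ 0 := hΛ.ball_pos.ne'
  have hct : c ≠ ∞ := hΛ.measure_ball_lt_top.ne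
  set G := Λ (nearSet Λ f ∩ box d (-1) (T - -1)) with hG
  have hGt : G ≠ ∞ := ((measure_mono Set.inter_subset_right).trans_lt (hΛ.box_lt_top _ _)).ne
  by_cases hf : X < exceedance Λ f (box d 0 T)
  swap
  · simp [hf]
  have hpos : 0 < exceedance Λ f (box d 0 T) := pos_of_gt hf
  have hcG : c ≤ G := hΛ.measure_ball_le_of_exceedance_pos hpos
  have hfu : X < exceedance Λ f Set.univ := hf.trans_le (exceedance_mono f (Set.subset_univ _))
  -- For infinite mass the indicator is recovered by giving each of the G near points an equal
  -- share, c⁻¹·G·(c/G) = 1. For finite mass, one is split into the shares inside and outside the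
  -- cube, and the outer one is inflated using c ≤ G.
  by_cases hD : pathMass Λ f = ∞
  · have h1 : c⁻¹ * (G * (c / max c G)) = 1 := by
      rw [max_eq_right hcG, ENNReal.mul_div_cancel (ne_of_gt (hΛ.ball_pos.trans_le hcG)) hGt,
        ENNReal.inv_mul_cancel hc0 hct]
    simp only [Set.indicator_apply, Set.mem_ofPred_eq, hf, hfu, hD, if_true, Pi.one_apply, one_mul,
      h1]
    exact le_add_left le_add_self
  · have hp0 := (pathMass_pos_of_exceedance_pos hpos).ne'
    have hsum : massShare Λ f (box d 0 T) + massShare Λ f (box d 0 T)ᶜ = 1 := by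
      unfold massShare
      rw [← ENNReal.add_div, lintegral_add_compl _ (measurableSet_box _ _)]
      exact ENNReal.div_self hp0 hD
    have h2 : massShare Λ f (box d 0 T)ᶜ ≤ c⁻¹ * (G * massShare Λ f (box d 0 T)ᶜ) := by
      rw [← mul_assoc]
      refine le_mul_of_one_le_left' ?_
      rw [← ENNReal.inv_mul_cancel hc0 hct]
      gcongr
    simp only [Set.indicator_apply, Set.mem_ofPred_eq, hf, hfu, if_true, Pi.one_apply, one_mul]
    rw [← hsum]
    gcongr
    exact h2.trans le_self_add

/-- The asymptotic intensity of cubes in which the exceedance functional is larger than `X`. -/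
theorem IsLatticeHaar.tendsto_measure_exceedance [SFinite Λ] [SFinite ν]
    (hΛ : IsLatticeHaar Λ H) (hν : ∀ h, MeasurePreserving (CadlagPath.shift h) ν ν)
    (hnear : ν {f | 0 ∈ nearSet Λ f} ≠ ∞)
    (hcons : ∀ᵐ f ∂ν, pathMass Λ f = ∞ →
      exceedance Λ f Set.univ = 0 ∨ exceedance Λ f Set.univ = ∞) (X : ℝ≥0∞) :
    Tendsto (fun T : ℝ => ν {f | X < exceedance Λ f (box d 0 T)} / ENNReal.ofReal (T ^ d)) atTop
      (𝓝 (tiltedMeasure Λ ν {f | X < exceedance Λ f Set.univ})) := by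
  set S : Set (CadlagPath d) := {f | X < exceedance Λ f Set.univ} with hS
  have hSm : MeasurableSet S := measurableSet_lt_exceedance X MeasurableSet.univ
  set c := Λ (Metric.ball 0 1) with hc
  have hc0 : c ≠ 0 := hΛ.ball_pos.ne'
  have hct : c ≠ ∞ := hΛ.measure_ball_lt_top.ne
  have hDm : MeasurableSet {f : CadlagPath d | pathMass Λ f = ∞} :=
    measurable_pathMass (measurableSet_singleton ∞)
  -- The main term is exact: S is invariant under shifts in H, so each t in the cube contributes the
  -- same tilted mass.
  have hmain : ∀ T : ℝ, ∫⁻ f, S.indicator 1 f * massShare Λ f (box d 0 T) ∂ν =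
      Λ (box d 0 T) * tiltedMeasure Λ ν S := by
    intro T
    set B := box d 0 T with hB
    have hBm : MeasurableSet B := measurableSet_box _ _
    have hm := measurable_shareIntegrand (Λ := Λ) hSm hBm
    have h1 : ∀ f : CadlagPath d, S.indicator 1 f * massShare Λ f B =
        ∫⁻ t, B.indicator 1 t * (S.indicator 1 f *
          (ENNReal.ofReal (f.1 t) / pathMass Λ f)) ∂Λ := by
      intro f
      have hfm : Measurable fun t => ENNReal.ofReal (f.1 t) := by fun_prop
      have h2 : ∀ t, B.indicator 1 t * (S.indicator 1 f * (ENNReal.ofReal (f.1 t) / pathMass Λ f)) =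
          S.indicator 1 f * (B.indicator (fun t => ENNReal.ofReal (f.1 t)) t *
            (pathMass Λ f)⁻¹) := fun t => by
        by_cases ht : t ∈ B <;> simp [ht, div_eq_mul_inv]
      simp_rw [h2]
      rw [lintegral_const_mul _ ((hfm.indicator hBm).mul_const _),
        lintegral_mul_const _ (hfm.indicator hBm), lintegral_indicator hBm, massShare,
        div_eq_mul_inv]
    simp_rw [h1]
    rw [lintegral_transport hν hm]
    have h3 : ∀ f : CadlagPath d, ∫⁻ t, B.indicator 1 t * (S.indicator 1 (f.shift t) *
          (ENNReal.ofReal ((f.shift t).1 t) / pathMass Λ (f.shift t))) ∂Λ =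
        Λ B * (S.indicator 1 f * (ENNReal.ofReal (f.1 0) / pathMass Λ f)) := by
      intro f
      rw [← lintegral_const_mul_indicator_box hBm]
      refine lintegral_congr_ae ?_
      filter_upwards [hΛ.ae_mem] with t ht
      rw [hΛ.pathMass_shift ht, CadlagPath.shift_apply, sub_self]
      congr 2
      simp only [Set.indicator_apply, hS, Set.mem_ofPred_eq, hΛ.exceedance_shift_univ ht,
        Pi.one_apply]
    simp_rw [h3]
    rw [lintegral_const_mul' _ _ (show Λ B ≠ ∞ from (hΛ.box_lt_top _ _).ne), tiltedMeasure_apply hSm]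
  have hub : ∀ T : ℝ, ν {f | X < exceedance Λ f (box d 0 T)} / ENNReal.ofReal (T ^ d) ≤
      Λ (box d 0 T) / ENNReal.ofReal (T ^ d) * tiltedMeasure Λ ν S +
      (c⁻¹ * ((∫⁻ f, Λ (nearSet Λ f ∩ box d (-1) (T - -1)) *
        massShare Λ f (box d 0 T)ᶜ ∂ν) / ENNReal.ofReal (T ^ d)) +
      c⁻¹ * ((∫⁻ f, Λ (nearSet Λ f ∩ box d (-1) (T - -1)) *
      ({f | pathMass Λ f = ∞}.indicator 1 f * (c /
        max c (Λ (nearSet Λ f ∩ box d (-1) (T - -1))))) ∂ν) / ENNReal.ofReal (T ^ d))) := by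
    intro T
    have hGm := measurable_measure_nearSet_inter (Λ := Λ) (measurableSet_box (d := d) (-1) (T - -1))
    have hm1 : Measurable fun f : CadlagPath d => S.indicator 1 f * massShare Λ f (box d 0 T) :=
      (measurable_one.indicator hSm).mul (measurable_massShare _)
    have hm2 : Measurable fun f : CadlagPath d => Λ (nearSet Λ f ∩ box d (-1) (T - -1)) *
        massShare Λ f (box d 0 T)ᶜ :=
      hGm.mul (measurable_massShare _)
    have h1 := lintegral_mono (μ := ν) (hΛ.indicator_exceedance_le X T)
    rw [lintegral_indicator_one (measurableSet_lt_exceedance X (measurableSet_box _ _)),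
      lintegral_add_left hm1, lintegral_add_left (hm2.const_mul _),
      lintegral_const_mul _ hm2, lintegral_const_mul' _ _ (ENNReal.inv_ne_top.2 hc0), hmain] at h1
    refine (ENNReal.div_le_div_right h1 _).trans (le_of_eq ?_)
    rw [ENNReal.add_div, ENNReal.add_div, ENNReal.mul_div_right_comm, mul_div_assoc c⁻¹,
      mul_div_assoc c⁻¹]
  have hlim := (ENNReal.Tendsto.mul_const (hΛ.growth 0) (b := tiltedMeasure Λ ν S)
    (Or.inl one_ne_zero)).add
    ((ENNReal.Tendsto.const_mul (hΛ.tendsto_dissipative_remainder hν hnear) (a := c⁻¹)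
      (Or.inr (ENNReal.inv_ne_top.2 hc0))).add
    (ENNReal.Tendsto.const_mul (hΛ.tendsto_conservative hν hnear hcons) (a := c⁻¹)
      (Or.inr (ENNReal.inv_ne_top.2 hc0))))
  simp only [sub_zero, one_mul, mul_zero, add_zero] at hlim
  refine tendsto_of_le_liminf_of_limsup_le (hΛ.tiltedMeasure_le_liminf hν X) ?_
  rw [← hlim.limsup_eq]
  exact limsup_le_limsup (Eventually.of_forall hub)

/-- Every path with an exceedance in the cube has near points of measure at least c in the enlarged
cube, so by transport c ν(S_T) ≤ Λ(enlarged cube) · ν{0 is near}. Divide by T^d and use the liminf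
bound. -/
theorem IsLatticeHaar.tiltedMeasure_lt_top [SFinite Λ] [SFinite ν]
    (hΛ : IsLatticeHaar Λ H) (hν : ∀ h, MeasurePreserving (CadlagPath.shift h) ν ν)
    (hnear : ν {f | 0 ∈ nearSet Λ f} ≠ ∞) (X : ℝ≥0∞) :
    tiltedMeasure Λ ν {f | X < exceedance Λ f Set.univ} < ∞ := by
  set c := Λ (Metric.ball 0 1) with hc
  have hc0 : c ≠ 0 := hΛ.ball_pos.ne'
  have hct : c ≠ ∞ := hΛ.measure_ball_lt_top.ne
  have hub : ∀ T : ℝ, ν {f | X < exceedance Λ f (box d 0 T)} / ENNReal.ofReal (T ^ d) ≤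
      c⁻¹ * (Λ (box d (-1) (T - -1)) / ENNReal.ofReal (T ^ d) * ν {f | 0 ∈ nearSet Λ f}) := by
    intro T
    set B := box d (-1) (T - -1) with hB
    have hBm : MeasurableSet B := measurableSet_box _ _
    set N : Set (CadlagPath d) := {f | 0 ∈ nearSet Λ f} with hN
    have hNm : MeasurableSet N := measurableSet_nearSet measurable_id measurable_const
    have hm : Measurable (Function.uncurry fun (f : CadlagPath d) (t : Fin d → ℝ) =>
        B.indicator (1 : (Fin d → ℝ) → ℝ≥0∞) t * ({τ | τ ∈ nearSet Λ f}.indicator 1 t * 1)) := by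
      have h1 := measurable_one_indicator_comp (measurableSet_box (d := d) (-1) (T - -1))
        (measurable_snd : Measurable fun p : CadlagPath d × (Fin d → ℝ) => p.2)
      have h2 : MeasurableSet {p : CadlagPath d × (Fin d → ℝ) | p.2 ∈ nearSet Λ p.1} :=
        measurableSet_nearSet measurable_fst measurable_snd
      have h3 : Measurable fun p : CadlagPath d × (Fin d → ℝ) =>
        {τ | τ ∈ nearSet Λ p.1}.indicator (1 : (Fin d → ℝ) → ℝ≥0∞) p.2 := measurable_one.indicator h2
      exact h1.mul (h3.mul_const 1)
    have h1 : c * ν {f | X < exceedance Λ f (box d 0 T)} ≤ Λ B * ν N := by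
      calc c * ν {f | X < exceedance Λ f (box d 0 T)}
          = ∫⁻ f, c * {f | X < exceedance Λ f (box d 0 T)}.indicator 1 f ∂ν := by
            rw [lintegral_const_mul' _ _ hct, lintegral_indicator_one
              (measurableSet_lt_exceedance X (measurableSet_box _ _))]
        _ ≤ ∫⁻ f, ∫⁻ t, B.indicator 1 t * ({τ | τ ∈ nearSet Λ f}.indicator 1 t * 1) ∂Λ ∂ν := by
            refine lintegral_mono fun f => ?_
            rw [lintegral_nearSet_const f hBm, mul_one]
            by_cases hf : X < exceedance Λ f (box d 0 T)
            · have h2 : c ≤ Λ (nearSet Λ f ∩ B) :=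
                hΛ.measure_ball_le_of_exceedance_pos (pos_of_gt hf)
              simpa [hf] using h2
            · simp [hf]
        _ = ∫⁻ f, ∫⁻ t, B.indicator 1 t * N.indicator 1 f ∂Λ ∂ν := by
            rw [lintegral_transport hν hm]
            refine lintegral_congr fun f => lintegral_congr_ae ?_
            filter_upwards [hΛ.ae_mem] with t ht
            have hiff : t ∈ nearSet Λ (f.shift t) ↔ f ∈ N := by
              rw [hΛ.mem_nearSet_shift ht, sub_self, hN, Set.mem_ofPred_eq]
            by_cases hfN : f ∈ N
            · simp [hfN, hiff.2 hfN]
            · simp [hfN, show t ∉ nearSet Λ (f.shift t) from fun h => hfN (hiff.1 h)]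
        _ = Λ B * ν N := by
            simp_rw [lintegral_const_mul_indicator_box hBm]
            rw [lintegral_const_mul _ (measurable_one.indicator hNm), lintegral_indicator_one hNm]
    rw [← ENNReal.mul_div_right_comm, ← mul_div_assoc]
    refine ENNReal.div_le_div_right ?_ _
    rw [← ENNReal.div_eq_inv_mul, ENNReal.le_div_iff_mul_le (Or.inl hc0) (Or.inl hct), mul_comm]
    exact h1
  have hlim := ENNReal.Tendsto.const_mul (a := c⁻¹)
    (ENNReal.Tendsto.mul_const (hΛ.growth (-1)) (b := ν {f | 0 ∈ nearSet Λ f})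
    (Or.inl one_ne_zero)) (Or.inr (ENNReal.inv_ne_top.2 hc0))
  rw [one_mul] at hlim
  refine ((hΛ.tiltedMeasure_le_liminf hν X).trans ?_).trans_lt
    (ENNReal.mul_lt_top (ENNReal.inv_lt_top.2 hΛ.ball_pos) hnear.lt_top)
  rw [← hlim.liminf_eq]
  exact liminf_le_liminf (Eventually.of_forall hub)

end Limit

/-! ### Bounds for the exponent measure and for masses of spectral paths. -/

section Conservative

variable {d : ℕ} {Λ : Measure (Fin d → ℝ)} {H : Set (Fin d → ℝ)}
  {Ω : Type*} [MeasurableSpace Ω] {P : Measure Ω} {Z : Ω → (Fin d → ℝ) → ℝ} {Y : Ω → CadlagPath d}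

/-- A property that holds at almost all scales of almost all spectral paths holds almost everywhere
for the exponent measure. -/
theorem ae_exponentMeasure_of_ae_ae [SFinite P] (hY : Measurable Y) {p : CadlagPath d → Prop}
    (hp : MeasurableSet {f | p f})
    (h : ∀ᵐ ω ∂P, ∀ᵐ s : ℝ ∂(volume.restrict (Set.Ioi 0)),
      p (CadlagPath.scale s.toNNReal⁻¹ (Y ω))) :
    ∀ᵐ f ∂(exponentMeasure P Y), p f := by
  have hp' : MeasurableSet {f | ¬ p f} := hp.compl
  rw [ae_iff, ← lintegral_indicator_one hp',
    lintegral_exponentMeasure_symm hY (measurable_one.indicator hp')]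
  have h0 : ∀ᵐ ω ∂P, ∫⁻ s in Set.Ioi (0 : ℝ), {f | ¬ p f}.indicator (1 : CadlagPath d → ℝ≥0∞)
      (CadlagPath.scale s.toNNReal⁻¹ (Y ω)) = 0 := by
    filter_upwards [h] with ω hω
    rw [← lintegral_zero (α := ℝ) (μ := volume.restrict (Set.Ioi 0))]
    refine lintegral_congr_ae ?_
    filter_upwards [hω] with s hs
    simp [hs]
  rw [lintegral_congr_ae h0, lintegral_zero]

/-- Shifting by one in each coordinate carries the unit ball into [0,2]^d. If s⁻¹Z exceeds one
there, then s < sup Z over this cube, so the measure is at most the expectation of that supremum. -/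
theorem exponentMeasure_nearSet_ne_top [SFinite P] (hZ : IsNormalisedField P Z)
    [SFinite Λ] (hY : Measurable Y) (hYZ : ∀ᵐ ω ∂P, (Y ω).1 = Z ω)
    (hν : ∀ h, MeasurePreserving (CadlagPath.shift h) (exponentMeasure P Y) (exponentMeasure P Y)) :
    exponentMeasure P Y {f | 0 ∈ nearSet Λ f} ≠ ∞ := by
  set N : Set (CadlagPath d) := {f | 0 ∈ nearSet Λ f} with hN
  have hNm : MeasurableSet N := measurableSet_nearSet measurable_id measurable_const
  set e : Fin d → ℝ := fun _ => -1 with he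
  rw [← (hν e).measure_preimage hNm.nullMeasurableSet]
  have hNm' := CadlagPath.measurable_shift e hNm
  rw [← lintegral_indicator_one hNm',
    lintegral_exponentMeasure_symm hY (measurable_one.indicator hNm')]
  refine ((lintegral_mono_ae ?_).trans_lt (hZ.sup_integrable 2 two_pos)).ne
  filter_upwards [hYZ] with ω hω
  rw [← lintegral_indicator_ofReal_lt (⨆ t ∈ cube d 2, ENNReal.ofReal (Z ω t))]
  refine setLIntegral_mono' measurableSet_Ioi fun s hs => ?_
  have hs' : (0 : ℝ) < s := hs
  by_cases hmem : CadlagPath.scale s.toNNReal⁻¹ (Y ω) ∈ CadlagPath.shift e ⁻¹' N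
  swap
  · rw [Set.indicator_of_notMem hmem]; exact zero_le
  have hpos : 0 < exceedance Λ ((CadlagPath.scale s.toNNReal⁻¹ (Y ω)).shift e)
    (Metric.ball 0 1) := hmem
  obtain ⟨t, ht, hlt⟩ := nonempty_of_measure_ne_zero hpos.ne'
  rw [CadlagPath.shift_apply, CadlagPath.lt_scale_inv_iff hs', mul_one, hω] at hlt
  have hcube : t - e ∈ cube d 2 := by
    intro i
    have h1 := (dist_le_pi_dist t 0 i).trans_lt (Metric.mem_ball.1 ht)
    rw [Real.dist_eq, abs_lt] at h1
    simp only [Pi.zero_apply, sub_zero] at h1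
    simp only [Pi.sub_apply, he]
    constructor <;> linarith [h1.1, h1.2]
  have hsup : ENNReal.ofReal s < ⨆ t ∈ cube d 2, ENNReal.ofReal (Z ω t) :=
    lt_of_lt_of_le ((ENNReal.ofReal_lt_ofReal_iff_of_nonneg hs'.le).2 hlt)
      (le_iSup₂ (f := fun t (_ : t ∈ cube d 2) => ENNReal.ofReal (Z ω t)) _ hcube)
  rw [Set.indicator_of_mem hmem, Set.indicator_of_mem (by exact hsup)]
  rfl

/-- This is E Z(t) = 1; it supplies the constant one in the transport bounds. -/
theorem exponentMeasure_one_lt [SFinite P] (hZ : IsNormalisedField P Z) (hY : Measurable Y)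
    (hYZ : ∀ᵐ ω ∂P, (Y ω).1 = Z ω) (t : Fin d → ℝ) :
    exponentMeasure P Y {f | 1 < f.1 t} = 1 := by
  have h := exponentMeasure_exists_lt (P := P) hY {()} (fun _ => t) (fun _ => (1 : ℝ)) (by simp)
  have hset : {f : CadlagPath d | ∃ i ∈ ({()} : Finset Unit), 1 < f.1 t} = {f | 1 < f.1 t} := by
    ext; simp
  simp only [Finset.sup_singleton, div_one] at h
  rw [← hset, h, ← hZ.lintegral_eq_one t]
  refine lintegral_congr_ae ?_
  filter_upwards [hYZ] with ω hω
  rw [hω]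

/-- The `Λ`-measure of the set on which the path exceeds the level `s`. -/
noncomputable def levelMeasure (Λ : Measure (Fin d → ℝ)) (f : CadlagPath d) (s : ℝ) : ℝ≥0∞ :=
  Λ {t | s < f.1 t}

theorem measurable_levelMeasure [SFinite Λ] :
    Measurable fun p : CadlagPath d × ℝ => levelMeasure Λ p.1 p.2 := by
  have hm : MeasurableSet {q : (CadlagPath d × ℝ) × (Fin d → ℝ) | q.1.2 < q.1.1.1 q.2} :=
    measurableSet_lt (by fun_prop)
      (CadlagPath.measurable_eval_comp (measurable_fst.comp measurable_fst) measurable_snd)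
  exact measurable_measure_prodMk_left hm

theorem exceedance_scale_inv {s : ℝ} (hs : 0 < s) (f : CadlagPath d) :
    exceedance Λ (f.scale s.toNNReal⁻¹) Set.univ = levelMeasure Λ f s := by
  unfold exceedance levelMeasure
  simp only [Set.mem_univ, true_and, CadlagPath.lt_scale_inv_iff hs, mul_one]

theorem lintegral_levelMeasure [SFinite Λ] (f : CadlagPath d) :
    ∫⁻ s in Set.Ioi (0 : ℝ), levelMeasure Λ f s = pathMass Λ f := by
  have hm : Measurable fun t => ENNReal.ofReal (f.1 t) := by fun_prop
  rw [pathMass, ← lintegral_measure_ofReal_lt hm]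
  refine setLIntegral_congr_fun measurableSet_Ioi fun s hs => ?_
  simp only [levelMeasure, ENNReal.ofReal_lt_ofReal_iff_of_nonneg (le_of_lt hs)]

theorem pathMass_scale (c : NNReal) (f : CadlagPath d) :
    pathMass Λ (f.scale c) = c * pathMass Λ f := by
  have hm : Measurable fun t => ENNReal.ofReal (f.1 t) := by fun_prop
  unfold pathMass
  rw [← lintegral_const_mul _ hm]
  refine lintegral_congr fun t => ?_
  rw [CadlagPath.scale_apply, ENNReal.ofReal_mul c.coe_nonneg, ENNReal.ofReal_coe_nnreal]

/-- For a scale invariant weight, the expectation of the total mass under the spectral law is the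
integral of the exceedance functional under the exponent measure. -/
theorem lintegral_pathMass_mul [SFinite P] [SFinite Λ] (hY : Measurable Y)
    {φ : CadlagPath d → ℝ≥0∞} (hφ : Measurable φ)
    (hscale : ∀ (c : NNReal) f, 0 < c → φ (f.scale c) = φ f) :
    ∫⁻ ω, pathMass Λ (Y ω) * φ (Y ω) ∂P =
      ∫⁻ f, exceedance Λ f Set.univ * φ f ∂(exponentMeasure P Y) := by
  have hm : Measurable fun f : CadlagPath d => exceedance Λ f Set.univ * φ f :=
    (measurable_exceedance_const MeasurableSet.univ).mul hφ
  rw [lintegral_exponentMeasure_symm hY hm]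
  refine lintegral_congr fun ω => ?_
  have h1 : ∫⁻ s in Set.Ioi (0 : ℝ), exceedance Λ (CadlagPath.scale s.toNNReal⁻¹ (Y ω)) Set.univ *
      φ (CadlagPath.scale s.toNNReal⁻¹ (Y ω)) =
      ∫⁻ s in Set.Ioi (0 : ℝ), levelMeasure Λ (Y ω) s * φ (Y ω) := by
    refine setLIntegral_congr_fun measurableSet_Ioi fun s hs => ?_
    have hs' : (0 : ℝ) < s := hs
    simp only [exceedance_scale_inv hs']
    rw [hscale _ _ (by simpa using hs')]
  have hl : Measurable fun s => levelMeasure Λ (Y ω) s :=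
    measurable_levelMeasure.comp (by fun_prop : Measurable fun s : ℝ => (Y ω, s))
  rw [h1, lintegral_mul_const _ hl, lintegral_levelMeasure]

/-- A weight whose integral along each orbit of shifts is at most one has integral at most one
against the exceedance functional. -/
theorem lintegral_exceedance_mul_le [SFinite Λ] {ν : Measure (CadlagPath d)} [SFinite ν]
    (hν : ∀ h, MeasurePreserving (CadlagPath.shift h) ν ν) (hone : ν {f | 1 < f.1 0} = 1)
    {φ : CadlagPath d → ℝ≥0∞} (hφ : Measurable φ) (hle : ∀ f : CadlagPath d, ∫⁻ t, φ (f.shift t) ∂Λ ≤ 1) :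
    ∫⁻ f, exceedance Λ f Set.univ * φ f ∂ν ≤ 1 := by
  set A : Set (CadlagPath d) := {f | 1 < f.1 0} with hA
  have hAm : MeasurableSet A := measurableSet_one_lt measurable_id measurable_const
  have hE : MeasurableSet {q : CadlagPath d × (Fin d → ℝ) | 1 < q.1.1 q.2} :=
    measurableSet_one_lt measurable_fst measurable_snd
  have hm : Measurable (Function.uncurry fun (f : CadlagPath d) (u : Fin d → ℝ) =>
      {q : CadlagPath d × (Fin d → ℝ) | 1 < q.1.1 q.2}.indicator 1 (f, u) * φ f) :=
    (measurable_one.indicator hE).mul (hφ.comp measurable_fst)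
  have h1 : ∀ f : CadlagPath d, exceedance Λ f Set.univ * φ f =
      ∫⁻ u, {q : CadlagPath d × (Fin d → ℝ) | 1 < q.1.1 q.2}.indicator 1 (f, u) * φ f ∂Λ := by
    intro f
    have hfm : MeasurableSet {u | 1 < f.1 u} := measurableSet_one_lt measurable_const measurable_id
    have hfm' : Measurable fun u : Fin d → ℝ =>
        {q : CadlagPath d × (Fin d → ℝ) | 1 < q.1.1 q.2}.indicator (1 : _ × _ → ℝ≥0∞) (f, u) :=
      (measurable_one.indicator hE).comp (by fun_prop : Measurable fun u : Fin d → ℝ => (f, u))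
    rw [lintegral_mul_const _ hfm']
    congr 1
    simp only [exceedance, Set.mem_univ, true_and]
    rw [← lintegral_indicator_one hfm]
    rfl
  simp_rw [h1]
  -- Recentring at the exceedance point u turns the exceedance into the event f(0) > 1 and the
  -- weight into its integral along the orbit.
  rw [lintegral_transport hν hm]
  calc _ ≤ ∫⁻ f, A.indicator 1 f ∂ν := by
        refine lintegral_mono fun f => ?_
        have h2 : ∫⁻ u, {q : CadlagPath d × (Fin d → ℝ) | 1 < q.1.1 q.2}.indicator 1 (f.shift u, u)
            * φ (f.shift u) ∂Λ = ∫⁻ u, A.indicator 1 f * φ (f.shift u) ∂Λ := by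
          refine lintegral_congr fun u => ?_
          congr 1
          simp only [Set.indicator_apply, Set.mem_ofPred_eq, CadlagPath.shift_apply, sub_self, hA]
          rfl
        have hφ' : Measurable fun u => φ (f.shift u) :=
          hφ.comp (by fun_prop : Measurable fun u => f.shift u)
        rw [h2, lintegral_const_mul _ hφ']
        exact mul_le_of_le_one_right' (hle f)
    _ = 1 := by rw [lintegral_indicator_one hAm, hone]

/-- A mass transport bound for equivariant, scale invariant sub-probability densities. -/
theorem IsLatticeHaar.lintegral_pathMass_mul_le [SFinite P] [SFinite Λ] (hΛ : IsLatticeHaar Λ H)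
    (hY : Measurable Y)
    (hν : ∀ h, MeasurePreserving (CadlagPath.shift h) (exponentMeasure P Y) (exponentMeasure P Y))
    (hone : exponentMeasure P Y {f | 1 < f.1 0} = 1)
    {p : CadlagPath d → (Fin d → ℝ) → ℝ≥0∞} (hp : Measurable (Function.uncurry p))
    (hshift : ∀ h ∈ H, ∀ f t, p (f.shift h) t = p f (t - h))
    (hscale : ∀ (c : NNReal) f t, 0 < c → p (f.scale c) t = p f t)
    (hint : ∀ f, ∫⁻ t, p f t ∂Λ ≤ 1) {t : Fin d → ℝ} (ht : t ∈ H) :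
    ∫⁻ ω, pathMass Λ (Y ω) * p (Y ω) t ∂P ≤ 1 := by
  have hpt : ∀ t, Measurable fun f => p f t := fun t => hp.comp (by fun_prop :
    Measurable fun f : CadlagPath d => (f, t))
  have hpf : ∀ f, Measurable fun t => p f t := fun f => hp.comp (by fun_prop :
    Measurable fun t : Fin d → ℝ => (f, t))
  rw [lintegral_pathMass_mul hY (hpt t) fun c f hc => hscale c f t hc]
  refine lintegral_exceedance_mul_le hν hone (hpt t) fun f => ?_
  have h2 : ∫⁻ u, p (f.shift u) t ∂Λ = ∫⁻ u, p f (t - u) ∂Λ := by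
    refine lintegral_congr_ae ?_
    filter_upwards [hΛ.ae_mem] with u hu
    rw [hshift u hu]
  -- The substitution u ↦ t - u, that is translation and reflection invariance of Λ, turns the orbit
  -- integral into ∫ p(f,·) dΛ.
  have e1 := (hΛ.add_right t ht).lintegral_comp (hpf f)
  have e2 := hΛ.neg.lintegral_comp (f := fun u => p f (u + t))
    ((hpf f).comp (measurable_add_const t))
  simp only [neg_add_eq_sub] at e2
  rw [h2, e2, e1]
  exact hint f

end Conservative

/-! ### Superlevel sets of paths of infinite mass are null or infinite. -/

section LevelWeights

variable {d : ℕ} {Λ : Measure (Fin d → ℝ)} {H : Set (Fin d → ℝ)}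
  {Ω : Type*} [MeasurableSpace Ω] {P : Measure Ω} {Z : Ω → (Fin d → ℝ) → ℝ} {Y : Ω → CadlagPath d}

/-- The positive levels whose superlevel sets have `Λ`-measure between `1/(n+1)` and `n+1`. -/
def moderateLevels (Λ : Measure (Fin d → ℝ)) (n : ℕ) (f : CadlagPath d) : Set ℝ :=
  {s | 0 < s ∧ ((n : ℝ≥0∞) + 1)⁻¹ ≤ levelMeasure Λ f s ∧ levelMeasure Λ f s ≤ (n : ℝ≥0∞) + 1}

/-- The length of the set of moderate levels below the value of the path at a point. -/
noncomputable def levelWeight (Λ : Measure (Fin d → ℝ)) (n : ℕ) (f : CadlagPath d)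
    (t : Fin d → ℝ) : ℝ≥0∞ := volume (moderateLevels Λ n f ∩ Set.Iio (f.1 t))

theorem measurableSet_mem_moderateLevels [SFinite Λ] (n : ℕ) :
    MeasurableSet {p : CadlagPath d × ℝ | p.2 ∈ moderateLevels Λ n p.1} :=
  (measurableSet_lt measurable_const measurable_snd).inter
    ((measurableSet_le measurable_const measurable_levelMeasure).inter
      (measurableSet_le measurable_levelMeasure measurable_const))

theorem measurableSet_moderateLevels [SFinite Λ] (n : ℕ) (f : CadlagPath d) :
    MeasurableSet (moderateLevels Λ n f) :=
  (measurableSet_mem_moderateLevels (Λ := Λ) n).preimage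
    (by fun_prop : Measurable fun s : ℝ => (f, s))

theorem measurable_levelWeight [SFinite Λ] (n : ℕ) :
    Measurable fun p : CadlagPath d × (Fin d → ℝ) => levelWeight Λ n p.1 p.2 := by
  have h1 : MeasurableSet {q : (CadlagPath d × (Fin d → ℝ)) × ℝ |
      q.2 ∈ moderateLevels Λ n q.1.1} :=
    (measurableSet_mem_moderateLevels (Λ := Λ) n).preimage
      (by fun_prop : Measurable fun q : (CadlagPath d × (Fin d → ℝ)) × ℝ => (q.1.1, q.2))
  have h2 : MeasurableSet {q : (CadlagPath d × (Fin d → ℝ)) × ℝ | q.2 < q.1.1.1 q.1.2} :=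
    measurableSet_lt measurable_snd (by fun_prop)
  exact measurable_measure_prodMk_left (h1.inter h2)

theorem measurable_levelWeight_comp [SFinite Λ] (n : ℕ) {α : Type*} [MeasurableSpace α]
    {f : α → CadlagPath d} {t : α → Fin d → ℝ} (hf : Measurable f) (ht : Measurable t) :
    Measurable fun a => levelWeight Λ n (f a) (t a) :=
  (measurable_levelWeight n).comp (hf.prodMk ht)

/-- Tonelli for the region under the graph of f, restricted to moderate levels. -/
theorem lintegral_levelWeight [SFinite Λ] (n : ℕ) (f : CadlagPath d) :
    ∫⁻ t, levelWeight Λ n f t ∂Λ = ∫⁻ s in moderateLevels Λ n f, levelMeasure Λ f s := by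
  have hm : MeasurableSet {p : (Fin d → ℝ) × ℝ | p.2 < f.1 p.1} :=
    measurableSet_lt measurable_snd (by fun_prop)
  have h1 : ∀ t, levelWeight Λ n f t = (volume.restrict (moderateLevels Λ n f))
      (Prod.mk t ⁻¹' {p : (Fin d → ℝ) × ℝ | p.2 < f.1 p.1}) := fun t => by
    rw [Measure.restrict_apply' (measurableSet_moderateLevels n f), Set.inter_comm]
    rfl
  simp_rw [h1]
  rw [← Measure.prod_apply hm, Measure.prod_apply_symm hm]
  rfl

theorem levelMeasure_antitone (f : CadlagPath d) : Antitone (levelMeasure Λ f) :=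
  fun _ _ h => measure_mono fun _ ht => lt_of_le_of_lt h ht

theorem exists_levelMeasure_lt (f : CadlagPath d) {s : ℝ} (hs : levelMeasure Λ f s ≠ ∞)
    {ε : ℝ≥0∞} (hε : 0 < ε) : ∃ u, levelMeasure Λ f u < ε := by
  have h1 := tendsto_measure_iInter_atTop (μ := Λ) (s := fun n : ℕ => {t | s + n < f.1 t})
    (fun n => (measurableSet_lt measurable_const (by fun_prop)).nullMeasurableSet)
    (fun m n hmn t ht => lt_of_le_of_lt (add_le_add_right (Nat.cast_le.2 hmn) s) ht)
    ⟨0, by simpa [levelMeasure] using hs⟩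
  have h2 : ⋂ n : ℕ, {t | s + n < f.1 t} = ∅ := by
    ext t
    simp only [Set.mem_iInter, Set.mem_ofPred_eq, Set.mem_empty_iff_false, iff_false, not_forall,
      not_lt]
    obtain ⟨n, hn⟩ := exists_nat_ge (f.1 t - s)
    exact ⟨n, by linarith⟩
  rw [h2, measure_empty] at h1
  obtain ⟨n, hn⟩ := ((tendsto_order.1 h1).2 ε hε).exists
  exact ⟨s + n, hn⟩

/-- Once one superlevel set has finite measure, their measures tend to 0. The lower bound 1/(n+1)
therefore caps the moderate levels, while n+1 bounds the integrand. -/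
theorem lintegral_levelWeight_ne_top [SFinite Λ] (n : ℕ) (f : CadlagPath d) :
    ∫⁻ t, levelWeight Λ n f t ∂Λ ≠ ∞ := by
  rw [lintegral_levelWeight]
  rcases (moderateLevels Λ n f).eq_empty_or_nonempty with h | ⟨s, hs⟩
  · simp [h]
  have hfin : levelMeasure Λ f s ≠ ∞ := (hs.2.2.trans_lt (by finiteness)).ne
  have hpos : 0 < ((n : ℝ≥0∞) + 1)⁻¹ := ENNReal.inv_pos.2 (by finiteness)
  obtain ⟨u, hu⟩ := exists_levelMeasure_lt f hfin hpos
  have hsub : moderateLevels Λ n f ⊆ Set.Ioc 0 u := fun r hr => ⟨hr.1, by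
    by_contra hc
    exact absurd ((hr.2.1.trans (levelMeasure_antitone f (not_le.1 hc).le)).trans_lt hu)
      (lt_irrefl _)⟩
  have hle : ∫⁻ s in moderateLevels Λ n f, levelMeasure Λ f s ≤
      ∫⁻ _ in moderateLevels Λ n f, ((n : ℝ≥0∞) + 1) :=
    setLIntegral_mono' (measurableSet_moderateLevels n f) fun r hr => hr.2.2
  rw [setLIntegral_const] at hle
  refine (hle.trans_lt (ENNReal.mul_lt_top (by finiteness) ?_)).ne
  exact (measure_mono hsub).trans_lt (by simp)

/-- The integrand over moderate levels is bounded away from 0, so a vanishing total weight leaves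
only a null set of them. -/
theorem measure_moderateLevels_eq_zero [SFinite Λ] {n : ℕ} {f : CadlagPath d}
    (h : ∫⁻ t, levelWeight Λ n f t ∂Λ = 0) : volume (moderateLevels Λ n f) = 0 := by
  rw [lintegral_levelWeight] at h
  have hle : ∫⁻ _ in moderateLevels Λ n f, ((n : ℝ≥0∞) + 1)⁻¹ ≤
      ∫⁻ s in moderateLevels Λ n f, levelMeasure Λ f s :=
    setLIntegral_mono' (measurableSet_moderateLevels n f) fun r hr => hr.2.1
  rw [h, setLIntegral_const, nonpos_iff_eq_zero, mul_eq_zero] at hle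
  refine hle.resolve_left (ENNReal.inv_ne_zero.2 (by finiteness))

theorem levelMeasure_scale {c : NNReal} (hc : 0 < c) (f : CadlagPath d) (s : ℝ) :
    levelMeasure Λ (f.scale c) s = levelMeasure Λ f ((c : ℝ)⁻¹ * s) := by
  unfold levelMeasure
  simp only [CadlagPath.scale_apply, inv_mul_lt_iff₀ (NNReal.coe_pos.2 hc)]

/-- Scaling a path scales its levels but leaves the superlevel sets themselves unchanged; the
quotient of the weight by its integral is thus scale invariant. -/
theorem levelWeight_scale {c : NNReal} (hc : 0 < c) (n : ℕ) (f : CadlagPath d) (t : Fin d → ℝ) :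
    levelWeight Λ n (f.scale c) t = c * levelWeight Λ n f t := by
  have hc' : (0 : ℝ) < c := NNReal.coe_pos.2 hc
  have hset : moderateLevels Λ n (f.scale c) ∩ Set.Iio ((f.scale c).1 t) =
      (fun s => (c : ℝ)⁻¹ * s) ⁻¹' (moderateLevels Λ n f ∩ Set.Iio (f.1 t)) := by
    ext s
    simp only [moderateLevels, Set.mem_inter_iff, Set.mem_preimage, Set.mem_ofPred_eq,
      Set.mem_Iio, levelMeasure_scale hc, CadlagPath.scale_apply, inv_mul_lt_iff₀ hc',
      mul_pos_iff_of_pos_left (inv_pos.2 hc')]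
  rw [levelWeight, hset, Real.volume_preimage_mul_left (inv_pos.2 hc').ne', inv_inv,
    abs_of_pos hc', ENNReal.ofReal_coe_nnreal]
  rfl

theorem IsLatticeHaar.levelMeasure_shift [SFinite Λ] (hΛ : IsLatticeHaar Λ H) {h : Fin d → ℝ}
    (hh : h ∈ H) (f : CadlagPath d) (s : ℝ) :
    levelMeasure Λ (f.shift h) s = levelMeasure Λ f s := by
  have hm : MeasurableSet {t | s < f.1 t} := measurableSet_lt measurable_const (by fun_prop)
  exact (hΛ.sub_right hh).measure_preimage hm.nullMeasurableSet

theorem IsLatticeHaar.levelWeight_shift [SFinite Λ] (hΛ : IsLatticeHaar Λ H) {h : Fin d → ℝ}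
    (hh : h ∈ H) (n : ℕ) (f : CadlagPath d) (t : Fin d → ℝ) :
    levelWeight Λ n (f.shift h) t = levelWeight Λ n f (t - h) := by
  simp only [levelWeight, moderateLevels, hΛ.levelMeasure_shift hh, CadlagPath.shift_apply]

/-- Almost every path of infinite mass has only moderate levels of length zero. -/
theorem IsLatticeHaar.ae_measure_moderateLevels [SFinite P] [SFinite Λ] (hΛ : IsLatticeHaar Λ H)
    (hY : Measurable Y)
    (hν : ∀ h, MeasurePreserving (CadlagPath.shift h) (exponentMeasure P Y) (exponentMeasure P Y))
    (hone : exponentMeasure P Y {f | 1 < f.1 0} = 1) (n : ℕ) :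
    ∀ᵐ ω ∂P, pathMass Λ (Y ω) = ∞ → volume (moderateLevels Λ n (Y ω)) = 0 := by
  set W : CadlagPath d → ℝ≥0∞ := fun f => ∫⁻ t, levelWeight Λ n f t ∂Λ with hW
  have hwm := measurable_levelWeight (Λ := Λ) n
  have hwt : ∀ f, Measurable fun t => levelWeight Λ n f t := fun f =>
    hwm.comp (by fun_prop : Measurable fun t : Fin d → ℝ => (f, t))
  have hWm : Measurable W := hwm.lintegral_prod_right'
  have hp : Measurable (Function.uncurry fun f t => levelWeight Λ n f t / W f) :=
    hwm.div (hWm.comp measurable_fst)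
  have hint : ∀ f, ∫⁻ t, levelWeight Λ n f t / W f ∂Λ ≤ 1 := fun f => by
    simp_rw [div_eq_mul_inv]
    rw [lintegral_mul_const _ (hwt f), ← div_eq_mul_inv]
    exact ENNReal.div_self_le_one
  have hWshift : ∀ h ∈ H, ∀ f : CadlagPath d, W (f.shift h) = W f := fun h hh f => by
    simp only [hW, hΛ.levelWeight_shift hh]
    exact (hΛ.sub_right hh).lintegral_comp (hwt f)
  have hWscale : ∀ (c : NNReal) (f : CadlagPath d), 0 < c → W (f.scale c) = c * W f :=
    fun c f hc => by
      simp only [hW, levelWeight_scale hc]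
      exact lintegral_const_mul _ (hwt f)
  -- Mass times normalised weight has expectation at most one, hence is almost surely finite. When
  -- the mass is infinite, the normalised weight must vanish, and since its normaliser is finite so
  -- does the weight.
  have hmain : ∀ᵐ t ∂Λ, ∀ᵐ ω ∂P, pathMass Λ (Y ω) = ∞ → levelWeight Λ n (Y ω) t = 0 := by
    filter_upwards [hΛ.ae_mem] with t ht
    have h1 := hΛ.lintegral_pathMass_mul_le hY hν hone hp
      (fun h hh f t => by rw [hΛ.levelWeight_shift hh, hWshift h hh])
      (fun c f t hc => by
        rw [levelWeight_scale hc, hWscale c f hc]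
        exact ENNReal.mul_div_mul_left _ _ (by simpa using hc.ne') ENNReal.coe_ne_top)
      hint ht
    have hmass : Measurable fun ω => pathMass Λ (Y ω) := measurable_pathMass.comp hY
    have hWY : Measurable fun ω => W (Y ω) := hWm.comp hY
    have hw : Measurable fun ω => levelWeight Λ n (Y ω) t :=
      measurable_levelWeight_comp n hY measurable_const
    have hm : Measurable fun ω => pathMass Λ (Y ω) * (levelWeight Λ n (Y ω) t / W (Y ω)) :=
      hmass.mul (hw.div hWY)
    filter_upwards [ae_lt_top hm (h1.trans_lt ENNReal.one_lt_top).ne] with ω hω htop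
    rw [htop] at hω
    by_contra hne
    refine hω.ne (ENNReal.top_mul ?_)
    exact (ENNReal.div_pos hne (lintegral_levelWeight_ne_top n (Y ω))).ne'
  have hms : MeasurableSet {p : (Fin d → ℝ) × Ω | pathMass Λ (Y p.2) = ∞ →
      levelWeight Λ n (Y p.2) p.1 = 0} := by
    have e1 : Measurable fun p : (Fin d → ℝ) × Ω => pathMass Λ (Y p.2) :=
      measurable_pathMass.comp (hY.comp measurable_snd)
    have e2 : Measurable fun p : (Fin d → ℝ) × Ω => levelWeight Λ n (Y p.2) p.1 :=
      measurable_levelWeight_comp n (hY.comp measurable_snd) measurable_fst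
    exact (measurableSet_eq_fun e1 measurable_const).imp (measurableSet_eq_fun e2 measurable_const)
  filter_upwards [(Measure.ae_ae_comm hms).1 hmain] with ω hω htop
  refine measure_moderateLevels_eq_zero ?_
  rw [← lintegral_zero (μ := Λ)]
  refine lintegral_congr_ae ?_
  filter_upwards [hω] with t ht using ht htop

/-- Almost every path of infinite mass exceeds the level one on a set of measure zero or
infinity. -/
theorem IsLatticeHaar.ae_exceedance_zero_or_top [SFinite P] [SFinite Λ] (hΛ : IsLatticeHaar Λ H)
    (hY : Measurable Y)
    (hν : ∀ h, MeasurePreserving (CadlagPath.shift h) (exponentMeasure P Y) (exponentMeasure P Y))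
    (hone : exponentMeasure P Y {f | 1 < f.1 0} = 1) :
    ∀ᵐ f ∂(exponentMeasure P Y), pathMass Λ f = ∞ →
      exceedance Λ f Set.univ = 0 ∨ exceedance Λ f Set.univ = ∞ := by
  have hE : Measurable fun f : CadlagPath d => exceedance Λ f Set.univ :=
    measurable_exceedance_const MeasurableSet.univ
  refine ae_exponentMeasure_of_ae_ae hY ?_ ?_
  · exact (measurableSet_eq_fun measurable_pathMass measurable_const).imp
      ((measurableSet_eq_fun hE measurable_const).union
        (measurableSet_eq_fun hE measurable_const))
  filter_upwards [ae_all_iff.2 fun n => hΛ.ae_measure_moderateLevels hY hν hone n] with ω hω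
  by_cases htop : pathMass Λ (Y ω) = ∞
  swap
  · filter_upwards [ae_restrict_mem measurableSet_Ioi] with s hs h
    rw [pathMass_scale] at h
    exact absurd h (ENNReal.mul_ne_top ENNReal.coe_ne_top htop)
  have h0 : ∀ᵐ s : ℝ, ∀ n, s ∉ moderateLevels Λ n (Y ω) :=
    ae_all_iff.2 fun n => measure_eq_zero_iff_ae_notMem.1 (hω n htop)
  filter_upwards [ae_restrict_mem measurableSet_Ioi, ae_restrict_of_ae h0] with s hs hn _
  rw [exceedance_scale_inv hs]
  by_contra! hc
  -- A superlevel set of measure in (0,∞) makes its level moderate for some n, which is excluded for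
  -- almost every s.
  obtain ⟨a, ha⟩ := ENNReal.exists_inv_nat_lt hc.1
  obtain ⟨b, hb⟩ := ENNReal.exists_nat_gt hc.2
  refine hn (max a b) ⟨hs, ?_, ?_⟩
  · refine (ENNReal.inv_le_inv.2 ?_).trans ha.le
    exact (Nat.cast_le.2 (le_max_left a b)).trans le_self_add
  · refine hb.le.trans ?_
    exact (Nat.cast_le.2 (le_max_right a b)).trans le_self_add

end LevelWeights

/-! ### Replacing one normalising mass by another. -/

section OriginShare

variable {d : ℕ} {Λ Λ' : Measure (Fin d → ℝ)} {H : Set (Fin d → ℝ)}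
  {Ω : Type*} [MeasurableSpace Ω] {P : Measure Ω} {Y : Ω → CadlagPath d}

/-- The quotient of the value at the origin and the total mass of the path. -/
noncomputable def originShare (Λ : Measure (Fin d → ℝ)) (f : CadlagPath d) : ℝ≥0∞ :=
  ENNReal.ofReal (f.1 0) / pathMass Λ f

theorem measurable_originShare [SFinite Λ] :
    Measurable (originShare Λ : CadlagPath d → ℝ≥0∞) := by
  have h : Measurable fun f : CadlagPath d => ENNReal.ofReal (f.1 0) := by fun_prop
  exact h.div measurable_pathMass

theorem originShare_scale {c : NNReal} (hc : 0 < c) (f : CadlagPath d) :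
    originShare Λ (f.scale c) = originShare Λ f := by
  rw [originShare, pathMass_scale, CadlagPath.scale_apply, ENNReal.ofReal_mul c.coe_nonneg,
    ENNReal.ofReal_coe_nnreal]
  exact ENNReal.mul_div_mul_left _ _ (by simpa using hc.ne') ENNReal.coe_ne_top

/-- S_η is unchanged by shifts in ηℤ^d, so the numerators sum over the orbit to S_η itself. The
quotient is left uncancelled because it is one only for a positive finite mass. -/
theorem ofReal_mul_tsum_originShare {η : ℝ} (hη : 0 < η) (f : CadlagPath d) :
    ENNReal.ofReal (η ^ d) * ∑' l, originShare (latticeMeasure d η) (f.shift (latticePoint η l)) =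
      pathMass (latticeMeasure d η) f / pathMass (latticeMeasure d η) f := by
  have hΛ := isLatticeHaar_latticeMeasure (d := d) hη.le
  have hmem : ∀ l : Fin d → ℤ, latticePoint η l ∈ scaledLattice d η := fun l => by
    rw [scaledLattice_of_pos hη]; exact Set.mem_range_self l
  have hneg : ∀ l : Fin d → ℤ, 0 - latticePoint η l = latticePoint η (-l) := fun l => by
    ext i; simp [latticePoint]
  simp_rw [originShare, hΛ.pathMass_shift (hmem _), CadlagPath.shift_apply, hneg, div_eq_mul_inv]
  have hsum : ∑' l : Fin d → ℤ, ENNReal.ofReal (f.1 (latticePoint η (-l))) =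
      ∑' l : Fin d → ℤ, ENNReal.ofReal (f.1 (latticePoint η l)) :=
    (Equiv.neg (Fin d → ℤ)).tsum_eq fun l => ENNReal.ofReal (f.1 (latticePoint η l))
  rw [ENNReal.tsum_mul_right, hsum, ← mul_assoc]
  congr 1
  exact (lintegral_latticeMeasure hη fun t => ENNReal.ofReal (f.1 t)).symm

theorem IsLatticeHaar.lintegral_shift_unfold [SFinite Λ] (hΛ : IsLatticeHaar Λ H) {η : ℝ}
    (hη : 0 < η) (hH : ∀ l, latticePoint η l ∈ H) {φ : CadlagPath d → ℝ≥0∞} (hφ : Measurable φ)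
    (f : CadlagPath d) :
    ∫⁻ t, φ (f.shift t) ∂Λ =
      ∫⁻ u in latticeCell d η, ∑' l, φ ((f.shift u).shift (latticePoint η l)) ∂Λ := by
  have hm : Measurable fun t => φ (f.shift t) :=
    hφ.comp (by fun_prop : Measurable fun t => f.shift t)
  have hml : ∀ l : Fin d → ℤ, Measurable fun u => φ ((f.shift u).shift (latticePoint η l)) :=
    fun l => hφ.comp (by fun_prop : Measurable fun u => (f.shift u).shift (latticePoint η l))
  rw [hΛ.lintegral_unfold hη hH hm, lintegral_tsum fun l => (hml l).aemeasurable]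
  simp_rw [CadlagPath.shift_shift, add_comm (latticePoint η _)]

/-- Unfold the orbit integral over cells of side η; the sum over the lattice collapses to mass over
mass for each offset u in the cell. -/
theorem IsLatticeHaar.lintegral_originShare_shift [SFinite Λ] (hΛ : IsLatticeHaar Λ H) {η : ℝ}
    (hη : 0 < η) (hH : ∀ l, latticePoint η l ∈ H) (f : CadlagPath d) :
    ∫⁻ t, originShare (latticeMeasure d η) (f.shift t) ∂Λ =
      (ENNReal.ofReal (η ^ d))⁻¹ * ∫⁻ u in latticeCell d η,
        pathMass (latticeMeasure d η) (f.shift u) / pathMass (latticeMeasure d η) (f.shift u) ∂Λ := by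
  have hs := sFinite_latticeMeasure (d := d) hη.le
  have h0 : ENNReal.ofReal (η ^ d) ≠ 0 := by
    rw [Ne, ENNReal.ofReal_eq_zero, not_le]; positivity
  rw [hΛ.lintegral_shift_unfold hη hH measurable_originShare,
    ← lintegral_const_mul' _ _ (ENNReal.inv_ne_top.2 h0)]
  refine lintegral_congr fun u => ?_
  rw [← ofReal_mul_tsum_originShare hη, ← mul_assoc, ENNReal.inv_mul_cancel h0 ENNReal.ofReal_ne_top,
    one_mul]

theorem IsLatticeHaar.lintegral_originShare_shift_le [SFinite Λ] (hΛ : IsLatticeHaar Λ H) {η : ℝ}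
    (hη : 0 < η) (hH : ∀ l, latticePoint η l ∈ H)
    (hcell : Λ (latticeCell d η) = ENNReal.ofReal (η ^ d)) (f : CadlagPath d) :
    ∫⁻ t, originShare (latticeMeasure d η) (f.shift t) ∂Λ ≤ 1 := by
  rw [hΛ.lintegral_originShare_shift hη hH]
  calc _ ≤ (ENNReal.ofReal (η ^ d))⁻¹ * ∫⁻ _ in latticeCell d η, 1 ∂Λ := by
        gcongr
        exact ENNReal.div_self_le_one
    _ ≤ 1 := by
        rw [setLIntegral_one, hcell, mul_comm, ← div_eq_mul_inv]
        exact ENNReal.div_self_le_one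

theorem IsLatticeHaar.lintegral_originShare_shift_eq_one [SFinite Λ] (hΛ : IsLatticeHaar Λ H)
    {η : ℝ} (hη : 0 < η) (hH : ∀ l, latticePoint η l ∈ H)
    (hcell : Λ (latticeCell d η) = ENNReal.ofReal (η ^ d)) {f : CadlagPath d}
    (hf : ∀ᵐ u ∂Λ, 0 < pathMass (latticeMeasure d η) (f.shift u) ∧
      pathMass (latticeMeasure d η) (f.shift u) < ∞) :
    ∫⁻ t, originShare (latticeMeasure d η) (f.shift t) ∂Λ = 1 := by
  have h0 : ENNReal.ofReal (η ^ d) ≠ 0 := by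
    rw [Ne, ENNReal.ofReal_eq_zero, not_le]; positivity
  have h1 : ∫⁻ u in latticeCell d η, pathMass (latticeMeasure d η) (f.shift u) /
      pathMass (latticeMeasure d η) (f.shift u) ∂Λ = ∫⁻ _ in latticeCell d η, 1 ∂Λ := by
    refine lintegral_congr_ae (ae_restrict_of_ae ?_)
    filter_upwards [hf] with u hu
    exact ENNReal.div_self hu.1.ne' hu.2.ne
  rw [hΛ.lintegral_originShare_shift hη hH, h1, setLIntegral_one, hcell,
    ENNReal.inv_mul_cancel h0 ENNReal.ofReal_ne_top]

/-- If a scale invariant weight integrates to at most one along each orbit of shifts, then it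
vanishes at almost every path of infinite mass. -/
theorem ae_eq_zero_of_pathMass_eq_top [SFinite P] [SFinite Λ] (hY : Measurable Y)
    (hν : ∀ h, MeasurePreserving (CadlagPath.shift h) (exponentMeasure P Y) (exponentMeasure P Y))
    (hone : exponentMeasure P Y {f | 1 < f.1 0} = 1)
    {φ : CadlagPath d → ℝ≥0∞} (hφ : Measurable φ) (hle : ∀ f : CadlagPath d, ∫⁻ t, φ (f.shift t) ∂Λ ≤ 1)
    (hscale : ∀ (c : NNReal) f, 0 < c → φ (f.scale c) = φ f) :
    ∀ᵐ f ∂(exponentMeasure P Y), pathMass Λ f = ∞ → φ f = 0 := by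
  have h1 := lintegral_exceedance_mul_le hν hone hφ hle
  rw [← lintegral_pathMass_mul hY hφ hscale] at h1
  have hmass : Measurable fun ω => pathMass Λ (Y ω) := measurable_pathMass.comp hY
  have hm : Measurable fun ω => pathMass Λ (Y ω) * φ (Y ω) := hmass.mul (hφ.comp hY)
  refine ae_exponentMeasure_of_ae hY ((measurableSet_eq_fun measurable_pathMass
    measurable_const).imp (measurableSet_eq_fun hφ measurable_const)) ?_
  filter_upwards [ae_lt_top hm (h1.trans_lt ENNReal.one_lt_top).ne] with ω hω s hs htop
  rw [pathMass_scale] at htop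
  rw [hscale _ _ (by simpa using hs)]
  by_contra hne
  by_cases hp : pathMass Λ (Y ω) = ∞
  · rw [hp, ENNReal.top_mul hne] at hω
    exact hω.ne rfl
  · exact ENNReal.mul_ne_top ENNReal.coe_ne_top hp htop

/-- Exchange of the normalising masses in the tilted measure of shift invariant sets. -/
theorem IsLatticeHaar.lintegral_indicator_mul_originShare [SFinite Λ] [SFinite Λ']
    {ν : Measure (CadlagPath d)} [SFinite ν] (hΛ : IsLatticeHaar Λ H)
    (hν : ∀ h, MeasurePreserving (CadlagPath.shift h) ν ν)
    {S : Set (CadlagPath d)} (hS : MeasurableSet S)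
    (hSshift : ∀ h ∈ H, ∀ f : CadlagPath d, f.shift h ∈ S ↔ f ∈ S)
    (hpos : ∀ f ∈ S, 0 < pathMass Λ f)
    (htop : ∀ᵐ f ∂ν, pathMass Λ f = ∞ → originShare Λ' f = 0)
    (hone : ∀ᵐ f ∂ν, originShare Λ f ≠ 0 → ∫⁻ t, originShare Λ' (f.shift t) ∂Λ = 1) :
    ∫⁻ f, S.indicator 1 f * originShare Λ' f ∂ν = ∫⁻ f, S.indicator 1 f * originShare Λ f ∂ν := by
  have hind : Measurable fun p : CadlagPath d × (Fin d → ℝ) =>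
      S.indicator (1 : CadlagPath d → ℝ≥0∞) p.1 := measurable_one_indicator_comp hS measurable_fst
  have hsh : Measurable fun p : CadlagPath d × (Fin d → ℝ) => originShare Λ' p.1 :=
    measurable_originShare.comp measurable_fst
  have hmass : Measurable fun p : CadlagPath d × (Fin d → ℝ) => pathMass Λ p.1 :=
    measurable_pathMass.comp measurable_fst
  have hev : Measurable fun p : CadlagPath d × (Fin d → ℝ) => ENNReal.ofReal (p.1.1 p.2) := by
    fun_prop
  have hm : Measurable (Function.uncurry fun (f : CadlagPath d) (t : Fin d → ℝ) =>
      S.indicator 1 f * originShare Λ' f * (ENNReal.ofReal (f.1 t) / pathMass Λ f)) :=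
    (hind.mul hsh).mul (hev.div hmass)
  -- Insert the density f(t)/∫f dΛ, whose integral is one on S when the mass is finite; when it is
  -- infinite the Λ'-share vanishes anyway.
  have h1 : ∀ᵐ f ∂ν, S.indicator 1 f * originShare Λ' f =
      ∫⁻ t, S.indicator 1 f * originShare Λ' f * (ENNReal.ofReal (f.1 t) / pathMass Λ f) ∂Λ := by
    filter_upwards [htop] with f hf
    have hfm : Measurable fun t => ENNReal.ofReal (f.1 t) := by fun_prop
    rw [lintegral_const_mul _ (hfm.div_const _)]
    by_cases hfS : f ∈ S
    · by_cases hft : pathMass Λ f = ∞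
      · simp [hf hft]
      · simp_rw [div_eq_mul_inv]
        rw [lintegral_mul_const _ hfm, ← pathMass, ENNReal.mul_inv_cancel (hpos f hfS).ne' hft,
          mul_one]
    · simp [hfS]
  rw [lintegral_congr_ae h1, lintegral_transport hν hm]
  refine lintegral_congr_ae ?_
  filter_upwards [hone] with f hf
  -- Transport swaps the roles: the inserted density becomes the Λ-share at the origin, and the
  -- Λ'-share is now integrated along the orbit.
  have h2 : ∫⁻ t, S.indicator 1 (f.shift t) * originShare Λ' (f.shift t) *
      (ENNReal.ofReal ((f.shift t).1 t) / pathMass Λ (f.shift t)) ∂Λ =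
      ∫⁻ t, S.indicator 1 f * originShare Λ f * originShare Λ' (f.shift t) ∂Λ := by
    refine lintegral_congr_ae ?_
    filter_upwards [hΛ.ae_mem] with t ht
    rw [hΛ.pathMass_shift ht, CadlagPath.shift_apply, sub_self]
    have h3 : S.indicator (1 : CadlagPath d → ℝ≥0∞) (f.shift t) = S.indicator 1 f := by
      by_cases hfS : f ∈ S
      · simp [hfS, (hSshift t ht f).2 hfS]
      · simp [hfS, mt (hSshift t ht f).1 hfS]
    rw [h3, mul_assoc, mul_assoc, mul_comm (originShare Λ' _)]
    rfl
  have hφ' : Measurable fun t => originShare Λ' (f.shift t) :=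
    measurable_originShare.comp (by fun_prop : Measurable fun t => f.shift t)
  rw [h2, lintegral_const_mul _ hφ']
  by_cases h0 : originShare Λ f = 0
  · simp [h0]
  · rw [hf h0, mul_one]

/-- If almost every path of finite Lebesgue mass has positive and finite mass on each translate of
the lattice `ηℤ^d`, then the masses with respect to `λ_δ` and `λ_η` may be exchanged. -/
theorem lintegral_indicator_mul_originShare_latticeMeasure [SFinite P] (hY : Measurable Y)
    (hν : ∀ h, MeasurePreserving (CadlagPath.shift h) (exponentMeasure P Y) (exponentMeasure P Y))
    (hone : exponentMeasure P Y {f | 1 < f.1 0} = 1) {δ η : ℝ} (hδ : 0 ≤ δ) (hη : 0 < η)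
    (h : δ = 0 ∨ 0 < δ ∧ ∃ k : ℕ, η = k * δ)
    (hfin : ∀ r ∈ scaledLattice d δ, ∀ᵐ ω ∂P, pathMass volume (Y ω) < ∞ →
      0 < pathMass (latticeMeasure d η) ((Y ω).shift r) ∧
      pathMass (latticeMeasure d η) ((Y ω).shift r) < ∞) (X : ℝ≥0∞) :
    ∫⁻ f, {f | X < exceedance (latticeMeasure d δ) f Set.univ}.indicator 1 f *
        originShare (latticeMeasure d η) f ∂(exponentMeasure P Y) =
      ∫⁻ f, {f | X < exceedance (latticeMeasure d δ) f Set.univ}.indicator 1 f *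
        originShare (latticeMeasure d δ) f ∂(exponentMeasure P Y) := by
  have hsδ := sFinite_latticeMeasure (d := d) hδ
  have hsη := sFinite_latticeMeasure (d := d) hη.le
  have hΛ := isLatticeHaar_latticeMeasure (d := d) hδ
  have hH := fun l : Fin d → ℤ => latticePoint_mem_scaledLattice h l
  have hcell := latticeMeasure_latticeCell (d := d) hη h
  -- The mass hypothesis covers only paths of finite Lebesgue mass. For δ > 0 the share f(0)/S_δ
  -- integrates to at most one along the Lebesgue orbit, so it vanishes at almost every path of
  -- infinite Lebesgue mass.
  have hvol : ∀ᵐ f ∂(exponentMeasure P Y), originShare (latticeMeasure d δ) f ≠ 0 →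
      pathMass volume f < ∞ := by
    rcases h with rfl | ⟨hδ0, -⟩
    · rw [latticeMeasure_zero]
      refine Eventually.of_forall fun f hf => lt_top_iff_ne_top.2 fun htop => hf ?_
      rw [originShare, htop, ENNReal.div_top]
    · have hcell0 := latticeMeasure_latticeCell (d := d) hδ0 (Or.inl (rfl : (0 : ℝ) = 0))
      rw [latticeMeasure_zero] at hcell0
      filter_upwards [ae_eq_zero_of_pathMass_eq_top (Λ := volume) hY hν hone measurable_originShare
        (fun f => isLatticeHaar_volume.lintegral_originShare_shift_le hδ0 (fun _ => trivial) hcell0 f)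
        fun c f hc => originShare_scale hc f] with f hf hne
      exact lt_top_iff_ne_top.2 fun htop => hne (hf htop)
  have hshm : Measurable fun p : (Fin d → ℝ) × CadlagPath d =>
      pathMass (latticeMeasure d η) (p.2.shift p.1) :=
    measurable_pathMass.comp (by fun_prop :
      Measurable fun p : (Fin d → ℝ) × CadlagPath d => p.2.shift p.1)
  have hvm : Measurable fun p : (Fin d → ℝ) × CadlagPath d => pathMass volume p.2 :=
    measurable_pathMass.comp measurable_snd
  have hpm : MeasurableSet {p : (Fin d → ℝ) × CadlagPath d | pathMass volume p.2 < ∞ →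
      0 < pathMass (latticeMeasure d η) (p.2.shift p.1) ∧
      pathMass (latticeMeasure d η) (p.2.shift p.1) < ∞} :=
    (measurableSet_lt hvm measurable_const).imp
      ((measurableSet_lt measurable_const hshm).inter (measurableSet_lt hshm measurable_const))
  have hae : ∀ᵐ u ∂(latticeMeasure d δ), ∀ᵐ f ∂(exponentMeasure P Y), pathMass volume f < ∞ →
      0 < pathMass (latticeMeasure d η) (f.shift u) ∧
      pathMass (latticeMeasure d η) (f.shift u) < ∞ := by
    filter_upwards [hΛ.ae_mem] with u hu
    refine ae_exponentMeasure_of_ae hY (hpm.preimage (by fun_prop :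
      Measurable fun f : CadlagPath d => (u, f))) ?_
    filter_upwards [hfin u hu] with ω hω s hs hlt
    have hc : (0 : NNReal) < s.toNNReal⁻¹ := by simpa using hs
    have hc' : ((s.toNNReal⁻¹ : NNReal) : ℝ≥0∞) ≠ 0 := by simpa using hc.ne'
    rw [pathMass_scale] at hlt
    rw [CadlagPath.shift_scale, pathMass_scale]
    have hYω : pathMass volume (Y ω) < ∞ :=
      lt_top_iff_ne_top.2 fun htop => by rw [htop, ENNReal.mul_top hc'] at hlt; exact hlt.ne rfl
    exact ⟨ENNReal.mul_pos hc' (hω hYω).1.ne', ENNReal.mul_lt_top ENNReal.coe_lt_top (hω hYω).2⟩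
  refine hΛ.lintegral_indicator_mul_originShare hν
    (measurableSet_lt_exceedance X MeasurableSet.univ)
    (fun k hk f => by simp only [Set.mem_ofPred_eq, hΛ.exceedance_shift_univ hk])
    (fun f hf => pathMass_pos_of_exceedance_pos (zero_le.trans_lt hf))
    (ae_eq_zero_of_pathMass_eq_top hY hν hone measurable_originShare
      (fun f => hΛ.lintegral_originShare_shift_le hη hH hcell f)
      fun c f hc => originShare_scale hc f) ?_
  -- The hypothesis holds for each shift outside a null set depending on that shift; Tonelli yields
  -- it for almost every path at almost all shifts, even when the shifts are uncountable.
  filter_upwards [hvol, (Measure.ae_ae_comm hpm).1 hae] with f hf1 hf2 hne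
  refine hΛ.lintegral_originShare_shift_eq_one hη hH hcell ?_
  filter_upwards [hf2] with u hu using hu (hf1 hne)

end OriginShare

/-! ### Berman functionals in terms of the exponent measure. -/

section Translation

variable {d : ℕ} {Ω : Type*} [MeasurableSpace Ω] {P : Measure Ω} {Z : Ω → (Fin d → ℝ) → ℝ}
  {Y : Ω → CadlagPath d} {δ : ℝ}

theorem totalMass_eq_pathMass (hδ : 0 ≤ δ) (f : CadlagPath d) :
    totalMass δ f.1 = pathMass (latticeMeasure d δ) f := by
  have h := Measure.restrict_eq_self_of_ae_mem (isLatticeHaar_latticeMeasure (d := d) hδ).ae_mem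
  rw [totalMass, h, pathMass]

theorem sojourn_inter_scaledLattice (hδ : 0 ≤ δ) (f : CadlagPath d) (A : Set (Fin d → ℝ)) {s : ℝ}
    (hs : 0 < s) : sojourn δ f.1 (A ∩ scaledLattice d δ) s =
      exceedance (latticeMeasure d δ) (f.scale s.toNNReal⁻¹) A := by
  unfold sojourn exceedance
  refine measure_congr ?_
  filter_upwards [(isLatticeHaar_latticeMeasure (d := d) hδ).ae_mem] with t ht
  refine propext ?_
  change (t ∈ A ∩ scaledLattice d δ ∧ s < f.1 t) ↔ (t ∈ A ∧ 1 < (f.scale s.toNNReal⁻¹).1 t)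
  rw [CadlagPath.lt_scale_inv_iff hs, mul_one, Set.mem_inter_iff, and_iff_left ht]

/-- The level s is absorbed into the path: exceeding s is the same as s⁻¹Z exceeding one, and ds ⊗ P
is then pushed forward to the exponent measure. -/
theorem bermanAverage_eq [SFinite P] (hY : Measurable Y) (hYZ : ∀ᵐ ω ∂P, (Y ω).1 = Z ω)
    (hδ : 0 ≤ δ) (x T : ℝ) :
    bermanAverage P Z δ x T = exponentMeasure P Y
      {f | ENNReal.ofReal x < exceedance (latticeMeasure d δ) f (box d 0 T)} /
        ENNReal.ofReal (T ^ d) := by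
  have hsδ := sFinite_latticeMeasure (d := d) hδ
  rw [bermanAverage, bermanOn,
    exponentMeasure_apply hY (measurableSet_lt_exceedance _ (measurableSet_box _ _))]
  congr 1
  refine setLIntegral_congr_fun measurableSet_Ioi fun s hs => measure_congr ?_
  filter_upwards [hYZ] with ω hω
  refine propext ?_
  change ENNReal.ofReal x < sojourn δ (Z ω) (cube d T ∩ scaledLattice d δ) s ↔
    ENNReal.ofReal x < exceedance (latticeMeasure d δ) ((Y ω).scale s.toNNReal⁻¹) (box d 0 T)
  rw [← hω, sojourn_inter_scaledLattice hδ _ _ hs, cube_eq_box]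

/-- The quotient Z(0)/S_η is scale invariant, so it may be evaluated at s⁻¹Z instead of Z. -/
theorem bermanFormula_eq [SFinite P] (hY : Measurable Y) (hYZ : ∀ᵐ ω ∂P, (Y ω).1 = Z ω)
    (hδ : 0 ≤ δ) {η : ℝ} (hη : 0 ≤ η) (x : ℝ) :
    bermanFormula P Z δ η x = ∫⁻ f,
      {f | ENNReal.ofReal x < exceedance (latticeMeasure d δ) f Set.univ}.indicator 1 f *
        originShare (latticeMeasure d η) f ∂(exponentMeasure P Y) := by
  have hsδ := sFinite_latticeMeasure (d := d) hδ
  have hsη := sFinite_latticeMeasure (d := d) hη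
  have hS := measurableSet_lt_exceedance (Λ := latticeMeasure d δ) (ENNReal.ofReal x)
    MeasurableSet.univ
  have hm : Measurable fun f : CadlagPath d =>
      {f | ENNReal.ofReal x < exceedance (latticeMeasure d δ) f Set.univ}.indicator 1 f *
        originShare (latticeMeasure d η) f :=
    (measurable_one.indicator hS).mul measurable_originShare
  rw [bermanFormula, lintegral_exponentMeasure hY hm]
  refine setLIntegral_congr_fun measurableSet_Ioi fun s hs => lintegral_congr_ae ?_
  filter_upwards [hYZ] with ω hω
  have hs' : (0 : ℝ) < s := hs
  have hsoj := sojourn_inter_scaledLattice hδ (Y ω) Set.univ hs'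
  rw [Set.univ_inter] at hsoj
  rw [← hω, totalMass_eq_pathMass hη, hsoj, originShare_scale (by simpa using hs'),
    mul_comm]
  simp only [Set.indicator_apply, Set.mem_ofPred_eq, Pi.one_apply]
  rfl

end Translation

theorem mainTheorem1 {d : ℕ} (hd : 1 ≤ d)
    {Ω : Type*} [MeasurableSpace Ω] (P : Measure Ω) [IsProbabilityMeasure P]
    (Z : Ω → (Fin d → ℝ) → ℝ) (hZ : IsNormalisedField P Z)
    {Ω' : Type*} [MeasurableSpace Ω'] (P' : Measure Ω') [IsProbabilityMeasure P']
    (V : ℕ → Ω' → ℝ) (W : ℕ → Ω' → (Fin d → ℝ) → ℝ) (hVW : IsDeHaanInput P Z P' V W)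
    (hX : IsStationaryField P' (maxStableField V W))
    (hS : P {ω | totalMass 0 (Z ω) = ∞} < 1)
    (δ x : ℝ) (hδ : 0 ≤ δ) (hx : 0 ≤ x) :
    Tendsto (bermanAverage P Z δ x) atTop (𝓝 (bermanFunction P Z δ x)) ∧
    bermanFunction P Z δ x = bermanFormula P Z δ δ x ∧
    bermanFormula P Z δ δ x < ∞ ∧
    ∀ η : ℝ, (δ = 0 ∧ 0 < η) ∨ (0 < δ ∧ ∃ k : ℕ, 1 ≤ k ∧ η = k * δ) →
      (∀ r ∈ scaledLattice d δ, ∀ᵐ ω ∂P, totalMass 0 (Z ω) < ∞ →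
        0 < totalMass η (fieldShift r (Z ω)) ∧ totalMass η (fieldShift r (Z ω)) < ∞) →
      bermanFunction P Z δ x = bermanFormula P Z δ η x ∧ bermanFormula P Z δ η x < ∞ := by
  obtain ⟨Y, hY, hYZ⟩ := hZ.exists_version
  have hΛ := isLatticeHaar_latticeMeasure (d := d) hδ
  have hsδ := sFinite_latticeMeasure (d := d) hδ
  have hν := measurePreserving_shift hZ hVW hX hY hYZ
  have hone := exponentMeasure_one_lt hZ hY hYZ 0
  have hnear := exponentMeasure_nearSet_ne_top (Λ := latticeMeasure d δ) hZ hY hYZ hν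
  have hformula : bermanFormula P Z δ δ x = tiltedMeasure (latticeMeasure d δ)
      (exponentMeasure P Y)
      {f | ENNReal.ofReal x < exceedance (latticeMeasure d δ) f Set.univ} := by
    rw [bermanFormula_eq hY hYZ hδ hδ,
      tiltedMeasure_apply (measurableSet_lt_exceedance _ MeasurableSet.univ)]
    rfl
  have hlim : Tendsto (bermanAverage P Z δ x) atTop (𝓝 (bermanFormula P Z δ δ x)) := by
    rw [hformula, funext fun T => bermanAverage_eq hY hYZ hδ x T]
    exact hΛ.tendsto_measure_exceedance hν hnear (hΛ.ae_exceedance_zero_or_top hY hν hone) _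
  have heq : bermanFunction P Z δ x = bermanFormula P Z δ δ x := hlim.limUnder_eq
  have hfinite : bermanFormula P Z δ δ x < ∞ := by
    rw [hformula]
    exact hΛ.tiltedMeasure_lt_top hν hnear _
  refine ⟨by rwa [heq], heq, hfinite, fun η hη hmass => ?_⟩
  have hη0 : 0 < η := by
    rcases hη with ⟨-, h⟩ | ⟨h, k, hk, rfl⟩
    · exact h
    · exact mul_pos (Nat.cast_pos.2 hk) h
  have hδη : δ = 0 ∨ 0 < δ ∧ ∃ k : ℕ, η = k * δ :=
    hη.imp And.left fun h => ⟨h.1, h.2.imp fun _ => And.right⟩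
  have hfin : ∀ r ∈ scaledLattice d δ, ∀ᵐ ω ∂P, pathMass volume (Y ω) < ∞ →
      0 < pathMass (latticeMeasure d η) ((Y ω).shift r) ∧
      pathMass (latticeMeasure d η) ((Y ω).shift r) < ∞ := fun r hr => by
    filter_upwards [hmass r hr, hYZ] with ω hω hYω
    rw [← hYω, totalMass_eq_pathMass le_rfl, latticeMeasure_zero] at hω
    rwa [← totalMass_eq_pathMass hη0.le]
  have hexch : bermanFormula P Z δ η x = bermanFormula P Z δ δ x := by
    rw [bermanFormula_eq hY hYZ hδ hη0.le, bermanFormula_eq hY hYZ hδ hδ]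
    exact lintegral_indicator_mul_originShare_latticeMeasure hY hν hone hδ hη0 hδη hfin _
  rw [hexch]
  exact ⟨heq, hfinite⟩
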